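/- **Setting.** Let $T>0$, $r\in\mathbb R$, $M>0$, $\alpha\in(1,2]$, and let $L$ be a nonzero $d$-dimensional $\alpha$-stable Lévy process, i.e. a Lévy process with $t^{-1/\alpha}L_t\overset{d}{=}L_1$ for all $t>0$ and not $L_1=0$ a.s.; if $\alpha=2$, then $L$ is a Brownian motion whose coordinates are standard and have a positive definite correlation matrix. Let $\mu:[0,T]\to\mathbb R^d$ and $\sigma:[0,T]\to\mathbb R^{d\times d}$ be continuous with $\sigma_t$ symmetric, positive definite, and $\sigma^{ij}_t>0$ for all $i,j,t$. Assume that either * $L$ is symmetric ($L\overset{d}{=}-L$), with $K:=[-M,M]^d$, or * $d=1$ and short selling is prohibited, with $K:=[0,M]$. Controls are the deterministic càglàd functions $u:[0,T]\to K$. For a control $u$ and $(t,x)\in[0,T)\times\mathbb R$, let $X^{u}=X^{t,x,u}$ be the wealth process on $[t,T]$ with $X_t^{u}=x$ and $$\mathrm dX^u_s=\Big[rX^u_s+\sum_i u^i_s(\mu^i_s-r)\Big]\mathrm ds+\sum_{i,j}u^i_s\sigma^{ij}_s\,\mathrm dL^j_s,$$ and let $\mathbb E_{t,x}$ and $\rho_{t,x}$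 denote expectation and risk measure applied to functionals of this process started at $(t,x)$. Let $\mathcal T\in C^1(\mathbb R)$ be non-decreasing and concave, $F\in C^1(\mathbb R)$ non-decreasing and convex, and $\lambda:[0,T]\to(0,\infty)$. Let $\rho$ be a functional of real random variables with values in $\mathbb R\cup\{+\infty\}$ that is law-invariant, positively homogeneous ($\rho(\beta Y)=\beta\rho(Y)$ for $\beta\ge0$, with $0\cdot\infty=0$), and either cash-invariant ($\rho(Y+c)=\rho(Y)-c$ for all $c\in\mathbb R$) or shift-invariant ($\rho(Y+c)=\rho(Y)$ for all $c\in\mathbb R$). Assume that $\rho(L_1^j)<\infty$ and $\mathbb E|\mathcal T(a+bL^j_t)|<\infty$ for all $j$, all $a,b\in\mathbb R$ and all $t\in(0,T]$. Put $$J(t,x,u)=\mathbb E_{t,x}\big[\mathcal T(X^u_T-xe^{r(T-t)})\big]-\lambda_tF\big(\rho_{t,x}(X^u_T-xe^{r(T-t)})\big).$$ A control $\hat u$ is called *optimal* (a Nash equilibrium) if for all $(t,x)\in[0,T)\times\mathbb R$ and all controls $u$ $$\liminf_{h\downarrow0}\frac{J(t,x,\hat u)-J(t,x,u_h)}{h}\ge0,$$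 where $u_h$ equals $u$ on $[t,t+h]$ and $\hat u$ on $(t+h,T]$. **Proposition.** Assume in addition that 1. $\mathbb E|L^j_t\,\mathcal T'(a+bL^j_t)|<\infty$ for all $j$, all $a,b\in\mathbb R$ and all $t\in(0,T]$; 2. $\hat u$ is an optimal control that is continuous on $[0,T]$; 3. $\lambda\in C^1([0,T])$. Then, for all $(t,x)\in[0,T)\times\mathbb R$, the number $\rho_{t,x}(X^{\hat u}_T-xe^{r(T-t)})$ is finite and $\mathcal T(X_T^{\hat u}-xe^{r(T-t)})$ is integrable, and the functions $$(t,x)\mapsto\lambda_tF\big(\rho_{t,x}(X_T^{\hat u}-xe^{r(T-t)})\big)\qquad\text{and}\qquad(t,x)\mapsto\mathbb E_{t,x}\big[\mathcal T(X_T^{\hat u}-xe^{r(T-t)})\big]$$ belong to $C^{1,2}([0,T)\times\mathbb R)$: they, their first derivatives in $t$ (one-sided at $t=0$) and their first and second derivatives in $x$ exist and are jointly continuous on $[0,T)\times\mathbb R$. -/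

import Mathlib

open MeasureTheory ProbabilityTheory Filter Set
open scoped Topology NNReal

namespace StableMarket

noncomputable section

/-- `f` is right-continuous on `[a, b)` and has left limits on `(a, b]`. -/
def IsCadlagOn {E : Type*} [TopologicalSpace E] (f : ℝ → E) (a b : ℝ) : Prop :=
  (∀ s ∈ Ico a b, ContinuousWithinAt f (Ici s) s) ∧
    ∀ s ∈ Ioc a b, ∃ l, Tendsto f (𝓝[<] s) (𝓝 l)

/-- `f` is left-continuous on `(a, b]` and has right limits on `[a, b)`. -/
def IsCagladOn {E : Type*} [TopologicalSpace E] (f : ℝ → E) (a b : ℝ) : Prop :=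
  (∀ s ∈ Ioc a b, ContinuousWithinAt f (Iic s) s) ∧
    ∀ s ∈ Ico a b, ∃ l, Tendsto f (𝓝[>] s) (𝓝 l)

variable {Ω : Type*} [MeasurableSpace Ω] {d : ℕ}

/-- A `d`-dimensional Lévy process (only the times `t ≥ 0` matter): it starts at `0`, has almost
surely càdlàg paths, and independent and stationary increments. -/
structure IsLevy (P : Measure Ω) (L : ℝ → Ω → Fin d → ℝ) : Prop where
  measurable : ∀ t, 0 ≤ t → Measurable (L t)
  zero : ∀ᵐ ω ∂P, L 0 ω = 0
  cadlag : ∀ᵐ ω ∂P, ∀ b, 0 < b → IsCadlagOn (fun t => L t ω) 0 b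
  indep : HasIndepIncrements (fun (t : ℝ≥0) (ω : Ω) => L t ω) P
  stationary : ∀ s t, 0 ≤ s → s ≤ t → IdentDistrib (L t - L s) (L (t - s)) P P

/-- A nonzero `α`-stable Lévy process with `α ∈ (1, 2]`. For `α = 2` it is a Brownian motion whose
coordinates are standard and have a positive definite correlation matrix `R`, i.e.
`⟨a, L t⟩ ∼ N(0, t aᵀ R a)` for every vector `a`. -/
structure IsStableLevy (P : Measure Ω) (α : ℝ) (L : ℝ → Ω → Fin d → ℝ) : Prop
    extends IsLevy P L where
  one_lt : 1 < α
  le_two : α ≤ 2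
  stable : ∀ t, 0 < t → IdentDistrib (t ^ (-(1 / α)) • L t) (L 1) P P
  nonzero : ¬ ∀ᵐ ω ∂P, L 1 ω = 0
  brownian : α = 2 → ∃ R : Matrix (Fin d) (Fin d) ℝ, R.PosDef ∧ (∀ j, R j j = 1) ∧
    ∀ t, 0 ≤ t → ∀ a : Fin d → ℝ,
      P.map (fun ω => a ⬝ᵥ L t ω) = gaussianReal 0 (t * (a ⬝ᵥ R.mulVec a)).toNNReal

/-- Symmetry in law: `L` and `-L` have the same distribution. -/
def IsSymmetric (P : Measure Ω) (L : ℝ → Ω → Fin d → ℝ) : Prop :=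
  ∀ t, 0 ≤ t → IdentDistrib (L t) (-L t) P P

/-- The coefficients of a market with `d` risky assets over `[0, T]`: interest rate `r`, drift `μ`
and volatility `σ`. -/
structure Market (d : ℕ) where
  T : ℝ
  r : ℝ
  μ : ℝ → Fin d → ℝ
  σ : ℝ → Matrix (Fin d) (Fin d) ℝ
  T_pos : 0 < T
  continuousOn_μ : ContinuousOn μ (Icc 0 T)
  continuousOn_σ : ContinuousOn σ (Icc 0 T)
  σ_pos : ∀ t ∈ Icc 0 T, ∀ i j, 0 < σ t i j
  σ_posDef : ∀ t ∈ Icc 0 T, (σ t).PosDef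

/-- `∑ⱼ ∑ₖ Hʲ(pₖ) (Lʲ(pₖ₊₁) - Lʲ(pₖ))`, with `k` ranging over `0, …, N - 1`. -/
def riemannSum (L : ℝ → Ω → Fin d → ℝ) (H : ℝ → Fin d → ℝ) (N : ℕ) (p : ℕ → ℝ) (ω : Ω) : ℝ :=
  ∑ k ∈ Finset.range N, H (p k) ⬝ᵥ (L (p (k + 1)) ω - L (p k) ω)

/-- `I` is (a version of) the stochastic integral `∑ⱼ ∫_{a+}^b Hʲ dLʲ` of the deterministic function
`H`: the limit in probability of the Riemann sums along all sequences of partitions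
`a = p 0 ≤ … ≤ p N = b` whose mesh tends to `0`. For càglàd `H` and a semimartingale `L` this is the
usual stochastic integral. It determines `I` up to null sets. -/
def IsStochIntegral (P : Measure Ω) (L : ℝ → Ω → Fin d → ℝ) (H : ℝ → Fin d → ℝ) (a b : ℝ)
    (I : Ω → ℝ) : Prop :=
  ∀ (N : ℕ → ℕ) (p : ℕ → ℕ → ℝ), (∀ n, Monotone (p n)) → (∀ n, p n 0 = a) →
    (∀ n, p n (N n) = b) →
    (∀ ε > 0, ∀ᶠ n in atTop, ∀ k < N n, p n (k + 1) - p n k < ε) →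
    TendstoInMeasure P (fun n => riemannSum L H (N n) (p n)) atTop I

/-- `X` is the wealth process on `[t, T]` started from wealth `x` at time `t` under the deterministic
strategy `u` (amounts of money invested in the risky assets), i.e. the càdlàg solution of
`dX_s = [r X_s + ∑ᵢ uⁱ_s (μⁱ_s - r)] ds + ∑ᵢⱼ uⁱ_s σⁱʲ_s dLʲ_s`, `X_t = x`. -/
structure IsWealth (P : Measure Ω) (L : ℝ → Ω → Fin d → ℝ) (m : Market d) (u : ℝ → Fin d → ℝ)
    (t x : ℝ) (X : ℝ → Ω → ℝ) : Prop where
  aemeasurable : ∀ s ∈ Icc t m.T, AEMeasurable (X s) P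
  cadlag : ∀ᵐ ω ∂P, IsCadlagOn (fun s => X s ω) t m.T
  equation : ∀ s ∈ Icc t m.T, IsStochIntegral P L (fun v => Matrix.vecMul (u v) (m.σ v)) t s
    (fun ω => X s ω - x - ∫ v in t..s, (m.r * X v ω + ∑ i, u v i * (m.μ v i - m.r)))

/-- The gain `Y - x e^{r(T-t)}` at time `T` of terminal wealth `Y` against wealth `x` at time `t`. -/
def gain (m : Market d) (t x : ℝ) (Y : Ω → ℝ) (ω : Ω) : ℝ :=
  Y ω - x * Real.exp (m.r * (m.T - t))

/-- Law-invariant, positively homogeneous functionals with values in `ℝ ∪ {+∞}` which are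
cash-invariant or shift-invariant. A functional given on a smaller class of random variables
is extended by the value `+∞`. -/
structure IsRiskMeasure (P : Measure Ω) (ρ : (Ω → ℝ) → EReal) : Prop where
  ne_bot : ∀ Y, AEMeasurable Y P → ρ Y ≠ ⊥
  law_invariant : ∀ Y₁ Y₂, IdentDistrib Y₁ Y₂ P P → ρ Y₁ = ρ Y₂
  pos_homogeneous : ∀ Y, AEMeasurable Y P → ∀ β : ℝ, 0 ≤ β → ρ (fun ω => β * Y ω) = β * ρ Y
  cash_or_shift :
    (∀ Y, AEMeasurable Y P → ∀ c : ℝ, ρ (fun ω => Y ω + c) = ρ Y - c) ∨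
    (∀ Y, AEMeasurable Y P → ∀ c : ℝ, ρ (fun ω => Y ω + c) = ρ Y)

/-- The preferences of the investor: target function `U` for the gain, penalty function `F`,
risk aversion `lam` and risk measure `ρ`. -/
structure Preferences (Ω : Type*) where
  U : ℝ → ℝ
  F : ℝ → ℝ
  lam : ℝ → ℝ
  ρ : (Ω → ℝ) → EReal

/-- The expected target value `E_{t,x}[U(X_T - x e^{r(T-t)})]`, where `Y = X_T`. -/
def expectedTarget (P : Measure Ω) (m : Market d) (pr : Preferences Ω) (t x : ℝ) (Y : Ω → ℝ) : ℝ :=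
  ∫ ω, pr.U (gain m t x Y ω) ∂P

/-- The risk term `λ_t F(ρ_{t,x}(X_T - x e^{r(T-t)}))`, where `Y = X_T`. It is used only where the
risk measure is finite. -/
def riskPenalty (m : Market d) (pr : Preferences Ω) (t x : ℝ) (Y : Ω → ℝ) : ℝ :=
  pr.lam t * pr.F (pr.ρ (gain m t x Y)).toReal

/-- The value functional: expected target minus risk term. -/
def value (P : Measure Ω) (m : Market d) (pr : Preferences Ω) (t x : ℝ) (Y : Ω → ℝ) : ℝ :=
  expectedTarget P m pr t x Y - riskPenalty m pr t x Y

/-- Deterministic càglàd strategies on `[0, T]` with values in `K`. -/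
def IsControl (m : Market d) (K : Set (Fin d → ℝ)) (u : ℝ → Fin d → ℝ) : Prop :=
  IsCagladOn u 0 m.T ∧ ∀ s ∈ Icc 0 m.T, u s ∈ K

/-- The strategy that follows `u` up to and including time `τ`, and `v` after `τ`. -/
def switchAt (τ : ℝ) (u v : ℝ → Fin d → ℝ) (s : ℝ) : Fin d → ℝ :=
  if s ≤ τ then u s else v s

/-- `v` is a Nash equilibrium control: from no state `(t, x)` is it profitable, to first order in
`h`, to follow another strategy `u` during the time interval `[t, t + h]` and `v` thereafter.
Here `X` and `Y h` are the corresponding wealth processes; the difference quotients are read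
in `EReal`, so that the limit inferior may be infinite. -/
def IsEquilibrium (P : Measure Ω) (L : ℝ → Ω → Fin d → ℝ) (m : Market d) (pr : Preferences Ω)
    (K : Set (Fin d → ℝ)) (v : ℝ → Fin d → ℝ) : Prop :=
  IsControl m K v ∧
  ∀ t ∈ Ico 0 m.T, ∀ x : ℝ, ∀ u, IsControl m K u →
    ∀ (X : ℝ → Ω → ℝ) (Y : ℝ → ℝ → Ω → ℝ), IsWealth P L m v t x X →
      (∀ᶠ h in 𝓝[>] (0 : ℝ), IsWealth P L m (switchAt (t + h) u v) t x (Y h)) →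
      0 ≤ liminf (fun h : ℝ =>
        (((value P m pr t x (X m.T) - value P m pr t x (Y h m.T)) / h : ℝ) : EReal)) (𝓝[>] 0)

/-- `f` is of class `C^{1,2}` on `[0, T) × ℝ`: `f`, `∂f/∂t`, `∂f/∂x` and `∂²f/∂x²` exist and are
jointly continuous there (the time derivative at `0` is the right derivative). -/
def IsC12On (T : ℝ) (f : ℝ → ℝ → ℝ) : Prop :=
  ∃ ft fx fxx : ℝ → ℝ → ℝ,
    (∀ t ∈ Ico 0 T, ∀ x, HasDerivWithinAt (fun s => f s x) (ft t x) (Ico 0 T) t) ∧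
    (∀ t ∈ Ico 0 T, ∀ x, HasDerivAt (f t) (fx t x) x) ∧
    (∀ t ∈ Ico 0 T, ∀ x, HasDerivAt (fx t) (fxx t x) x) ∧
    ContinuousOn (Function.uncurry f) (Ico 0 T ×ˢ univ) ∧
    ContinuousOn (Function.uncurry ft) (Ico 0 T ×ˢ univ) ∧
    ContinuousOn (Function.uncurry fx) (Ico 0 T ×ˢ univ) ∧
    ContinuousOn (Function.uncurry fxx) (Ico 0 T ×ˢ univ)

end

end StableMarket

/-!
Strategies are deterministic, so the gain from time `t` on has an explicit law. Fix a coordinate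
`Z = Lʲ₁` that is not almost surely zero. For every admissible exposure `H` the increment
`⟨H, L t - L s⟩` is distributed as `((t - s) ψ(H))^{1/α} Z`, where `ψ` is the normalized
characteristic exponent in the symmetric case and `|H|^α` for a single asset without short selling
(`IsScale`). Hence the gain has the law of `A(t) + B(t)^{1/α} Z` with
`A(t) = ∫ e^{r(T-s)} ⟨u, μ - r⟩ ds` and `B(t) = ∫ e^{α r(T-s)} ψ(u σ) ds` over `[t, T]`
(`IsScale.identDistrib_gain`). In particular both functions of the theorem do not depend on `x`, and
only their regularity in `t` is at stake.

The function `(a, b) ↦ E U(a + b Z)` is continuously differentiable, because `U'` is monotone, and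
the risk of `a + b Z` is affine for `b ≥ 0`. So both functions are of class `C¹` in time wherever
`B > 0`, and also after the first time `t*` at which `B` vanishes, since `B` vanishes from then on.
The difficulty is the time `t*` itself, if `0 < t* < T`: the root `B^{1/α}` need not be
differentiable there. This is where the equilibrium property enters; to use it, wealth processes of
deviating strategies are constructed (`exists_isWealth_switch`).

* Before `t*`, deviations of constant exposure give a first-order condition
  (`IsProblem.local_optimality`): the equilibrium position maximizes the marginal value of the
  location less the marginal cost of the scale. Comparison with a position whose exposure is nearly
  that at time `t*`, which is not exposed to noise, shows that the marginal cost of the scale times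
  the derivative of `B^{1/α}` has a nonnegative lower limit at `t*`
  (`IsProblem.eventually_neg_le_marginalScale`).
* The marginal cost of the scale is the sum of a term from the risk and a term from the target. The
  latter is nonnegative, since `U` is concave and `E Z = 0`. If `ρ(Z) ≥ 0`, so is the former. If
  `ρ(Z) < 0`, then a deviation of length `h` after `t*` would gain a multiple of `h^{1/α} ≫ h`
  unless the marginal penalty vanishes at `t*` (`IsProblem.deriv_F_eq_zero`), and from there it is
  shown to vanish also shortly before `t*` (`IsProblem.eventually_risk_nonneg`).

As the derivative of `B^{1/α}` is nonpositive, both terms times this derivative tend to `0` at `t*`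
(`IsProblem.tendsto_scale_contribution`), so the time derivatives of the two functions extend
continuously through `t*` (`IsProblem.exists_continuousOn_deriv`).
-/

namespace StableMarket

variable {Ω : Type*} [MeasurableSpace Ω] {P : Measure Ω} {d : ℕ}
  {α : ℝ} {L : ℝ → Ω → Fin d → ℝ}

/-! ### One-dimensional projections of a stable Lévy process -/

lemma measurable_dotProduct_left (H : Fin d → ℝ) : Measurable fun y : Fin d → ℝ => H ⬝ᵥ y := by
  unfold dotProduct
  fun_prop

lemma IsStableLevy.alpha_pos (hL : IsStableLevy P α L) : 0 < α := by linarith [hL.one_lt]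

lemma IsStableLevy.identDistrib_smul (hL : IsStableLevy P α L) {t : ℝ} (ht : 0 ≤ t) :
    IdentDistrib (L t) (t ^ (1 / α) • L 1) P P := by
  have hα := hL.alpha_pos
  have hm := hL.measurable
  rcases ht.eq_or_lt with rfl | ht
  · rw [Real.zero_rpow (by positivity), zero_smul]
    exact IdentDistrib.of_ae_eq (hm 0 le_rfl).aemeasurable hL.zero
  · have h := (hL.stable t ht).comp (u := fun y : Fin d → ℝ => t ^ (1 / α) • y)
      (measurable_const_smul _)
    have e : (fun y : Fin d → ℝ => t ^ (1 / α) • y) ∘ (t ^ (-(1 / α)) • L t) = L t := by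
      funext ω
      simp only [Function.comp_apply, Pi.smul_apply, smul_smul]
      rw [← Real.rpow_add ht]
      simp
    rw [e] at h
    exact h

lemma IsStableLevy.charFun_dotProduct (hL : IsStableLevy P α L) (H : Fin d → ℝ) {t : ℝ}
    (ht : 0 ≤ t) (θ : ℝ) :
    charFun (P.map fun ω => H ⬝ᵥ L t ω) θ
      = charFun (P.map fun ω => H ⬝ᵥ L 1 ω) (t ^ (1 / α) * θ) := by
  have h := (hL.identDistrib_smul ht).comp (measurable_dotProduct_left H)
  have e : (fun y : Fin d → ℝ => H ⬝ᵥ y) ∘ (t ^ (1 / α) • L 1)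
      = fun ω => t ^ (1 / α) * (H ⬝ᵥ L 1 ω) := by
    funext ω
    simp [dotProduct_smul]
  rw [e] at h
  have h2 := h.map_eq
  have h3 : (fun ω => H ⬝ᵥ L t ω) = (fun y : Fin d → ℝ => H ⬝ᵥ y) ∘ L t := rfl
  rw [h3, h2, charFun_map_mul_comp]
  exact ((measurable_dotProduct_left H).comp (hL.measurable 1 zero_le_one)).aemeasurable

lemma IsLevy.charFun_increment (hL : IsLevy P L) (H : Fin d → ℝ) {s t : ℝ} (hs : 0 ≤ s)
    (hst : s ≤ t) (θ : ℝ) :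
    charFun (P.map fun ω => H ⬝ᵥ (L t ω - L s ω)) θ
      = charFun (P.map fun ω => H ⬝ᵥ L (t - s) ω) θ := by
  have h := ((hL.stationary s t hs hst).comp (measurable_dotProduct_left H)).map_eq
  have h3 : (fun ω => H ⬝ᵥ (L t ω - L s ω)) = (fun y : Fin d → ℝ => H ⬝ᵥ y) ∘ (L t - L s) := rfl
  rw [h3, h]
  rfl

lemma IsLevy.charFun_dotProduct_add [IsProbabilityMeasure P] (hL : IsLevy P L) (H : Fin d → ℝ)
    {s t : ℝ} (hs : 0 ≤ s) (ht : 0 ≤ t) (θ : ℝ) :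
    charFun (P.map fun ω => H ⬝ᵥ L (s + t) ω) θ
      = charFun (P.map fun ω => H ⬝ᵥ L s ω) θ * charFun (P.map fun ω => H ⬝ᵥ L t ω) θ := by
  have hi := hL.indep.indepFun_eval_sub (r := ⟨0, le_rfl⟩) (s := ⟨s, hs⟩)
    (t := ⟨s + t, by positivity⟩) hs (by
      change s ≤ s + t
      linarith) hL.zero
  have hi2 := hi.comp (measurable_dotProduct_left H) (measurable_dotProduct_left H)
  have m1 : AEMeasurable ((fun y : Fin d → ℝ => H ⬝ᵥ y) ∘ L s) P :=
    ((measurable_dotProduct_left H).comp (hL.measurable s hs)).aemeasurable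
  have m2 : AEMeasurable ((fun y : Fin d → ℝ => H ⬝ᵥ y) ∘ (L (s + t) - L s)) P :=
    ((measurable_dotProduct_left H).comp
      ((hL.measurable _ (by positivity)).sub (hL.measurable s hs))).aemeasurable
  have h := congrFun (hi2.charFun_map_add_eq_mul m1 m2) θ
  have e : (fun y : Fin d → ℝ => H ⬝ᵥ y) ∘ L s + (fun y : Fin d → ℝ => H ⬝ᵥ y) ∘ (L (s + t) - L s)
      = fun ω => H ⬝ᵥ L (s + t) ω := by
    funext ω
    simp [dotProduct_sub]
  have h1 := hL.charFun_increment H hs (show s ≤ s + t by linarith) θ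
  rw [add_sub_cancel_left] at h1
  rw [← h1, ← e]
  exact h

/-- The stochastic integrals of deterministic integrands with values in the cone `C` have, up to a
deterministic scale, the law of a single random variable `Z`: if `H ∈ C`, then `⟨H, L t - L s⟩` is
distributed as `((t - s) ψ(H))^{1/α} Z`. The laws are compared through characteristic functions. -/
structure IsScale (P : Measure Ω) (α : ℝ) (L : ℝ → Ω → Fin d → ℝ) (C : Set (Fin d → ℝ))
    (Z : Ω → ℝ) (ψ : (Fin d → ℝ) → ℝ) : Prop where
  measurable : Measurable Z
  smul_mem : ∀ c : ℝ, 0 ≤ c → ∀ H ∈ C, c • H ∈ C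
  continuous : Continuous ψ
  nonneg : ∀ H, 0 ≤ ψ H
  map_smul : ∀ c : ℝ, 0 ≤ c → ∀ H, ψ (c • H) = c ^ α * ψ H
  charFun_increment : ∀ H ∈ C, ∀ s t, 0 ≤ s → s ≤ t → ∀ θ,
    charFun (P.map fun ω => H ⬝ᵥ (L t ω - L s ω)) θ
      = charFun (P.map Z) (((t - s) * ψ H) ^ (1 / α) * θ)
  charFun_add : ∀ a b : ℝ, 0 ≤ a → 0 ≤ b → ∀ θ,
    charFun (P.map Z) ((a + b) ^ (1 / α) * θ)
      = charFun (P.map Z) (a ^ (1 / α) * θ) * charFun (P.map Z) (b ^ (1 / α) * θ)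

/-- The law of a step-function integral against `L`. -/
lemma IsScale.charFun_sum [IsProbabilityMeasure P] {C : Set (Fin d → ℝ)} {Z : Ω → ℝ}
    {ψ : (Fin d → ℝ) → ℝ} (hS : IsScale P α L C Z ψ) (hL : IsLevy P L) (hα : 0 < α)
    (p : ℕ → ℝ) (hp : Monotone p) (hp0 : 0 ≤ p 0) (N : ℕ) (H : ℕ → Fin d → ℝ)
    (hH : ∀ k < N, H k ∈ C) (θ : ℝ) :
    charFun (P.map fun ω => ∑ k ∈ Finset.range N, H k ⬝ᵥ (L (p (k + 1)) ω - L (p k) ω)) θ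
      = charFun (P.map Z)
        ((∑ k ∈ Finset.range N, (p (k + 1) - p k) * ψ (H k)) ^ (1 / α) * θ) := by
  have hpk : ∀ k, 0 ≤ p k := fun k => hp0.trans (hp (Nat.zero_le k))
  have hi := hL.indep.nat (t := fun k => (⟨p k, hpk k⟩ : ℝ≥0)) (fun i j hij => hp hij)
  have hi2 := hi.comp (fun k y => H k ⬝ᵥ y) (fun k => measurable_dotProduct_left (H k))
  have hm : ∀ k ∈ Finset.range N, AEMeasurable
      (fun ω => H k ⬝ᵥ (L (p (k + 1)) ω - L (p k) ω)) P := fun k _ =>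
    ((measurable_dotProduct_left (H k)).comp
      ((hL.measurable _ (hpk _)).sub (hL.measurable _ (hpk k)))).aemeasurable
  have h := congrFun (iIndepFun.charFun_map_fun_finsetSum_eq_prod (s := Finset.range N) hm
    (hi2.restrict _)) θ
  rw [h, Finset.prod_apply]
  clear h hm hi2 hi
  induction N with
  | zero =>
    have : IsProbabilityMeasure (P.map Z) :=
      Measure.isProbabilityMeasure_map hS.measurable.aemeasurable
    simp only [Finset.range_zero, Finset.prod_empty, Finset.sum_empty]
    rw [Real.zero_rpow (by positivity), zero_mul, charFun_zero]
    simp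
  | succ n ih =>
    rw [Finset.prod_range_succ, Finset.sum_range_succ, ih (fun k hk => hH k (by omega)),
      hS.charFun_add, hS.charFun_increment _ (hH n (by omega)) _ _ (hpk n) (hp (Nat.le_succ n))]
    · exact Finset.sum_nonneg fun k _ =>
        mul_nonneg (sub_nonneg.2 (hp (Nat.le_succ k))) (hS.nonneg _)
    · exact mul_nonneg (sub_nonneg.2 (hp (Nat.le_succ n))) (hS.nonneg _)

variable {Ω : Type*} [MeasurableSpace Ω] {P : Measure Ω} {d : ℕ}
  {α : ℝ} {L : ℝ → Ω → Fin d → ℝ}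

/-! ### The scale of a stable process -/

/-- Some coordinate of a nonzero stable process does not vanish. -/
lemma IsStableLevy.exists_coord (hL : IsStableLevy P α L) :
    ∃ j, ¬ ∀ᵐ ω ∂P, L 1 ω j = 0 := by
  by_contra! h
  refine hL.nonzero ?_
  filter_upwards [ae_all_iff.2 h] with ω hω
  exact funext hω

lemma IsStableLevy.measurable_coord (hL : IsStableLevy P α L) (j : Fin d) :
    Measurable fun ω => L 1 ω j :=
  (measurable_pi_apply j).comp (hL.measurable 1 zero_le_one)

lemma IsStableLevy.charFun_coord_add [IsProbabilityMeasure P] (hL : IsStableLevy P α L)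
    (j : Fin d) {a b : ℝ} (ha : 0 ≤ a) (hb : 0 ≤ b) (θ : ℝ) :
    charFun (P.map fun ω => L 1 ω j) ((a + b) ^ (1 / α) * θ)
      = charFun (P.map fun ω => L 1 ω j) (a ^ (1 / α) * θ)
        * charFun (P.map fun ω => L 1 ω j) (b ^ (1 / α) * θ) := by
  have h := hL.charFun_dotProduct_add (Pi.single j 1) ha hb θ
  rw [hL.charFun_dotProduct _ (by positivity), hL.charFun_dotProduct _ ha,
    hL.charFun_dotProduct _ hb] at h
  simpa using h

/-- If there is a single asset and short selling is excluded, the scale is `ψ(H) = |H|^α`. -/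
lemma IsStableLevy.isScale_of_one [IsProbabilityMeasure P] (hL : IsStableLevy P α L) (hd : d = 1)
    (j : Fin d) :
    IsScale P α L {H | ∀ i, 0 ≤ H i} (fun ω => L 1 ω j) (fun H => |H j| ^ α) where
  measurable := hL.measurable_coord j
  smul_mem c hc H hH i := mul_nonneg hc (hH i)
  continuous := by
    have := hL.alpha_pos
    exact (continuous_abs.comp (continuous_apply j)).rpow_const fun _ => Or.inr this.le
  nonneg H := by positivity
  map_smul c hc H := by
    simp only [Pi.smul_apply, smul_eq_mul, abs_mul, abs_of_nonneg hc]
    rw [Real.mul_rpow hc (abs_nonneg _)]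
  charFun_increment H hH s t hs hst θ := by
    have hα := hL.alpha_pos
    rw [hL.toIsLevy.charFun_increment H hs hst, hL.charFun_dotProduct H (sub_nonneg.2 hst)]
    have e : (fun ω => H ⬝ᵥ L 1 ω) = fun ω => H j * L 1 ω j := by
      funext ω
      subst hd
      rw [Subsingleton.elim j 0]
      simp [dotProduct]
    rw [e, charFun_map_mul_comp (hL.measurable_coord j).aemeasurable,
      Real.mul_rpow (sub_nonneg.2 hst) (by positivity), ← Real.rpow_mul (abs_nonneg _),
      mul_one_div_cancel hα.ne', Real.rpow_one, abs_of_nonneg (hH j)]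
    congr 1
    ring
  charFun_add a b ha hb θ := hL.charFun_coord_add j ha hb θ

/-- A continuous solution of the exponential functional equation on `[0, ∞)`. -/
lemma eq_rpow_of_mul {q : ℝ → ℝ} (hq : ContinuousOn q (Ici 0)) (h0 : q 0 = 1)
    (hmul : ∀ s t, 0 ≤ s → 0 ≤ t → q (s + t) = q s * q t) :
    (∀ t, 0 ≤ t → 0 < q t) ∧ ∀ t, 0 ≤ t → q t = q 1 ^ t := by
  have hnn : ∀ t, 0 ≤ t → 0 ≤ q t := fun t ht => by
    have := hmul (t / 2) (t / 2) (by positivity) (by positivity)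
    rw [add_halves] at this
    rw [this]
    exact mul_self_nonneg _
  have hpos : ∀ t, 0 ≤ t → 0 < q t := by
    intro t ht
    refine lt_of_le_of_ne (hnn t ht) fun h => ?_
    have hz : ∀ n : ℕ, q (t / 2 ^ n) = 0 := by
      intro n
      induction n with
      | zero => simpa using h.symm
      | succ n ih =>
        have := hmul (t / 2 ^ (n + 1)) (t / 2 ^ (n + 1)) (by positivity) (by positivity)
        have e : t / 2 ^ (n + 1) + t / 2 ^ (n + 1) = t / 2 ^ n := by
          field_simp
          ring
        rw [e, ih] at this
        exact mul_self_eq_zero.1 this.symm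
    have hlim : Tendsto (fun n : ℕ => t / 2 ^ n) atTop (𝓝[Ici 0] 0) := by
      refine tendsto_nhdsWithin_iff.2 ⟨?_, Eventually.of_forall fun n => by
        simp only [mem_Ici]
        positivity⟩
      exact tendsto_const_nhds.div_atTop (tendsto_pow_atTop_atTop_of_one_lt one_lt_two)
    have h1 := (hq 0 (mem_Ici.2 le_rfl)).tendsto.comp hlim
    have h2 : Tendsto (q ∘ fun n : ℕ => t / 2 ^ n) atTop (𝓝 0) := by
      simp only [Function.comp_def, hz]
      exact tendsto_const_nhds
    exact zero_ne_one ((tendsto_nhds_unique h2 h1).trans h0)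
  refine ⟨hpos, ?_⟩
  -- the odd extension of `log q` is additive on `ℝ`
  set l : ℝ → ℝ := fun t => Real.log (q (max t 0)) with hl
  have hladd : ∀ s t, 0 ≤ s → 0 ≤ t → l (s + t) = l s + l t := fun s t hs ht => by
    simp only [hl, max_eq_left hs, max_eq_left ht, max_eq_left (add_nonneg hs ht)]
    rw [hmul s t hs ht, Real.log_mul (hpos s hs).ne' (hpos t ht).ne']
  have hlneg : ∀ t, t ≤ 0 → l t = 0 := fun t ht => by simp [hl, max_eq_right ht, h0]
  have hlc : Continuous l := by
    have : Continuous fun t => q (max t 0) :=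
      hq.comp_continuous (by fun_prop) fun t => mem_Ici.2 (le_max_right _ _)
    exact this.log fun t => (hpos _ (le_max_right _ _)).ne'
  have hdiff : ∀ a b, 0 ≤ a → 0 ≤ b → l (a - b) - l (b - a) = l a - l b := by
    intro a b ha hb
    rcases le_total a b with h | h
    · have := hladd a (b - a) ha (sub_nonneg.2 h)
      rw [add_sub_cancel] at this
      rw [hlneg _ (sub_nonpos.2 h)]
      linarith
    · have := hladd b (a - b) hb (sub_nonneg.2 h)
      rw [add_sub_cancel] at this
      rw [hlneg _ (sub_nonpos.2 h)]
      linarith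
  let g : ℝ →+ ℝ := AddMonoidHom.mk' (fun t => l t - l (-t)) (by
    intro s t
    have h1 := hdiff (max s 0 + max t 0) (max (-s) 0 + max (-t) 0) (by positivity) (by positivity)
    have e1 : ∀ s : ℝ, max s 0 - max (-s) 0 = s := fun s => by
      rcases le_total s 0 with h | h
      · rw [max_eq_right h, max_eq_left (by linarith)]
        ring
      · rw [max_eq_left h, max_eq_right (by linarith)]
        ring
    have e2 : max s 0 + max t 0 - (max (-s) 0 + max (-t) 0) = s + t := by
      linarith [e1 s, e1 t]
    have e3 : max (-s) 0 + max (-t) 0 - (max s 0 + max t 0) = -(s + t) := by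
      linarith [e1 s, e1 t]
    have e4 : ∀ s, l (max s 0) = l s := fun s => by simp [hl]
    rw [e2, e3, hladd _ _ (le_max_right s 0) (le_max_right t 0),
      hladd _ _ (le_max_right (-s) 0) (le_max_right (-t) 0), e4, e4, e4, e4] at h1
    rw [h1]
    ring)
  have hg : Continuous g := hlc.sub (hlc.comp continuous_neg)
  intro t ht
  have h1 := (g.toRealLinearMap hg).map_smul t 1
  simp only [smul_eq_mul, mul_one] at h1
  change l t - l (-t) = t * (l 1 - l (-1)) at h1
  rw [hlneg _ (by linarith : -t ≤ 0), hlneg _ (by norm_num : (-1 : ℝ) ≤ 0), sub_zero, sub_zero]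
    at h1
  simp only [hl, max_eq_left ht, max_eq_left zero_le_one] at h1
  rw [Real.rpow_def_of_pos (hpos 1 zero_le_one), mul_comm, ← h1, Real.exp_log (hpos t ht)]

/-- The (real) characteristic function of `L 1` in the symmetric case. -/
noncomputable def cosTransform (P : Measure Ω) (L : ℝ → Ω → Fin d → ℝ) (H : Fin d → ℝ) : ℝ :=
  ∫ ω, Real.cos (H ⬝ᵥ L 1 ω) ∂P

lemma cosTransform_zero [IsProbabilityMeasure P] : cosTransform P L 0 = 1 := by
  simp [cosTransform]

lemma cosTransform_neg (H : Fin d → ℝ) : cosTransform P L (-H) = cosTransform P L H := by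
  simp [cosTransform, neg_dotProduct]

lemma IsLevy.continuous_cosTransform [IsProbabilityMeasure P] (hL : IsLevy P L) :
    Continuous (cosTransform P L) := by
  refine continuous_of_dominated (bound := fun _ => 1) (fun H => ?_) (fun H => ?_)
    (integrable_const 1) ?_
  · exact (Real.continuous_cos.measurable.comp
      ((measurable_dotProduct_left H).comp (hL.measurable 1 zero_le_one))).aestronglyMeasurable
  · exact Eventually.of_forall fun ω => by simpa using Real.abs_cos_le_one _
  · exact Eventually.of_forall fun ω => by fun_prop

lemma cosTransform_le_one [IsProbabilityMeasure P] (H : Fin d → ℝ) : cosTransform P L H ≤ 1 := by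
  by_cases hi : Integrable (fun ω => Real.cos (H ⬝ᵥ L 1 ω)) P
  · calc cosTransform P L H ≤ ∫ _, (1 : ℝ) ∂P :=
          integral_mono hi (integrable_const 1) fun ω => Real.cos_le_one _
      _ = 1 := by simp
  · rw [cosTransform, integral_undef hi]
    exact zero_le_one

lemma IsLevy.charFun_eq_cosTransform [IsProbabilityMeasure P] (hL : IsLevy P L)
    (hs : IsSymmetric P L) (H : Fin d → ℝ) (θ : ℝ) :
    charFun (P.map fun ω => H ⬝ᵥ L 1 ω) θ = (cosTransform P L (θ • H) : ℂ) := by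
  have hm : Measurable fun ω => H ⬝ᵥ L 1 ω :=
    (measurable_dotProduct_left H).comp (hL.measurable 1 zero_le_one)
  have hsin : ∫ ω, Real.sin (θ * (H ⬝ᵥ L 1 ω)) ∂P = 0 := by
    have h := ((hs 1 zero_le_one).comp
      (u := fun y : Fin d → ℝ => Real.sin (θ * (H ⬝ᵥ y)))
      (Real.continuous_sin.measurable.comp
        ((measurable_dotProduct_left H).const_mul θ))).integral_eq
    simp only [Function.comp_apply, Pi.neg_apply, dotProduct_neg, mul_neg, Real.sin_neg] at h
    rw [integral_neg] at h
    linarith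
  have hi1 : Integrable (fun ω => ((Real.cos (θ * (H ⬝ᵥ L 1 ω)) : ℝ) : ℂ)) P := by
    refine Integrable.ofReal (Integrable.of_bound (C := 1)
      (Real.continuous_cos.measurable.comp (hm.const_mul θ)).aestronglyMeasurable ?_)
    exact Eventually.of_forall fun ω =>
      (Real.norm_eq_abs _).trans_le (Real.abs_cos_le_one _)
  have hi2 : Integrable (fun ω => ((Real.sin (θ * (H ⬝ᵥ L 1 ω)) : ℝ) : ℂ)) P := by
    refine Integrable.ofReal (Integrable.of_bound (C := 1)
      (Real.continuous_sin.measurable.comp (hm.const_mul θ)).aestronglyMeasurable ?_)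
    exact Eventually.of_forall fun ω =>
      (Real.norm_eq_abs _).trans_le (Real.abs_sin_le_one _)
  rw [charFun_apply_real, integral_map hm.aemeasurable
    (by fun_prop : Continuous fun x : ℝ => Complex.exp (θ * x * Complex.I)).aestronglyMeasurable]
  calc ∫ ω, Complex.exp (θ * (H ⬝ᵥ L 1 ω : ℝ) * Complex.I) ∂P
      = ∫ ω, (((Real.cos (θ * (H ⬝ᵥ L 1 ω)) : ℝ) : ℂ)
        + ((Real.sin (θ * (H ⬝ᵥ L 1 ω)) : ℝ) : ℂ) * Complex.I) ∂P := by
        congr 1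
        funext ω
        rw [Complex.exp_mul_I]
        push_cast
        rfl
    _ = _ := by
        rw [integral_add hi1 (hi2.mul_const _), integral_mul_const, integral_complex_ofReal,
          integral_complex_ofReal, hsin]
        simp [cosTransform]

/-- Independence and stationarity of the increments make `t ↦ E cos ⟨H, L t⟩` multiplicative, and
stability turns time into scaling of `H`. -/
lemma IsStableLevy.cosTransform_smul [IsProbabilityMeasure P] (hL : IsStableLevy P α L)
    (hs : IsSymmetric P L) (H : Fin d → ℝ) :
    0 < cosTransform P L H ∧
      ∀ c : ℝ, cosTransform P L (c • H) = cosTransform P L H ^ (|c| ^ α) := by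
  have hα := hL.alpha_pos
  have key := eq_rpow_of_mul (q := fun t => cosTransform P L (t ^ (1 / α) • H)) ?_ ?_ ?_
  · simp only [Real.one_rpow, one_smul] at key
    refine ⟨by simpa using key.1 1 zero_le_one, fun c => ?_⟩
    have h := key.2 (|c| ^ α) (by positivity)
    rw [← Real.rpow_mul (abs_nonneg c), mul_one_div_cancel hα.ne', Real.rpow_one] at h
    rw [← h]
    rcases abs_choice c with e | e <;> rw [e]
    rw [neg_smul, cosTransform_neg]
  · refine (hL.toIsLevy.continuous_cosTransform.comp ?_).continuousOn
    exact (Real.continuous_rpow_const (by positivity)).smul continuous_const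
  · rw [Real.zero_rpow (by positivity), zero_smul, cosTransform_zero]
  · intro s t h1 h2
    have h := hL.charFun_dotProduct_add H h1 h2 1
    rw [hL.charFun_dotProduct _ (by positivity), hL.charFun_dotProduct _ h1,
      hL.charFun_dotProduct _ h2] at h
    simp only [hL.charFun_eq_cosTransform hs, mul_one] at h
    exact_mod_cast h

/-- In the symmetric case the scale is the characteristic exponent of `L 1`, normalized so that the
reference coordinate `j` has scale `1`. -/
lemma IsStableLevy.isScale_of_symmetric [IsProbabilityMeasure P] (hL : IsStableLevy P α L)
    (hs : IsSymmetric P L) (j : Fin d) (hj : ¬ ∀ᵐ ω ∂P, L 1 ω j = 0) :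
    IsScale P α L univ (fun ω => L 1 ω j)
      (fun H => Real.log (cosTransform P L H) / Real.log (cosTransform P L (Pi.single j 1))) ∧
    Real.log (cosTransform P L (Pi.single j 1)) < 0 := by
  have hα := hL.alpha_pos
  have hpos : ∀ H, 0 < cosTransform P L H := fun H => (hL.cosTransform_smul hs H).1
  have hpow : ∀ H (c : ℝ), cosTransform P L (c • H) = cosTransform P L H ^ (|c| ^ α) :=
    fun H => (hL.cosTransform_smul hs H).2
  have hZ : ∀ θ, charFun (P.map fun ω => L 1 ω j) θ
      = ((cosTransform P L (Pi.single j 1) ^ (|θ| ^ α) : ℝ) : ℂ) := fun θ => by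
    have := hL.toIsLevy.charFun_eq_cosTransform hs (Pi.single j 1) θ
    rw [hpow] at this
    simpa using this
  have hlog : ∀ H, Real.log (cosTransform P L H) ≤ 0 := fun H =>
    Real.log_nonpos (hpos H).le (cosTransform_le_one H)
  have hneg : Real.log (cosTransform P L (Pi.single j 1)) < 0 := by
    refine lt_of_le_of_ne (hlog _) fun h => hj ?_
    have h1 : cosTransform P L (Pi.single j 1) = 1 := by
      rw [← Real.exp_log (hpos (Pi.single j 1)), h, Real.exp_zero]
    have : IsProbabilityMeasure (P.map fun ω => L 1 ω j) :=
      Measure.isProbabilityMeasure_map (hL.measurable_coord j).aemeasurable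
    have h2 : P.map (fun ω => L 1 ω j) = Measure.dirac 0 := by
      refine Measure.ext_of_charFun ?_
      funext θ
      rw [hZ, h1, charFun_dirac]
      simp
    have h3 : ∀ᵐ x ∂(P.map fun ω => L 1 ω j), x = 0 := by
      rw [h2, ae_dirac_eq]
      exact rfl
    exact ae_of_ae_map (hL.measurable_coord j).aemeasurable h3
  refine ⟨{ measurable := hL.measurable_coord j
            smul_mem := fun _ _ _ _ => mem_univ _
            continuous := ?_
            nonneg := fun H => div_nonneg_of_nonpos (hlog H) hneg.le
            map_smul := fun c hc H => ?_
            charFun_increment := fun H _ s t h1 h2 θ => ?_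
            charFun_add := fun a b ha hb θ => hL.charFun_coord_add j ha hb θ }, hneg⟩
  · exact (hL.toIsLevy.continuous_cosTransform.log fun H => (hpos H).ne').div_const _
  · rw [hpow, Real.log_rpow (hpos H), abs_of_nonneg hc]
    ring
  · have hts := sub_nonneg.2 h2
    rw [hL.toIsLevy.charFun_increment H h1 h2, hL.charFun_dotProduct H hts,
      hL.toIsLevy.charFun_eq_cosTransform hs, hpow, hZ]
    congr 1
    have hψ : 0 ≤ Real.log (cosTransform P L H) / Real.log (cosTransform P L (Pi.single j 1)) :=
      div_nonneg_of_nonpos (hlog H) hneg.le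
    rw [abs_mul, abs_mul, abs_of_nonneg (Real.rpow_nonneg hts _),
      abs_of_nonneg (Real.rpow_nonneg (mul_nonneg hts hψ) _),
      Real.mul_rpow (Real.rpow_nonneg hts _) (abs_nonneg _),
      Real.mul_rpow (Real.rpow_nonneg (mul_nonneg hts hψ) _) (abs_nonneg _),
      ← Real.rpow_mul hts, ← Real.rpow_mul (mul_nonneg hts hψ), one_div_mul_cancel hα.ne',
      Real.rpow_one, Real.rpow_one, Real.rpow_def_of_pos (hpos H),
      Real.rpow_def_of_pos (hpos (Pi.single j 1))]
    congr 1
    field_simp [hneg.ne]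

/-! ### Uniform grids and càdlàg functions -/

/-- The mesh of the uniform grid with `n + 1` cells on `[a, b]`. -/
noncomputable def gridStep (a b : ℝ) (n : ℕ) : ℝ := (b - a) / (n + 1)

/-- The `k`-th point of the uniform grid with `n + 1` cells on `[a, b]`. -/
noncomputable def gridPt (a b : ℝ) (n : ℕ) (k : ℝ) : ℝ := a + k * gridStep a b n

/-- The last grid point before `v`. -/
noncomputable def gridLo (a b : ℝ) (n : ℕ) (v : ℝ) : ℝ :=
  gridPt a b n (⌊(v - a) / gridStep a b n⌋ : ℤ)

/-- The first grid point after `v`. -/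
noncomputable def gridUp (a b : ℝ) (n : ℕ) (v : ℝ) : ℝ :=
  gridPt a b n (⌈(v - a) / gridStep a b n⌉ : ℤ)

section Grid

variable {a b : ℝ}

lemma gridStep_pos (hab : a < b) (n : ℕ) : 0 < gridStep a b n :=
  div_pos (sub_pos.2 hab) (by positivity)

lemma tendsto_gridStep : Tendsto (gridStep a b) atTop (𝓝 0) :=
  tendsto_const_nhds.div_atTop (tendsto_atTop_add_const_right _ _ tendsto_natCast_atTop_atTop)

lemma gridPt_zero (n : ℕ) : gridPt a b n 0 = a := by simp [gridPt]

lemma gridPt_last (n : ℕ) : gridPt a b n ((n + 1 : ℕ) : ℝ) = b := by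
  have : (n : ℝ) + 1 ≠ 0 := by positivity
  simp only [gridPt, gridStep, Nat.cast_add, Nat.cast_one]
  field_simp
  ring

lemma gridPt_mono (hab : a < b) (n : ℕ) : Monotone (gridPt a b n) := fun x y hxy => by
  have := gridStep_pos hab n
  simp only [gridPt]
  gcongr

lemma gridLo_le (hab : a < b) (n : ℕ) (v : ℝ) : gridLo a b n v ≤ v := by
  have h := gridStep_pos hab n
  have := Int.floor_le ((v - a) / gridStep a b n)
  rw [le_div_iff₀ h] at this
  simp only [gridLo, gridPt]
  linarith

lemma gridPt_mem (hab : a < b) (n : ℕ) {k : ℕ} (hk : k ≤ n + 1) :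
    gridPt a b n k ∈ Icc a b := by
  refine ⟨(gridPt_zero n).symm.trans_le (gridPt_mono hab n (Nat.cast_nonneg k)), ?_⟩
  exact (gridPt_mono hab n (Nat.cast_le.2 hk)).trans_eq (gridPt_last n)

lemma lt_gridLo_add (hab : a < b) (n : ℕ) (v : ℝ) : v < gridLo a b n v + gridStep a b n := by
  have h := gridStep_pos hab n
  have := Int.lt_floor_add_one ((v - a) / gridStep a b n)
  rw [div_lt_iff₀ h] at this
  simp only [gridLo, gridPt]
  linarith

lemma le_gridUp (hab : a < b) (n : ℕ) (v : ℝ) : v ≤ gridUp a b n v := by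
  have h := gridStep_pos hab n
  have := Int.le_ceil ((v - a) / gridStep a b n)
  rw [div_le_iff₀ h] at this
  simp only [gridUp, gridPt]
  linarith

lemma gridUp_lt (hab : a < b) (n : ℕ) (v : ℝ) : gridUp a b n v < v + gridStep a b n := by
  have h := gridStep_pos hab n
  have := Int.ceil_lt_add_one ((v - a) / gridStep a b n)
  rw [← sub_lt_iff_lt_add, lt_div_iff₀ h] at this
  simp only [gridUp, gridPt]
  linarith

lemma le_gridLo (hab : a < b) (n : ℕ) {v : ℝ} (hv : a ≤ v) : a ≤ gridLo a b n v := by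
  have h := gridStep_pos hab n
  have : 0 ≤ ⌊(v - a) / gridStep a b n⌋ :=
    Int.floor_nonneg.2 (div_nonneg (sub_nonneg.2 hv) h.le)
  have : (0 : ℝ) ≤ (⌊(v - a) / gridStep a b n⌋ : ℤ) := by exact_mod_cast this
  simp only [gridLo, gridPt]
  nlinarith

lemma gridUp_le (hab : a < b) (n : ℕ) {v : ℝ} (hv : v ≤ b) : gridUp a b n v ≤ b := by
  have h := gridStep_pos hab n
  refine le_of_le_of_eq ?_ (gridPt_last (a := a) (b := b) n)
  refine gridPt_mono hab n ?_
  have : ⌈(v - a) / gridStep a b n⌉ ≤ ((n + 1 : ℕ) : ℤ) := by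
    rw [Int.ceil_le, div_le_iff₀ h]
    have := gridPt_last (a := a) (b := b) n
    simp only [gridPt] at this
    push_cast at this ⊢
    linarith
  exact_mod_cast this

lemma gridLo_mem (hab : a < b) (n : ℕ) {v : ℝ} (hv : v ∈ Icc a b) : gridLo a b n v ∈ Icc a b :=
  ⟨le_gridLo hab n hv.1, (gridLo_le hab n v).trans hv.2⟩

lemma gridUp_mem (hab : a < b) (n : ℕ) {v : ℝ} (hv : v ∈ Icc a b) : gridUp a b n v ∈ Icc a b :=
  ⟨hv.1.trans (le_gridUp hab n v), gridUp_le hab n hv.2⟩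

lemma tendsto_gridLo (hab : a < b) (v : ℝ) : Tendsto (fun n => gridLo a b n v) atTop (𝓝 v) := by
  have h : Tendsto (fun n => v - gridStep a b n) atTop (𝓝 (v - 0)) :=
    tendsto_const_nhds.sub tendsto_gridStep
  rw [sub_zero] at h
  exact tendsto_of_tendsto_of_tendsto_of_le_of_le h tendsto_const_nhds
    (fun n => by linarith [lt_gridLo_add hab n v]) (fun n => gridLo_le hab n v)

lemma tendsto_gridUp (hab : a < b) (v : ℝ) :
    Tendsto (fun n => gridUp a b n v) atTop (𝓝[Ici v] v) := by
  have h : Tendsto (fun n => v + gridStep a b n) atTop (𝓝 (v + 0)) :=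
    tendsto_const_nhds.add tendsto_gridStep
  rw [add_zero] at h
  exact tendsto_nhdsWithin_iff.2 ⟨tendsto_of_tendsto_of_tendsto_of_le_of_le tendsto_const_nhds h
    (fun n => le_gridUp hab n v) (fun n => (gridUp_lt hab n v).le),
    Eventually.of_forall fun n => le_gridUp hab n v⟩

lemma gridLo_eq (hab : a < b) (n : ℕ) (k : ℕ) {v : ℝ} (h1 : gridPt a b n k ≤ v)
    (h2 : v < gridPt a b n (k + 1)) : gridLo a b n v = gridPt a b n k := by
  have h := gridStep_pos hab n
  have : ⌊(v - a) / gridStep a b n⌋ = (k : ℤ) := by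
    rw [Int.floor_eq_iff, le_div_iff₀ h, div_lt_iff₀ h]
    simp only [gridPt] at h1 h2
    push_cast
    constructor <;> linarith
  rw [gridLo, this]
  norm_cast

lemma gridUp_eq (hab : a < b) (n : ℕ) (k : ℕ) {v : ℝ} (h1 : gridPt a b n k < v)
    (h2 : v ≤ gridPt a b n (k + 1)) : gridUp a b n v = gridPt a b n (k + 1) := by
  have h := gridStep_pos hab n
  have : ⌈(v - a) / gridStep a b n⌉ = ((k + 1 : ℕ) : ℤ) := by
    rw [Int.ceil_eq_iff, lt_div_iff₀ h, div_le_iff₀ h]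
    simp only [gridPt] at h1 h2
    push_cast
    constructor <;> linarith
  rw [gridUp, this]
  norm_cast

lemma measurable_comp_gridUp (f : ℝ → ℝ) (n : ℕ) : Measurable fun v => f (gridUp a b n v) := by
  have h1 : Measurable fun v : ℝ => ⌈(v - a) / gridStep a b n⌉ :=
    Int.measurable_ceil.comp (by fun_prop)
  exact (measurable_from_top (f := fun k : ℤ => f (gridPt a b n k))).comp h1

lemma measurable_comp_gridLo (f : ℝ → ℝ) (n : ℕ) : Measurable fun v => f (gridLo a b n v) := by
  have h1 : Measurable fun v : ℝ => ⌊(v - a) / gridStep a b n⌋ :=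
    Int.measurable_floor.comp (by fun_prop)
  exact (measurable_from_top (f := fun k : ℤ => f (gridPt a b n k))).comp h1

/-- A sum over the cells of the grid is the integral of a step function. -/
lemma sum_integral_grid (hab : a < b) (n : ℕ) (G : ℝ → ℝ → ℝ → ℝ)
    (hG : IntervalIntegrable (fun v => G v (gridLo a b n v) (gridUp a b n v)) volume a b) :
    ∑ k ∈ Finset.range (n + 1), ∫ v in (gridPt a b n k)..(gridPt a b n (k + 1)),
        G v (gridPt a b n k) (gridPt a b n (k + 1))
      = ∫ v in a..b, G v (gridLo a b n v) (gridUp a b n v) := by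
  have hm := gridPt_mono hab n
  have h1 := intervalIntegral.sum_integral_adjacent_intervals (μ := volume)
    (f := fun v => G v (gridLo a b n v) (gridUp a b n v)) (a := fun k : ℕ => gridPt a b n k)
    (n := n + 1) (fun k hk => by
      refine hG.mono_set ?_
      rw [uIcc_of_le hab.le, uIcc_of_le (hm (by simp))]
      exact Icc_subset_Icc (gridPt_mem hab n hk.le).1 (gridPt_mem hab n hk).2)
  simp only [Nat.cast_zero, gridPt_zero, gridPt_last] at h1
  rw [← h1]
  refine Finset.sum_congr rfl fun k _ => ?_
  push_cast
  refine intervalIntegral.integral_congr_ae ?_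
  have hne : ∀ᵐ v : ℝ, v ≠ gridPt a b n (k + 1) := by
    simp [ae_iff]
  filter_upwards [hne] with v hv hmem
  rw [uIoc_of_le (hm (by linarith))] at hmem
  rw [gridLo_eq hab n k hmem.1.le (lt_of_le_of_ne hmem.2 hv), gridUp_eq hab n k hmem.1 hmem.2]

/-- Bounded convergence on an interval. -/
lemma tendsto_intervalIntegral_of_bounded (hab : a ≤ b) {g : ℕ → ℝ → ℝ} {g' : ℝ → ℝ} {C : ℝ}
    (hm : ∀ n, AEStronglyMeasurable (g n) (volume.restrict (Ioc a b)))
    (hb : ∀ n, ∀ v ∈ Ioc a b, |g n v| ≤ C)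
    (hlim : ∀ᵐ v, v ∈ Ioc a b → Tendsto (fun n => g n v) atTop (𝓝 (g' v))) :
    Tendsto (fun n => ∫ v in a..b, g n v) atTop (𝓝 (∫ v in a..b, g' v)) := by
  refine intervalIntegral.tendsto_integral_filter_of_dominated_convergence (fun _ => C) ?_ ?_ ?_ ?_
  · rw [uIoc_of_le hab]
    exact Eventually.of_forall hm
  · rw [uIoc_of_le hab]
    exact Eventually.of_forall fun n => Eventually.of_forall fun v hv => hb n v hv
  · exact intervalIntegrable_const
  · rw [uIoc_of_le hab]
    exact hlim

lemma intervalIntegrable_of_bounded (hab : a ≤ b) {g : ℝ → ℝ} {C : ℝ}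
    (hm : AEStronglyMeasurable g (volume.restrict (Ioc a b)))
    (hb : ∀ v ∈ Ioc a b, |g v| ≤ C) : IntervalIntegrable g volume a b := by
  rw [intervalIntegrable_iff_integrableOn_Ioc_of_le hab]
  refine Integrable.of_bound (C := C) hm ?_
  exact (ae_restrict_iff' measurableSet_Ioc).2 (Eventually.of_forall fun v hv => hb v hv)

lemma ae_ne_right (b : ℝ) : ∀ᵐ v : ℝ, v ≠ b := by simp [ae_iff]

end Grid

section Cadlag

variable {f : ℝ → ℝ} {a b : ℝ}

lemma IsCadlagOn.exists_bound (hf : IsCadlagOn f a b) : ∃ C, ∀ s ∈ Icc a b, |f s| ≤ C := by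
  refine isCompact_Icc.induction_on (p := fun s => ∃ C, ∀ x ∈ s, |f x| ≤ C) ?_ ?_ ?_ ?_
  · exact ⟨0, by simp⟩
  · rintro s t hst ⟨C, hC⟩
    exact ⟨C, fun x hx => hC x (hst hx)⟩
  · rintro s t ⟨C, hC⟩ ⟨D, hD⟩
    refine ⟨max C D, fun x hx => ?_⟩
    rcases hx with hx | hx
    · exact (hC x hx).trans (le_max_left _ _)
    · exact (hD x hx).trans (le_max_right _ _)
  · intro x hx
    have hl : ∃ C, ∀ᶠ y in 𝓝[<] x, y ∈ Icc a b → |f y| ≤ C := by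
      rcases hx.1.eq_or_lt with rfl | hax
      · refine ⟨0, ?_⟩
        filter_upwards [self_mem_nhdsWithin] with y hy hy2
        exact absurd hy2.1 (not_le.2 hy)
      · obtain ⟨l, hl⟩ := hf.2 x ⟨hax, hx.2⟩
        refine ⟨|l| + 1, ?_⟩
        filter_upwards [hl.abs.eventually (gt_mem_nhds (lt_add_one |l|))] with y hy _
        exact hy.le
    have hr : ∃ C, ∀ᶠ y in 𝓝[≥] x, y ∈ Icc a b → |f y| ≤ C := by
      rcases hx.2.eq_or_lt with rfl | hxb
      · refine ⟨|f x|, ?_⟩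
        filter_upwards [self_mem_nhdsWithin] with y hy hy2
        rw [le_antisymm hy2.2 hy]
      · refine ⟨|f x| + 1, ?_⟩
        filter_upwards [(hf.1 x ⟨hx.1, hxb⟩).tendsto.abs.eventually
          (gt_mem_nhds (lt_add_one |f x|))] with y hy _
        exact hy.le
    obtain ⟨C, hC⟩ := hl
    obtain ⟨D, hD⟩ := hr
    refine ⟨{y | y ∈ Icc a b → |f y| ≤ max C D} ∩ Icc a b, ?_, max C D, fun y hy => hy.1 hy.2⟩
    refine inter_mem (nhdsWithin_le_nhds ?_) self_mem_nhdsWithin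
    rw [← nhdsLT_sup_nhdsGE]
    refine mem_sup.2 ⟨?_, ?_⟩
    · filter_upwards [hC] with y hy h
      exact (hy h).trans (le_max_left _ _)
    · filter_upwards [hD] with y hy h
      exact (hy h).trans (le_max_right _ _)

lemma IsCadlagOn.tendsto_gridUp (hf : IsCadlagOn f a b) {v : ℝ} (hv : v ∈ Ico a b) :
    Tendsto (fun n => f (gridUp a b n v)) atTop (𝓝 (f v)) :=
  (hf.1 v hv).tendsto.comp (StableMarket.tendsto_gridUp (hv.1.trans_lt hv.2) v)

lemma IsCadlagOn.aestronglyMeasurable (hf : IsCadlagOn f a b) :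
    AEStronglyMeasurable f (volume.restrict (Ioc a b)) := by
  refine aestronglyMeasurable_of_tendsto_ae (u := atTop)
    (f := fun n v => f (gridUp a b n v)) (fun n => ?_) ?_
  · exact (measurable_comp_gridUp f n).aestronglyMeasurable
  · refine (ae_restrict_iff' measurableSet_Ioc).2 ?_
    filter_upwards [ae_ne_right b] with v hv hmem
    exact hf.tendsto_gridUp ⟨hmem.1.le, lt_of_le_of_ne hmem.2 hv⟩

lemma IsCadlagOn.intervalIntegrable (hf : IsCadlagOn f a b) (hab : a ≤ b) :
    IntervalIntegrable f volume a b := by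
  obtain ⟨C, hC⟩ := hf.exists_bound
  exact intervalIntegrable_of_bounded hab hf.aestronglyMeasurable
    fun v hv => hC v (Ioc_subset_Icc_self hv)

lemma IsCadlagOn.mono (hf : IsCadlagOn f a b) {c : ℝ} (hc : c ≤ b) :
    IsCadlagOn f a c :=
  ⟨fun s hs => hf.1 s ⟨hs.1, hs.2.trans_le hc⟩, fun s hs => hf.2 s ⟨hs.1, hs.2.trans hc⟩⟩

lemma IsCadlagOn.add {g : ℝ → ℝ} (hf : IsCadlagOn f a b) (hg : IsCadlagOn g a b) :
    IsCadlagOn (fun s => f s + g s) a b := by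
  refine ⟨fun s hs => (hf.1 s hs).add (hg.1 s hs), fun s hs => ?_⟩
  obtain ⟨l, hl⟩ := hf.2 s hs
  obtain ⟨k, hk⟩ := hg.2 s hs
  exact ⟨l + k, hl.add hk⟩

lemma IsCadlagOn.const_mul (hf : IsCadlagOn f a b) (c : ℝ) :
    IsCadlagOn (fun s => c * f s) a b := by
  refine ⟨fun s hs => (hf.1 s hs).const_mul c, fun s hs => ?_⟩
  obtain ⟨l, hl⟩ := hf.2 s hs
  exact ⟨c * l, hl.const_mul c⟩

lemma IsCadlagOn.mul_continuous {g : ℝ → ℝ} (hf : IsCadlagOn f a b) (hg : Continuous g) :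
    IsCadlagOn (fun s => g s * f s) a b := by
  refine ⟨fun s hs => hg.continuousWithinAt.mul (hf.1 s hs), fun s hs => ?_⟩
  obtain ⟨l, hl⟩ := hf.2 s hs
  exact ⟨g s * l, (hg.continuousAt.mono_left nhdsWithin_le_nhds).mul hl⟩

lemma isCadlagOn_of_continuousOn (hf : ContinuousOn f (Icc a b)) : IsCadlagOn f a b := by
  refine ⟨fun s hs => ?_, fun s hs => ⟨f s, ?_⟩⟩
  · refine (hf s ⟨hs.1, hs.2.le⟩).mono_of_mem_nhdsWithin ?_
    exact mem_of_superset (Icc_mem_nhdsGE hs.2) (Icc_subset_Icc_left hs.1)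
  · refine ((hf s ⟨hs.1.le, hs.2⟩).mono_of_mem_nhdsWithin ?_).tendsto
    exact mem_of_superset (Ioo_mem_nhdsLT hs.1) fun x hx => ⟨hx.1.le, hx.2.le.trans hs.2⟩

/-- Stopping a càdlàg function at a time `τ` leaves it càdlàg. -/
lemma IsCadlagOn.stopped (hf : IsCadlagOn f a b) (τ : ℝ) :
    IsCadlagOn (fun s => f (min s τ)) a b := by
  refine ⟨fun s hs => ?_, fun s hs => ?_⟩
  · rcases lt_or_ge s τ with h | h
    · refine (hf.1 s hs).congr_of_eventuallyEq ?_ (by simp [h.le])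
      filter_upwards [mem_nhdsWithin_of_mem_nhds (Iio_mem_nhds h)] with y hy
      rw [min_eq_left (le_of_lt hy)]
    · refine (continuousWithinAt_const (b := f τ)).congr (fun y hy => ?_) ?_
      · rw [min_eq_right (h.trans hy)]
      · rw [min_eq_right h]
  · rcases le_or_gt s τ with h | h
    · obtain ⟨l, hl⟩ := hf.2 s hs
      refine ⟨l, hl.congr' ?_⟩
      filter_upwards [self_mem_nhdsWithin] with y hy
      rw [min_eq_left ((le_of_lt hy).trans h)]
    · refine ⟨f τ, tendsto_const_nhds.congr' ?_⟩
      filter_upwards [mem_nhdsWithin_of_mem_nhds (Ioi_mem_nhds h)] with y hy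
      rw [min_eq_right (le_of_lt hy)]

lemma IsCadlagOn.integral (hf : IsCadlagOn f a b) (hab : a ≤ b) :
    ContinuousOn (fun s => ∫ v in a..s, f v) (Icc a b) :=
  intervalIntegral.continuousOn_primitive_interval'
    (hf.intervalIntegrable hab) left_mem_uIcc |>.mono (by rw [uIcc_of_le hab])

end Cadlag

/-- The time integral of a càdlàg process is a random variable. -/
lemma aemeasurable_integral_of_cadlag {Ω : Type*} [MeasurableSpace Ω] {P : Measure Ω}
    {X : ℝ → Ω → ℝ} {a b : ℝ} (hab : a ≤ b) (hm : ∀ s ∈ Icc a b, AEMeasurable (X s) P)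
    (hc : ∀ᵐ ω ∂P, IsCadlagOn (fun s => X s ω) a b) :
    AEMeasurable (fun ω => ∫ v in a..b, X v ω) P := by
  rcases hab.eq_or_lt with rfl | hab
  · simp
  refine aemeasurable_of_tendsto_metrizable_ae atTop
    (f := fun n ω => ∑ k ∈ Finset.range (n + 1), gridStep a b n * X (gridPt a b n (k + 1)) ω)
    (fun n => ?_) ?_
  · refine Finset.aemeasurable_fun_sum _ fun k hk => (hm _ ?_).const_mul _
    exact_mod_cast gridPt_mem hab n (Finset.mem_range.1 hk)
  · filter_upwards [hc] with ω hω
    obtain ⟨C, hC⟩ := hω.exists_bound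
    have h1 : Tendsto (fun n => ∫ v in a..b, X (gridUp a b n v) ω) atTop
        (𝓝 (∫ v in a..b, X v ω)) := by
      refine tendsto_intervalIntegral_of_bounded hab.le
        (fun n => (measurable_comp_gridUp (fun s => X s ω) n).aestronglyMeasurable)
        (fun n v hv => hC _ (gridUp_mem hab n (Ioc_subset_Icc_self hv))) ?_
      filter_upwards [ae_ne_right b] with v hv hmem
      exact hω.tendsto_gridUp ⟨hmem.1.le, lt_of_le_of_ne hmem.2 hv⟩
    refine h1.congr fun n => ?_
    rw [← sum_integral_grid hab n (fun _ _ y => X y ω)]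
    · refine Finset.sum_congr rfl fun k _ => ?_
      rw [intervalIntegral.integral_const, smul_eq_mul]
      congr 1
      simp only [gridPt]
      ring
    · exact intervalIntegrable_of_bounded hab.le
        (measurable_comp_gridUp (fun s => X s ω) n).aestronglyMeasurable
        (fun v hv => hC _ (gridUp_mem hab n (Ioc_subset_Icc_self hv)))

/-! ### Bounded almost everywhere continuous functions and Riemann sums -/

/-- `g` is Riemann integrable on `[a, b]`, in Lebesgue's form: bounded and almost everywhere
continuous. -/
def IsRiemannOn (g : ℝ → ℝ) (a b : ℝ) : Prop :=
  (∃ C, ∀ s ∈ Icc a b, |g s| ≤ C) ∧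
    ∀ᵐ s : ℝ, s ∈ Icc a b → ContinuousWithinAt g (Icc a b) s

section Riemann

variable {g : ℝ → ℝ} {a b : ℝ}

lemma IsRiemannOn.ae_tendsto (hg : IsRiemannOn g a b) (hab : a < b) :
    ∀ᵐ v : ℝ, v ∈ Ioc a b → Tendsto (fun n => g (gridLo a b n v)) atTop (𝓝 (g v)) := by
  filter_upwards [hg.2] with v hv hmem
  have hv' := Ioc_subset_Icc_self hmem
  exact (hv hv').tendsto.comp (tendsto_nhdsWithin_iff.2
    ⟨tendsto_gridLo hab v, Eventually.of_forall fun n => gridLo_mem hab n hv'⟩)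

lemma IsRiemannOn.aestronglyMeasurable (hg : IsRiemannOn g a b) (hab : a < b) :
    AEStronglyMeasurable g (volume.restrict (Ioc a b)) :=
  aestronglyMeasurable_of_tendsto_ae (u := atTop) (f := fun n v => g (gridLo a b n v))
    (fun n => (measurable_comp_gridLo g n).aestronglyMeasurable)
    ((ae_restrict_iff' measurableSet_Ioc).2 (hg.ae_tendsto hab))

lemma IsRiemannOn.intervalIntegrable (hg : IsRiemannOn g a b) (hab : a ≤ b) :
    IntervalIntegrable g volume a b := by
  rcases hab.eq_or_lt with rfl | hab
  · exact IntervalIntegrable.refl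
  obtain ⟨C, hC⟩ := hg.1
  exact intervalIntegrable_of_bounded hab.le (hg.aestronglyMeasurable hab)
    fun v hv => hC v (Ioc_subset_Icc_self hv)

/-- The left Riemann sums along uniform grids converge. -/
lemma IsRiemannOn.tendsto_sum (hg : IsRiemannOn g a b) (hab : a < b) :
    Tendsto (fun n : ℕ => ∑ j ∈ Finset.range (n + 1),
      (gridPt a b n (j + 1) - gridPt a b n j) * g (gridPt a b n j)) atTop
      (𝓝 (∫ v in a..b, g v)) := by
  obtain ⟨C, hC⟩ := hg.1
  have hb : ∀ n, ∀ v ∈ Ioc a b, |g (gridLo a b n v)| ≤ C := fun n v hv =>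
    hC _ (gridLo_mem hab n (Ioc_subset_Icc_self hv))
  have h1 := tendsto_intervalIntegral_of_bounded hab.le
    (fun n => (measurable_comp_gridLo g n).aestronglyMeasurable) hb (hg.ae_tendsto hab)
  refine h1.congr fun n => ?_
  rw [← sum_integral_grid hab n (fun _ y _ => g y)]
  · refine Finset.sum_congr rfl fun k _ => ?_
    rw [intervalIntegral.integral_const, smul_eq_mul]
  · exact intervalIntegrable_of_bounded hab.le
      (measurable_comp_gridLo g n).aestronglyMeasurable (hb n)

/-- The last grid point before `v` is a step function of `v`. -/
lemma ae_continuousAt_gridLo (hab : a < b) (n : ℕ) :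
    ∀ᵐ v : ℝ, ContinuousAt (gridLo a b n) v := by
  have hc : ((fun k : ℤ => gridPt a b n k) '' univ).Countable := (Set.countable_univ).image _
  filter_upwards [hc.ae_notMem volume] with v hv
  have hδ := gridStep_pos hab n
  set y := (v - a) / gridStep a b n with hy
  have h1 : (⌊y⌋ : ℝ) < y := by
    refine lt_of_le_of_ne (Int.floor_le y) fun h => hv ⟨⌊y⌋, mem_univ _, ?_⟩
    simp only [gridPt]
    rw [h, hy]
    field_simp
    ring
  have h2 : ContinuousAt (fun x : ℝ => ((⌊x⌋ : ℤ) : ℝ)) y :=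
    (continuousOn_floor ⌊y⌋).continuousAt (Ico_mem_nhds h1 (Int.lt_floor_add_one y))
  have h3 : ContinuousAt (fun v : ℝ => (v - a) / gridStep a b n) v := by fun_prop
  have h4 := ContinuousAt.comp (f := fun v : ℝ => (v - a) / gridStep a b n)
    (g := fun x : ℝ => ((⌊x⌋ : ℤ) : ℝ)) h2 h3
  unfold gridLo gridPt
  exact continuousAt_const.add (h4.mul continuousAt_const)

end Riemann

/-! ### Convergence in measure -/

section InMeasure

variable {Ω : Type*} [MeasurableSpace Ω] {P : Measure Ω}

lemma tendstoInMeasure_add {f g : ℕ → Ω → ℝ} {f' g' : Ω → ℝ}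
    (hf : TendstoInMeasure P f atTop f') (hg : TendstoInMeasure P g atTop g') :
    TendstoInMeasure P (fun n ω => f n ω + g n ω) atTop (fun ω => f' ω + g' ω) := by
  rw [tendstoInMeasure_iff_norm] at hf hg ⊢
  intro ε hε
  have h := (hf (ε / 2) (half_pos hε)).add (hg (ε / 2) (half_pos hε))
  rw [add_zero] at h
  refine tendsto_of_tendsto_of_tendsto_of_le_of_le tendsto_const_nhds h
    (fun n => zero_le) fun n => ?_
  refine (measure_mono fun ω hω => ?_).trans (measure_union_le _ _)
  simp only [mem_ofPred_eq, mem_union] at hω ⊢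
  by_contra! h
  have := norm_add_le (f n ω - f' ω) (g n ω - g' ω)
  rw [show f n ω - f' ω + (g n ω - g' ω) = f n ω + g n ω - (f' ω + g' ω) by ring] at this
  linarith

lemma tendstoInMeasure_const_mul {f : ℕ → Ω → ℝ} {f' : Ω → ℝ}
    (hf : TendstoInMeasure P f atTop f') (c : ℝ) :
    TendstoInMeasure P (fun n ω => c * f n ω) atTop (fun ω => c * f' ω) := by
  rw [tendstoInMeasure_iff_norm] at hf ⊢
  intro ε hε
  refine tendsto_of_tendsto_of_tendsto_of_le_of_le tendsto_const_nhds
    (hf (ε / (|c| + 1)) (by positivity)) (fun n => zero_le) fun n => measure_mono fun ω hω => ?_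
  simp only [mem_ofPred_eq] at hω ⊢
  rw [div_le_iff₀ (by positivity)]
  rw [← mul_sub, norm_mul, Real.norm_eq_abs c] at hω
  nlinarith [norm_nonneg (f n ω - f' ω)]

lemma tendstoInMeasure_sum {f : ℕ → ℕ → Ω → ℝ} {f' : ℕ → Ω → ℝ} (N : ℕ)
    (hf : ∀ k < N, TendstoInMeasure P (f k) atTop (f' k)) :
    TendstoInMeasure P (fun n ω => ∑ k ∈ Finset.range N, f k n ω) atTop
      (fun ω => ∑ k ∈ Finset.range N, f' k ω) := by
  induction N with
  | zero =>
    rw [tendstoInMeasure_iff_norm]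
    intro ε hε
    simp [not_le.2 hε]
  | succ N ih =>
    simp only [Finset.sum_range_succ]
    exact tendstoInMeasure_add (ih fun k hk => hf k (by omega)) (hf N (by omega))

/-- Characteristic functions converge along sequences that converge in measure. -/
lemma tendsto_charFun_of_tendstoInMeasure [IsProbabilityMeasure P] {f : ℕ → Ω → ℝ} {f' : Ω → ℝ}
    (hm : ∀ n, AEMeasurable (f n) P) (hf : TendstoInMeasure P f atTop f') (θ : ℝ) :
    Tendsto (fun n => charFun (P.map (f n)) θ) atTop (𝓝 (charFun (P.map f') θ)) := by
  have hm' : AEMeasurable f' P := hf.aemeasurable hm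
  have hc : ∀ g : Ω → ℝ, AEMeasurable g P →
      charFun (P.map g) θ = ∫ ω, Complex.exp (θ * g ω * Complex.I) ∂P := fun g hg => by
    rw [charFun_apply_real, integral_map hg
      (by fun_prop : Continuous fun x : ℝ => Complex.exp (θ * x * Complex.I)).aestronglyMeasurable]
  refine tendsto_of_subseq_tendsto fun ns hns => ?_
  obtain ⟨ms, -, hms⟩ := (hf.comp hns).exists_seq_tendsto_ae
  refine ⟨ms, ?_⟩
  rw [hc f' hm']
  simp only [hc _ (hm _)]
  refine tendsto_integral_of_dominated_convergence (fun _ => 1) (fun n => ?_)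
    (integrable_const 1) (fun n => ?_) ?_
  · exact (by fun_prop : Continuous fun x : ℝ =>
      Complex.exp (θ * x * Complex.I)).comp_aestronglyMeasurable (hm _).aestronglyMeasurable
  · refine Eventually.of_forall fun ω => ?_
    have : (θ : ℂ) * (f (ns (ms n)) ω : ℂ) * Complex.I
        = ((θ * f (ns (ms n)) ω : ℝ) : ℂ) * Complex.I := by push_cast; ring
    rw [this, Complex.norm_exp_ofReal_mul_I]
  · filter_upwards [hms] with ω hω
    have : Continuous fun x : ℝ => Complex.exp (θ * x * Complex.I) := by fun_prop
    exact (this.tendsto (f' ω)).comp hω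

end InMeasure

/-! ### The law of the gain -/

section Law

variable {Ω : Type*} [MeasurableSpace Ω] {P : Measure Ω} {d : ℕ}
  {α : ℝ} {L : ℝ → Ω → Fin d → ℝ}

/-- The rate of excess return `∑ᵢ uⁱ (μⁱ - r)` of the strategy `u`. -/
noncomputable def excess (m : Market d) (u : ℝ → Fin d → ℝ) (s : ℝ) : ℝ :=
  ∑ i, u s i * (m.μ s i - m.r)

/-- The exposure `u σ` of the strategy `u` to the noise `L`. -/
noncomputable def exposure (m : Market d) (u : ℝ → Fin d → ℝ) (s : ℝ) : Fin d → ℝ :=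
  Matrix.vecMul (u s) (m.σ s)

/-- The compounding factor from time `s` to time `T`. -/
noncomputable def compound (m : Market d) (s : ℝ) : ℝ := Real.exp (m.r * (m.T - s))

lemma compound_pos (m : Market d) (s : ℝ) : 0 < compound m s := Real.exp_pos _

lemma continuous_compound (m : Market d) : Continuous (compound m) := by
  unfold compound
  fun_prop

lemma hasDerivAt_compound (m : Market d) (s : ℝ) :
    HasDerivAt (compound m) (-(m.r * compound m s)) s := by
  unfold compound
  have h1 : HasDerivAt (fun s => m.r * (m.T - s)) (m.r * (-1)) s :=
    ((hasDerivAt_id s).const_sub m.T).const_mul m.r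
  convert h1.exp using 1
  ring

/-- The stochastic integral process `∫_t^s u σ dL`, read off from the wealth process. -/
noncomputable def noise (m : Market d) (u : ℝ → Fin d → ℝ) (t x : ℝ) (X : ℝ → Ω → ℝ) (s : ℝ)
    (ω : Ω) : ℝ :=
  X s ω - x - ∫ v in t..s, (m.r * X v ω + excess m u v)

/-- The grid with `(m + 1) (n + 1)` cells refines the one with `m + 1` cells. -/
lemma gridPt_eq_of_refine (a b : ℝ) (m n k i : ℕ) :
    gridPt a b (m * (n + 1) + n) ((k * (n + 1) + i : ℕ) : ℝ)
      = gridPt a b m (k + i / (n + 1)) := by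
  have h1 : (n : ℝ) + 1 ≠ 0 := by positivity
  have h2 : (m : ℝ) + 1 ≠ 0 := by positivity
  have h3 : (m : ℝ) * (n + 1) + n + 1 ≠ 0 := by positivity
  simp only [gridPt, gridStep]
  push_cast
  have h4 : (m : ℝ) * (n + 1) + n + 1 = (m + 1) * (n + 1) := by ring
  rw [h4]
  field_simp

/-- A weighted sum over the cells of a grid, each of whose increments is a sum over the cells of a
refinement, as a single sum over the refinement. -/
lemma sum_weights_refine (a b : ℝ) (hab : a < b) (m n : ℕ) (w : ℝ → ℝ) (D : ℕ → ℝ) (K : ℕ) :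
    ∑ k ∈ Finset.range K, w (gridPt a b m k) *
        (∑ j ∈ Finset.range ((k + 1) * (n + 1)), D j - ∑ j ∈ Finset.range (k * (n + 1)), D j)
      = ∑ j ∈ Finset.range (K * (n + 1)),
        w (gridLo a b m (gridPt a b (m * (n + 1) + n) j)) * D j := by
  induction K with
  | zero => simp
  | succ K ih =>
    have e : (K + 1) * (n + 1) = K * (n + 1) + (n + 1) := by ring
    rw [Finset.sum_range_succ, ih, e, Finset.sum_range_add _ (K * (n + 1)) (n + 1),
      Finset.sum_range_add _ (K * (n + 1)) (n + 1), add_sub_cancel_left, Finset.mul_sum]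
    congr 1
    refine Finset.sum_congr rfl fun i hi => ?_
    have hin : (i : ℝ) < n + 1 := by exact_mod_cast Finset.mem_range.1 hi
    have h0 : (0 : ℝ) ≤ i / (n + 1) := by positivity
    have h1 : (i : ℝ) / (n + 1) < 1 := by rwa [div_lt_one (by positivity)]
    have hδ := gridStep_pos hab m
    rw [gridPt_eq_of_refine, gridLo_eq hab m K]
    · exact gridPt_mono hab m (by linarith)
    · simp only [gridPt]
      gcongr

variable {C : Set (Fin d → ℝ)} {Z : Ω → ℝ} {ψ : (Fin d → ℝ) → ℝ}

lemma IsScale.continuous_charFun [IsProbabilityMeasure P] (hS : IsScale P α L C Z ψ) :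
    Continuous (charFun (P.map Z)) := by
  have : IsProbabilityMeasure (P.map Z) :=
    Measure.isProbabilityMeasure_map hS.measurable.aemeasurable
  fun_prop

lemma IsLevy.aemeasurable_riemannSum (hL : IsLevy P L) (H : ℝ → Fin d → ℝ) (N : ℕ) (p : ℕ → ℝ)
    (hp : ∀ k, 0 ≤ p k) : AEMeasurable (riemannSum L H N p) P := by
  unfold riemannSum
  exact Finset.aemeasurable_fun_sum _ fun k _ => ((measurable_dotProduct_left _).comp
    ((hL.measurable _ (hp _)).sub (hL.measurable _ (hp _)))).aemeasurable

lemma IsLevy.aemeasurable_noise (hL : IsLevy P L) {m : Market d} {u : ℝ → Fin d → ℝ} {t x : ℝ}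
    {X : ℝ → Ω → ℝ} (hX : IsWealth P L m u t x X) (ht : 0 ≤ t) {s : ℝ} (hs : s ∈ Icc t m.T) :
    AEMeasurable (noise m u t x X s) P := by
  rcases hs.1.eq_or_lt with rfl | hts
  · unfold noise
    simp only [intervalIntegral.integral_same]
    exact ((hX.aemeasurable _ hs).sub_const x).sub_const 0
  · refine (hX.equation s hs (fun n => n + 1) (fun n j => gridPt t s n j) ?_ ?_ ?_ ?_).aemeasurable
      fun n => hL.aemeasurable_riemannSum _ _ _ fun k => ?_
    · exact fun n i j hij => gridPt_mono hts n (Nat.cast_le.2 hij)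
    · exact fun n => by simp [gridPt]
    · exact fun n => gridPt_last n
    · intro ε hε
      filter_upwards [(tendsto_gridStep (a := t) (b := s)).eventually (gt_mem_nhds hε)]
        with n hn k _
      simp only [gridPt]
      push_cast
      linarith
    · exact ht.trans ((gridPt_zero n).symm.trans_le (gridPt_mono hts n (Nat.cast_nonneg k)))

/-- The law of `∑ₖ e(vₖ) (I(vₖ₊₁) - I(vₖ))` for the stochastic integral process `I`. -/
lemma IsScale.charFun_sum_noise [IsProbabilityMeasure P] (hS : IsScale P α L C Z ψ)
    (hL : IsLevy P L) (hα : 0 < α)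
    {m : Market d} {u : ℝ → Fin d → ℝ} {t x : ℝ} {X : ℝ → Ω → ℝ} (hX : IsWealth P L m u t x X)
    (ht : 0 ≤ t) (htT : t < m.T) (huC : ∀ s ∈ Icc t m.T, exposure m u s ∈ C)
    (hu : IsRiemannOn (fun s => ψ (exposure m u s)) t m.T) (M : ℕ) (θ : ℝ) :
    charFun (P.map fun ω => ∑ k ∈ Finset.range (M + 1), compound m (gridPt t m.T M k) *
      (noise m u t x X (gridPt t m.T M (k + 1)) ω - noise m u t x X (gridPt t m.T M k) ω)) θ
      = charFun (P.map Z) ((∫ v in t..m.T,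
        compound m (gridLo t m.T M v) ^ α * ψ (exposure m u v)) ^ (1 / α) * θ) := by
  set p : ℕ → ℕ → ℝ := fun n j => gridPt t m.T (M * (n + 1) + n) j with hp
  have hpm : ∀ n, Monotone (p n) := fun n i j hij => gridPt_mono htT _ (Nat.cast_le.2 hij)
  have hp0 : ∀ n, p n 0 = t := fun n => by simp [hp, gridPt]
  have hplast : ∀ k n, p n (k * (n + 1)) = gridPt t m.T M k := fun k n => by
    have := gridPt_eq_of_refine t m.T M n k 0
    simp only [add_zero, Nat.cast_zero, zero_div] at this
    exact this
  have hN : Tendsto (fun n : ℕ => M * (n + 1) + n) atTop atTop :=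
    tendsto_atTop_mono (fun n => Nat.le_add_left _ _) tendsto_id
  have hmesh : ∀ ε > 0, ∀ᶠ n in atTop, ∀ k : ℕ, p n (k + 1) - p n k < ε := by
    intro ε hε
    filter_upwards [(tendsto_gridStep.comp hN).eventually (gt_mem_nhds hε)] with n hn k
    simp only [hp, gridPt, Function.comp] at hn ⊢
    push_cast at hn ⊢
    linarith
  have hlim : ∀ k ≤ M + 1, TendstoInMeasure P
      (fun n => riemannSum L (exposure m u) (k * (n + 1)) (p n)) atTop
      (noise m u t x X (gridPt t m.T M k)) := fun k hk =>
    hX.equation _ (gridPt_mem htT M hk) (fun n => k * (n + 1)) p hpm hp0 (hplast k)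
      fun ε hε => (hmesh ε hε).mono fun n hn j _ => hn j
  have hsum := tendstoInMeasure_sum (P := P) (M + 1)
    (f := fun k n ω => compound m (gridPt t m.T M k) *
      (riemannSum L (exposure m u) ((k + 1) * (n + 1)) (p n) ω
        + -1 * riemannSum L (exposure m u) (k * (n + 1)) (p n) ω))
    (f' := fun k ω => compound m (gridPt t m.T M k) *
      (noise m u t x X (gridPt t m.T M (k + 1)) ω + -1 * noise m u t x X (gridPt t m.T M k) ω))
    (fun k hk => by
      have h := hlim (k + 1) hk
      push_cast at h
      exact tendstoInMeasure_const_mul (tendstoInMeasure_add h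
        (tendstoInMeasure_const_mul (hlim k (by omega)) (-1))) _)
  have hpos : ∀ n k, 0 ≤ p n k := fun n k => by
    rw [← hp0 n] at ht
    exact ht.trans (hpm n (Nat.zero_le k))
  have hcf := tendsto_charFun_of_tendstoInMeasure (fun n => Finset.aemeasurable_fun_sum _
    fun k _ => ((hL.aemeasurable_riemannSum _ _ _ (hpos n)).add
      ((hL.aemeasurable_riemannSum _ _ _ (hpos n)).const_mul (-1))).const_mul _) hsum θ
  -- the characteristic functions of the approximating sums
  have hval : ∀ n : ℕ, charFun (P.map fun ω => ∑ k ∈ Finset.range (M + 1),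
      compound m (gridPt t m.T M k) *
      (riemannSum L (exposure m u) ((k + 1) * (n + 1)) (p n) ω
        + -1 * riemannSum L (exposure m u) (k * (n + 1)) (p n) ω)) θ
      = charFun (P.map Z) ((∑ j ∈ Finset.range (M * (n + 1) + n + 1),
        (gridPt t m.T (M * (n + 1) + n) (j + 1) - gridPt t m.T (M * (n + 1) + n) j) *
        (compound m (gridLo t m.T M (gridPt t m.T (M * (n + 1) + n) j)) ^ α *
          ψ (exposure m u (gridPt t m.T (M * (n + 1) + n) j)))) ^ (1 / α) * θ) := by
    intro n
    have hc := hS.charFun_sum hL hα (p n) (hpm n) (hpos n 0) (M * (n + 1) + n + 1)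
      (fun j => compound m (gridLo t m.T M (p n j)) • exposure m u (p n j)) (fun j hj =>
        hS.smul_mem _ (compound_pos m _).le _ (huC _ (gridPt_mem htT _ hj.le))) θ
    have e2 : ∀ j : ℕ, (p n (j + 1) - p n j) *
        ψ (compound m (gridLo t m.T M (p n j)) • exposure m u (p n j))
        = (gridPt t m.T (M * (n + 1) + n) (j + 1) - gridPt t m.T (M * (n + 1) + n) j) *
        (compound m (gridLo t m.T M (gridPt t m.T (M * (n + 1) + n) j)) ^ α *
          ψ (exposure m u (gridPt t m.T (M * (n + 1) + n) j))) := fun j => by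
      rw [hS.map_smul _ (compound_pos m _).le]
      simp only [hp]
      push_cast
      rfl
    simp only [e2] at hc
    rw [← hc]
    congr 2
    funext ω
    have h := sum_weights_refine t m.T htT M n (compound m)
      (fun j => exposure m u (p n j) ⬝ᵥ (L (p n (j + 1)) ω - L (p n j) ω)) (M + 1)
    have e3 : (M + 1) * (n + 1) = M * (n + 1) + n + 1 := by ring
    rw [e3] at h
    simp only [smul_dotProduct, smul_eq_mul]
    rw [← h]
    refine Finset.sum_congr rfl fun k _ => ?_
    simp only [riemannSum]
    ring
  replace hcf := hcf.congr hval
  have hR : IsRiemannOn (fun v => compound m (gridLo t m.T M v) ^ α * ψ (exposure m u v))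
      t m.T := by
    obtain ⟨D, hD⟩ := hu.1
    obtain ⟨D', hD'⟩ := isCompact_Icc.exists_bound_of_continuousOn
      (continuous_compound m).continuousOn (s := Icc t m.T)
    refine ⟨⟨D' ^ α * D, fun s hs => ?_⟩, ?_⟩
    · rw [abs_mul]
      have h1 := hD' _ (gridLo_mem htT M hs)
      rw [Real.norm_eq_abs, abs_of_pos (compound_pos m _)] at h1
      rw [abs_of_nonneg (Real.rpow_nonneg (compound_pos m _).le _)]
      exact mul_le_mul (Real.rpow_le_rpow (compound_pos m _).le h1 hα.le) (hD s hs) (abs_nonneg _)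
        (Real.rpow_nonneg ((compound_pos m _).le.trans h1) _)
    · filter_upwards [hu.2, ae_continuousAt_gridLo htT M] with v hv1 hv2 hmem
      refine ContinuousWithinAt.mul ?_ (hv1 hmem)
      refine ContinuousAt.continuousWithinAt ?_
      exact ((continuous_compound m).continuousAt.comp hv2).rpow_const (Or.inr hα.le)
  have hRlim := (hR.tendsto_sum htT).comp hN
  have hcont : Continuous fun y : ℝ => charFun (P.map Z) (y ^ (1 / α) * θ) :=
    hS.continuous_charFun.comp
      ((Real.continuous_rpow_const (by positivity)).mul continuous_const)
  have h2 := (hcont.tendsto _).comp hRlim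
  have h3 := tendsto_nhds_unique hcf h2
  rw [← h3]
  congr 2
  funext ω
  refine Finset.sum_congr rfl fun k _ => ?_
  ring

end Law

section Law

variable {Ω : Type*} [MeasurableSpace Ω] {P : Measure Ω} {d : ℕ}
  {α : ℝ} {L : ℝ → Ω → Fin d → ℝ}

/-- The wealth process starts at `x`: at `s = t` all Riemann sums vanish. -/
lemma IsWealth.ae_initial {m : Market d} {u : ℝ → Fin d → ℝ} {t x : ℝ}
    {X : ℝ → Ω → ℝ} (hX : IsWealth P L m u t x X) (htT : t ≤ m.T) : ∀ᵐ ω ∂P, X t ω = x := by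
  have h := hX.equation t ⟨le_rfl, htT⟩ (fun _ => 0) (fun _ _ => t) (fun _ => monotone_const)
    (fun _ => rfl) (fun _ => rfl) (fun ε hε => Eventually.of_forall fun n k hk => by simpa)
  have h0 : TendstoInMeasure P (fun _ : ℕ => riemannSum L (exposure m u) 0 (fun _ => t)) atTop
      (fun _ => 0) := by
    rw [tendstoInMeasure_iff_norm]
    intro ε hε
    simp [riemannSum, not_le.2 hε]
  filter_upwards [tendstoInMeasure_ae_unique h h0] with ω hω
  simp only [intervalIntegral.integral_same] at hω
  linarith

/-- Path by path, the terminal gain less its drift is the integral of the compounding factor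
against the stochastic integral process. -/
lemma tendsto_sum_noise {Ω' : Type*} {m : Market d} {u : ℝ → Fin d → ℝ} {t x : ℝ}
    {X : ℝ → Ω' → ℝ} (htT : t < m.T) (hu : IsRiemannOn (excess m u) t m.T) {ω : Ω'}
    (hX : IsCadlagOn (fun s => X s ω) t m.T) (hXt : X t ω = x) :
    Tendsto (fun n : ℕ => ∑ k ∈ Finset.range (n + 1), compound m (gridPt t m.T n k) *
      (noise m u t x X (gridPt t m.T n (k + 1)) ω - noise m u t x X (gridPt t m.T n k) ω)) atTop
      (𝓝 (gain m t x (X m.T) ω - ∫ v in t..m.T, compound m v * excess m u v)) := by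
  obtain ⟨CX, hCX⟩ := hX.exists_bound
  obtain ⟨Ca, hCa⟩ := hu.1
  obtain ⟨Ce, hCe⟩ := isCompact_Icc.exists_bound_of_continuousOn
      (continuous_compound m).continuousOn (s := Icc t m.T)
  have hCe' : ∀ v ∈ Icc t m.T, |compound m v| ≤ Ce := hCe
  have htm : t ∈ Icc t m.T := ⟨le_rfl, htT.le⟩
  have hCX0 : 0 ≤ CX := (abs_nonneg _).trans (hCX t htm)
  have hCe0 : 0 ≤ Ce := (abs_nonneg _).trans (hCe' t htm)
  have hint : IntervalIntegrable (fun v => m.r * X v ω + excess m u v) volume t m.T :=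
    ((hX.intervalIntegrable htT.le).const_mul _).add (hu.intervalIntegrable htT.le)
  have hmeasX : AEStronglyMeasurable (fun v => m.r * X v ω + excess m u v)
      (volume.restrict (Ioc t m.T)) :=
    (hX.aestronglyMeasurable.const_mul _).add (hu.aestronglyMeasurable htT)
  set G : ℝ → ℝ → ℝ → ℝ := fun v l y =>
    m.r * compound m v * X y ω - compound m l * (m.r * X v ω + excess m u v) with hG
  have hGm : ∀ n, AEStronglyMeasurable
      (fun v => G v (gridLo t m.T n v) (gridUp t m.T n v)) (volume.restrict (Ioc t m.T)) :=
    fun n => ((((continuous_compound m).const_mul m.r).aestronglyMeasurable.mul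
      (measurable_comp_gridUp (fun s => X s ω) n).aestronglyMeasurable)).sub
      ((measurable_comp_gridLo (compound m) n).aestronglyMeasurable.mul hmeasX)
  have hGb : ∀ n, ∀ v ∈ Ioc t m.T, |G v (gridLo t m.T n v) (gridUp t m.T n v)|
      ≤ |m.r| * Ce * CX + Ce * (|m.r| * CX + Ca) := by
    intro n v hv
    have hv' := Ioc_subset_Icc_self hv
    refine (abs_sub _ _).trans (add_le_add ?_ ?_)
    · rw [abs_mul, abs_mul]
      have := hCe' v hv'
      have := hCX _ (gridUp_mem htT n hv')
      gcongr
    · rw [abs_mul]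
      have h1 := hCe' _ (gridLo_mem htT n hv')
      have h2 := hCX _ hv'
      have h3 := hCa _ hv'
      refine mul_le_mul h1 ((abs_add_le _ _).trans ?_) (abs_nonneg _) hCe0
      rw [abs_mul]
      gcongr
  have hlim := tendsto_intervalIntegral_of_bounded htT.le hGm hGb
    (g' := fun v => -(compound m v * excess m u v)) (by
      filter_upwards [ae_ne_right m.T] with v hv hmem
      have h1 := hX.tendsto_gridUp (v := v) ⟨hmem.1.le, lt_of_le_of_ne hmem.2 hv⟩
      have h2 := ((continuous_compound m).tendsto v).comp (tendsto_gridLo htT v)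
      have h3 := (h1.const_mul (m.r * compound m v)).sub
        (h2.mul_const (m.r * X v ω + excess m u v))
      refine h3.congr' ?_ |>.trans_eq ?_
      · exact Eventually.of_forall fun n => rfl
      · congr 1
        ring)
  have hfin := hlim.const_add (X m.T ω - x * compound m t)
  rw [intervalIntegral.integral_neg, ← sub_eq_add_neg] at hfin
  refine hfin.congr fun n => ?_
  rw [← sum_integral_grid htT n G
    (intervalIntegrable_of_bounded htT.le (hGm n) (hGb n))]
  have hcell : ∀ k ∈ Finset.range (n + 1),
      compound m (gridPt t m.T n k) *
      (noise m u t x X (gridPt t m.T n (k + 1)) ω - noise m u t x X (gridPt t m.T n k) ω)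
      = (compound m (gridPt t m.T n ((k + 1 : ℕ) : ℝ)) * X (gridPt t m.T n ((k + 1 : ℕ) : ℝ)) ω
        - compound m (gridPt t m.T n k) * X (gridPt t m.T n k) ω)
        + ∫ v in (gridPt t m.T n k)..(gridPt t m.T n (k + 1)),
          G v (gridPt t m.T n k) (gridPt t m.T n (k + 1)) := by
    intro k hk
    have hk := Finset.mem_range.1 hk
    have hm0 := gridPt_mem htT n hk.le
    have hm1 := gridPt_mem htT n (Nat.succ_le_of_lt hk)
    push_cast at hm1
    have hsub : ∀ {a b}, a ∈ Icc t m.T → b ∈ Icc t m.T → IntervalIntegrable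
        (fun v => m.r * X v ω + excess m u v) volume a b := fun {a b} ha hb =>
      hint.mono_set (by
        rw [uIcc_of_le htT.le]
        exact uIcc_subset_Icc ha hb)
    have hi1 : ∫ v in (gridPt t m.T n k)..(gridPt t m.T n (k + 1)), m.r * compound m v
        = compound m (gridPt t m.T n k) - compound m (gridPt t m.T n (k + 1)) := by
      rw [intervalIntegral.integral_eq_sub_of_hasDerivAt
        (f := fun v => -compound m v) (fun v _ => by
          have h := (hasDerivAt_compound m v).neg
          rw [neg_neg] at h
          exact h)
        (((continuous_compound m).const_mul m.r).intervalIntegrable _ _)]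
      ring
    have hi2 := intervalIntegral.integral_add_adjacent_intervals (hsub htm hm0) (hsub hm0 hm1)
    simp only [hG]
    rw [intervalIntegral.integral_sub
      ((((continuous_compound m).const_mul m.r).intervalIntegrable _ _).mul_const _)
      ((hsub hm0 hm1).const_mul _), intervalIntegral.integral_mul_const, hi1,
      intervalIntegral.integral_const_mul]
    simp only [noise]
    push_cast
    rw [← hi2]
    ring
  rw [Finset.sum_congr rfl hcell, Finset.sum_add_distrib,
    Finset.sum_range_sub (fun k : ℕ => compound m (gridPt t m.T n k) * X (gridPt t m.T n k) ω),
    gridPt_last, Nat.cast_zero, gridPt_zero, hXt]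
  have : compound m m.T = 1 := by simp [compound]
  rw [this]
  ring

/-- The terminal gain of a deterministic strategy is `A + B^{1/α} Z` in law. -/
theorem IsScale.charFun_gain [IsProbabilityMeasure P] {C : Set (Fin d → ℝ)} {Z : Ω → ℝ}
    {ψ : (Fin d → ℝ) → ℝ} (hS : IsScale P α L C Z ψ) (hL : IsLevy P L) (hα : 0 < α)
    {m : Market d} {u : ℝ → Fin d → ℝ} {t x : ℝ} {X : ℝ → Ω → ℝ} (hX : IsWealth P L m u t x X)
    (ht : 0 ≤ t) (htT : t < m.T) (huC : ∀ s ∈ Icc t m.T, exposure m u s ∈ C)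
    (hu : IsRiemannOn (fun s => ψ (exposure m u s)) t m.T)
    (hu' : IsRiemannOn (excess m u) t m.T) (θ : ℝ) :
    charFun (P.map fun ω => gain m t x (X m.T) ω - ∫ v in t..m.T, compound m v * excess m u v) θ
      = charFun (P.map Z)
        ((∫ v in t..m.T, compound m v ^ α * ψ (exposure m u v)) ^ (1 / α) * θ) := by
  have hmeas : ∀ n : ℕ, AEMeasurable (fun ω => ∑ k ∈ Finset.range (n + 1),
      compound m (gridPt t m.T n k) * (noise m u t x X (gridPt t m.T n (k + 1)) ω
        - noise m u t x X (gridPt t m.T n k) ω)) P := fun n => by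
    refine Finset.aemeasurable_fun_sum _ fun k hk => AEMeasurable.const_mul ?_ _
    have hk := Finset.mem_range.1 hk
    have hm1 := gridPt_mem htT n (Nat.succ_le_of_lt hk)
    push_cast at hm1
    exact (hL.aemeasurable_noise hX ht hm1).sub
      (hL.aemeasurable_noise hX ht (gridPt_mem htT n hk.le))
  have hconv := tendstoInMeasure_of_tendsto_ae (fun n => (hmeas n).aestronglyMeasurable) (by
    filter_upwards [hX.cadlag, hX.ae_initial htT.le] with ω h1 h2
    exact tendsto_sum_noise htT hu' h1 h2)
  have h1 := tendsto_charFun_of_tendstoInMeasure hmeas hconv θ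
  replace h1 := h1.congr fun n => hS.charFun_sum_noise hL hα hX ht htT huC hu n θ
  obtain ⟨D, hD⟩ := hu.1
  obtain ⟨D', hD'⟩ := isCompact_Icc.exists_bound_of_continuousOn
    (continuous_compound m).continuousOn (s := Icc t m.T)
  have h2 := tendsto_intervalIntegral_of_bounded (C := D' ^ α * D) htT.le
    (g := fun n v => compound m (gridLo t m.T n v) ^ α * ψ (exposure m u v))
    (g' := fun v => compound m v ^ α * ψ (exposure m u v))
    (fun n => (((measurable_comp_gridLo (compound m) n).pow_const α).aestronglyMeasurable).mul
      (hu.aestronglyMeasurable htT)) (fun n v hv => by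
      rw [abs_mul]
      have hv' := Ioc_subset_Icc_self hv
      have h1 := hD' _ (gridLo_mem htT n hv')
      rw [Real.norm_eq_abs, abs_of_pos (compound_pos m _)] at h1
      rw [abs_of_nonneg (Real.rpow_nonneg (compound_pos m _).le _)]
      exact mul_le_mul (Real.rpow_le_rpow (compound_pos m _).le h1 hα.le) (hD v hv')
        (abs_nonneg _) (Real.rpow_nonneg ((compound_pos m _).le.trans h1) _))
    (Eventually.of_forall fun v _ => by
      refine Tendsto.mul_const _ (Tendsto.rpow_const ?_ (Or.inr hα.le))
      exact ((continuous_compound m).tendsto v).comp (tendsto_gridLo htT v))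
  have hcont : Continuous fun y : ℝ => charFun (P.map Z) (y ^ (1 / α) * θ) :=
    hS.continuous_charFun.comp
      ((Real.continuous_rpow_const (by positivity)).mul continuous_const)
  exact tendsto_nhds_unique h1 ((hcont.tendsto _).comp h2)

/-- The law of the terminal gain, as equality in distribution. -/
theorem IsScale.identDistrib_gain [IsProbabilityMeasure P] {C : Set (Fin d → ℝ)} {Z : Ω → ℝ}
    {ψ : (Fin d → ℝ) → ℝ} (hS : IsScale P α L C Z ψ) (hL : IsLevy P L) (hα : 0 < α)
    {m : Market d} {u : ℝ → Fin d → ℝ} {t x : ℝ} {X : ℝ → Ω → ℝ} (hX : IsWealth P L m u t x X)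
    (ht : 0 ≤ t) (htT : t < m.T) (huC : ∀ s ∈ Icc t m.T, exposure m u s ∈ C)
    (hu : IsRiemannOn (fun s => ψ (exposure m u s)) t m.T)
    (hu' : IsRiemannOn (excess m u) t m.T) :
    IdentDistrib (gain m t x (X m.T)) (fun ω => (∫ v in t..m.T, compound m v * excess m u v)
      + (∫ v in t..m.T, compound m v ^ α * ψ (exposure m u v)) ^ (1 / α) * Z ω) P P := by
  set A := ∫ v in t..m.T, compound m v * excess m u v
  have hg : AEMeasurable (gain m t x (X m.T)) P :=
    (hX.aemeasurable _ ⟨htT.le, le_rfl⟩).sub_const _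
  have hZ := hS.measurable
  have h : IdentDistrib (fun ω => gain m t x (X m.T) ω - A) (fun ω =>
      (∫ v in t..m.T, compound m v ^ α * ψ (exposure m u v)) ^ (1 / α) * Z ω) P P := by
    refine ⟨hg.sub_const _, (hZ.const_mul _).aemeasurable, ?_⟩
    have i1 := Measure.isProbabilityMeasure_map (μ := P) (hg.sub_const A)
    have i2 := Measure.isProbabilityMeasure_map (μ := P) (hZ.const_mul
      ((∫ v in t..m.T, compound m v ^ α * ψ (exposure m u v)) ^ (1 / α))).aemeasurable
    refine Measure.ext_of_charFun ?_
    funext θ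
    rw [hS.charFun_gain hL hα hX ht htT huC hu hu', charFun_map_mul_comp hZ.aemeasurable]
  have h2 := h.comp (measurable_const_add A)
  simpa [Function.comp_def] using h2

end Law

/-! ### Wealth processes of switched strategies -/

lemma IsCadlagOn.mono_left {E : Type*} [TopologicalSpace E] {f : ℝ → E} {a b c : ℝ}
    (hf : IsCadlagOn f a b) (hc : a ≤ c) : IsCadlagOn f c b :=
  ⟨fun s hs => hf.1 s ⟨hc.trans hs.1, hs.2⟩, fun s hs => hf.2 s ⟨hc.trans_lt hs.1, hs.2⟩⟩

lemma IsCadlagOn.continuous_comp {E : Type*} [TopologicalSpace E] {f : ℝ → E} {a b : ℝ}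
    (hf : IsCadlagOn f a b) {g : E → ℝ} (hg : Continuous g) :
    IsCadlagOn (fun s => g (f s)) a b := by
  refine ⟨fun s hs => hg.continuousAt.comp_continuousWithinAt (hf.1 s hs), fun s hs => ?_⟩
  obtain ⟨l, hl⟩ := hf.2 s hs
  exact ⟨g l, (hg.tendsto l).comp hl⟩

lemma continuous_dotProduct_left {d : ℕ} (H : Fin d → ℝ) :
    Continuous fun y : Fin d → ℝ => H ⬝ᵥ y := by
  unfold dotProduct
  fun_prop

/-- Variation of constants: `y = Q + r ∫ e^{r(· - v)} Q_v dv` solves `y = Q + r ∫ y`. -/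
lemma integral_variation_of_constants {Q : ℝ → ℝ} {a b : ℝ} (hQ : IsCadlagOn Q a b) (r : ℝ)
    {s : ℝ} (hs : s ∈ Icc a b) :
    ∫ y in a..s, (Q y + r * (Real.exp (r * y) * ∫ z in a..y, Real.exp (-(r * z)) * Q z))
      = Real.exp (r * s) * ∫ z in a..s, Real.exp (-(r * z)) * Q z := by
  have hQs := hQ.mono hs.2
  have hW : IsCadlagOn (fun z => Real.exp (-(r * z)) * Q z) a s :=
    hQs.mul_continuous (by fun_prop)
  have hR := hW.integral hs.1
  have hexp : Continuous fun y => Real.exp (r * y) := by fun_prop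
  have hi : IntervalIntegrable
      (fun y => Q y + r * (Real.exp (r * y) * ∫ z in a..y, Real.exp (-(r * z)) * Q z))
      volume a s := by
    refine (hQs.intervalIntegrable hs.1).add (ContinuousOn.intervalIntegrable ?_)
    rw [uIcc_of_le hs.1]
    exact (hexp.continuousOn.mul hR).const_smul r
  have h := intervalIntegral.integral_eq_sub_of_hasDeriv_right_of_le hs.1
    (f := fun y => Real.exp (r * y) * ∫ z in a..y, Real.exp (-(r * z)) * Q z)
    (hexp.continuousOn.mul hR) (fun y hy => ?_) hi
  · rw [h]
    simp
  · have hWy := hW.mono hy.2.le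
    have hd : HasDerivWithinAt (fun y => ∫ z in a..y, Real.exp (-(r * z)) * Q z)
        (Real.exp (-(r * y)) * Q y) (Ioi y) y := by
      refine HasDerivWithinAt.mono ?_ (Ioi_subset_Ici_self (a := y))
      refine intervalIntegral.integral_hasDerivWithinAt_right
        (hWy.intervalIntegrable hy.1.le) (t := Ioi y) ?_ ?_
      · refine ⟨Ioc a s, ?_, hW.aestronglyMeasurable⟩
        exact mem_of_superset (Ioo_mem_nhdsGT hy.2) fun z hz => ⟨hy.1.trans hz.1, hz.2.le⟩
      · exact (hW.1 y ⟨hy.1.le, hy.2⟩).mono Ioi_subset_Ici_self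
    have he : HasDerivAt (fun y => Real.exp (r * y)) (Real.exp (r * y) * (r * 1)) y :=
      ((hasDerivAt_id y).const_mul r).exp
    have hcancel : Real.exp (r * y) * Real.exp (-(r * y)) = 1 := by
      rw [← Real.exp_add]
      simp
    refine (he.hasDerivWithinAt.mul hd).congr_deriv ?_
    linear_combination Q y * hcancel

section Switch

variable {Ω : Type*} {d : ℕ} {L : ℝ → Ω → Fin d → ℝ}

lemma abs_dotProduct_le {a b : Fin d → ℝ} {C : ℝ} (hC : ∀ i, |a i| ≤ C) :
    |a ⬝ᵥ b| ≤ d * (C * ‖b‖) := by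
  unfold dotProduct
  refine (Finset.abs_sum_le_sum_abs _ _).trans ?_
  refine (Finset.sum_le_card_nsmul _ _ (C * ‖b‖) fun i _ => ?_).trans_eq (by simp)
  rw [abs_mul]
  exact mul_le_mul (hC i) (norm_le_pi_norm b i) (abs_nonneg _) ((abs_nonneg _).trans (hC i))

/-- The part of a Riemann sum which belongs to the cell that contains the switching time. -/
noncomputable def switchError (L : ℝ → Ω → Fin d → ℝ) (G : ℝ → Fin d → ℝ) (τ : ℝ) (N : ℕ)
    (p : ℕ → ℝ) (ω : Ω) : ℝ :=
  ∑ k ∈ Finset.range N,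
    if p k ≤ τ then G (p k) ⬝ᵥ (L (p (k + 1)) ω - L (min (p (k + 1)) τ) ω) else 0

/-- The Riemann sums of a switched integrand. -/
lemma riemannSum_switch {G : ℝ → Fin d → ℝ} {G' : ℝ → Fin d → ℝ} {c : Fin d → ℝ} {τ : ℝ} {N : ℕ}
    {p : ℕ → ℝ} (hp : Monotone p) (hτ : p 0 ≤ τ) (h1 : ∀ k < N, p k ≤ τ → G' (p k) = c)
    (h2 : ∀ k < N, τ < p k → G' (p k) = G (p k)) (ω : Ω) :
    riemannSum L G' N p ω = riemannSum L G N p ω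
      + -1 * riemannSum L G N (fun k => min (p k) τ) ω
      + c ⬝ᵥ (L (min (p N) τ) ω - L (p 0) ω)
      + switchError L (fun s => c - G s) τ N p ω := by
  have e : c ⬝ᵥ (L (min (p N) τ) ω - L (p 0) ω)
      = ∑ k ∈ Finset.range N, c ⬝ᵥ (L (min (p (k + 1)) τ) ω - L (min (p k) τ) ω) := by
    simp only [dotProduct_sub]
    rw [Finset.sum_range_sub (fun k => c ⬝ᵥ L (min (p k) τ) ω), min_eq_left hτ]
  rw [e]
  simp only [riemannSum, switchError]
  rw [Finset.mul_sum, ← Finset.sum_add_distrib, ← Finset.sum_add_distrib,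
    ← Finset.sum_add_distrib]
  refine Finset.sum_congr rfl fun k hk => ?_
  have hk := Finset.mem_range.1 hk
  rcases le_or_gt (p k) τ with h | h
  · rw [h1 k hk h, if_pos h, min_eq_left h]
    simp only [dotProduct_sub, sub_dotProduct]
    ring
  · have h' : τ < p (k + 1) := h.trans_le (hp (Nat.le_succ k))
    rw [h2 k hk h, if_neg (not_le.2 h), min_eq_right h.le, min_eq_right h'.le]
    simp

/-- The cell that contains the switching time contributes nothing in the limit, by right-continuity
of the paths. -/
lemma tendsto_switchError {G : ℝ → Fin d → ℝ} {τ s t C : ℝ} (hG : ∀ y ∈ Icc t s, ∀ i, |G y i| ≤ C)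
    {N : ℕ → ℕ} {p : ℕ → ℕ → ℝ} (hp : ∀ n, Monotone (p n)) (hp0 : ∀ n, p n 0 = t)
    (hpN : ∀ n, p n (N n) = s)
    (hmesh : ∀ ε > 0, ∀ᶠ n in atTop, ∀ k < N n, p n (k + 1) - p n k < ε) {ω : Ω}
    (hL : ContinuousWithinAt (fun s => L s ω) (Ici τ) τ) :
    Tendsto (fun n => switchError L G τ (N n) (p n) ω) atTop (𝓝 0) := by
  rw [Metric.tendsto_atTop']
  intro ε hε
  set η := ε / (d * |C| + 1) with hη
  have hηpos : 0 < η := by positivity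
  obtain ⟨δ, hδ, hδL⟩ := Metric.continuousWithinAt_iff.1 hL η hηpos
  obtain ⟨n₀, hn₀⟩ := eventually_atTop.1 (hmesh δ hδ)
  refine ⟨n₀, fun n hn => ?_⟩
  rw [Real.dist_eq, sub_zero]
  have hmem : ∀ k ≤ N n, p n k ∈ Icc t s := fun k hk =>
    ⟨(hp0 n).symm.trans_le (hp n (Nat.zero_le k)), (hp n hk).trans_eq (hpN n)⟩
  unfold switchError
  -- at most one cell contains the switching time
  by_cases hk : ∃ k < N n, p n k ≤ τ ∧ τ < p n (k + 1)
  · obtain ⟨k, hkN, hk1, hk2⟩ := hk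
    rw [Finset.sum_eq_single k]
    · rw [if_pos hk1, min_eq_right hk2.le]
      refine (abs_dotProduct_le (hG _ (hmem k hkN.le))).trans_lt ?_
      have h1 := hδL (x := p n (k + 1)) hk2.le (by
        rw [Real.dist_eq, abs_of_pos (sub_pos.2 hk2)]
        linarith [hn₀ n hn.le k hkN])
      rw [dist_eq_norm] at h1
      calc (d : ℝ) * (C * ‖L (p n (k + 1)) ω - L τ ω‖)
          ≤ d * (|C| * η) := by
            gcongr
            exact le_abs_self C
        _ < (d * |C| + 1) * η := by nlinarith
        _ = ε := by
            rw [hη]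
            field_simp
    · intro j hj hjk
      rcases lt_or_gt_of_ne hjk with h | h
      · rw [min_eq_left ((hp n (Nat.succ_le_of_lt h)).trans hk1)]
        simp
      · rw [if_neg (not_le.2 (hk2.trans_le (hp n (Nat.succ_le_of_lt h))))]
    · intro h
      exact absurd (Finset.mem_range.2 hkN) h
  · push Not at hk
    rw [Finset.sum_eq_zero]
    · simpa
    · intro k hkN
      split_ifs with h
      · rw [min_eq_left (hk k (Finset.mem_range.1 hkN) h)]
        simp
      · rfl

lemma isCadlagOn_noise {m : Market d} {v : ℝ → Fin d → ℝ} {t x : ℝ} {X : ℝ → Ω → ℝ} {ω : Ω}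
    (htT : t ≤ m.T) (hX : IsCadlagOn (fun s => X s ω) t m.T)
    (hv : IntervalIntegrable (excess m v) volume t m.T) :
    IsCadlagOn (fun s => noise m v t x X s ω) t m.T := by
  have hi : IntervalIntegrable (fun y => m.r * X y ω + excess m v y) volume t m.T :=
    ((hX.intervalIntegrable htT).const_mul _).add hv
  have h1 : ContinuousOn (fun s => -x - ∫ y in t..s, (m.r * X y ω + excess m v y))
      (Icc t m.T) := by
    refine continuousOn_const.sub ?_
    exact (intervalIntegral.continuousOn_primitive_interval' hi left_mem_uIcc).mono
      (by rw [uIcc_of_le htT])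
  have h2 := hX.add (isCadlagOn_of_continuousOn h1)
  convert h2 using 2 with s
  simp only [noise]
  ring

/-- If the exposure of `u` to the noise is constant on `[t, τ]`, a wealth process for the strategy
that follows `u` until `τ` and `v` afterwards is obtained from one for `v`, by changing the
stochastic integral until `τ` and solving the linear wealth equation path by path. -/
theorem exists_isWealth_switch [MeasurableSpace Ω] {P : Measure Ω} [IsProbabilityMeasure P]
    (hL : IsLevy P L) {m : Market d}
    {u v : ℝ → Fin d → ℝ} {t x τ : ℝ} {X : ℝ → Ω → ℝ} (hX : IsWealth P L m v t x X) (ht : 0 ≤ t)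
    (htτ : t ≤ τ) (hτT : τ < m.T) {c : Fin d → ℝ} (hc : ∀ s ∈ Icc t τ, exposure m u s = c)
    {C : ℝ} (hC : ∀ s ∈ Icc t m.T, ∀ i, |exposure m v s i| ≤ C)
    (hv : IsRiemannOn (excess m v) t m.T)
    (hw : IsRiemannOn (excess m (switchAt τ u v)) t m.T) :
    ∃ Y, IsWealth P L m (switchAt τ u v) t x Y := by
  have htT : t ≤ m.T := htτ.trans hτT.le
  have hvi := hv.intervalIntegrable htT
  have hwi := hw.intervalIntegrable htT
  set E : ℝ → Ω → ℝ := fun s ω =>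
    c ⬝ᵥ (L (min s τ) ω - L t ω) + -1 * noise m v t x X (min s τ) ω with hE
  set q : ℝ → ℝ := fun s => ∫ y in t..s, (excess m (switchAt τ u v) y - excess m v y) with hq
  set Q : ℝ → Ω → ℝ := fun s ω => E s ω + q s with hQ
  set R : ℝ → Ω → ℝ := fun s ω => Real.exp (m.r * s) *
    ∫ z in t..s, Real.exp (-(m.r * z)) * Q z ω with hR
  set Y : ℝ → Ω → ℝ := fun s ω => X s ω + (Q s ω + m.r * R s ω) with hY
  have hqc : ContinuousOn q (Icc t m.T) :=
    (intervalIntegral.continuousOn_primitive_interval' (hwi.sub hvi) left_mem_uIcc).mono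
      (by rw [uIcc_of_le htT])
  have hmem : ∀ s ∈ Icc t m.T, min s τ ∈ Icc t m.T := fun s hs =>
    ⟨le_min hs.1 htτ, (min_le_left _ _).trans hs.2⟩
  have hcad : ∀ᵐ ω ∂P, IsCadlagOn (fun s => X s ω) t m.T ∧
      IsCadlagOn (fun s => Q s ω) t m.T ∧ ContinuousWithinAt (fun s => L s ω) (Ici τ) τ := by
    filter_upwards [hX.cadlag, hL.cadlag] with ω h1 h2
    have h3 := (h2 m.T m.T_pos).mono_left ht
    refine ⟨h1, ?_, h3.1 τ ⟨htτ, hτT⟩⟩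
    have h4 : IsCadlagOn (fun s => c ⬝ᵥ (L s ω - L t ω)) t m.T :=
      h3.continuous_comp (g := fun y => c ⬝ᵥ (y - L t ω))
        ((continuous_dotProduct_left c).comp (continuous_id.sub continuous_const))
    have h5 := (isCadlagOn_noise (x := x) htT h1 hvi).const_mul (-1)
    exact ((h4.stopped τ).add (h5.stopped τ)).add (isCadlagOn_of_continuousOn hqc)
  have hQm : ∀ s ∈ Icc t m.T, AEMeasurable (Q s) P := fun s hs => by
    have hs' := hmem s hs
    refine AEMeasurable.add_const (AEMeasurable.add ?_ ?_) _
    · exact ((measurable_dotProduct_left c).comp ((hL.measurable _ (ht.trans hs'.1)).sub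
        (hL.measurable t ht))).aemeasurable
    · exact (hL.aemeasurable_noise hX ht hs').const_mul _
  have hexp : Continuous fun z => Real.exp (-(m.r * z)) := by fun_prop
  refine ⟨Y, fun s hs => ?_, ?_, fun s hs => ?_⟩
  · refine (hX.aemeasurable s hs).add ((hQm s hs).add (AEMeasurable.const_mul
      (AEMeasurable.const_mul ?_ _) _))
    refine aemeasurable_integral_of_cadlag hs.1
      (fun z hz => (hQm z ⟨hz.1, hz.2.trans hs.2⟩).const_mul _) ?_
    filter_upwards [hcad] with ω hω
    exact (hω.2.1.mono hs.2).mul_continuous hexp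
  · filter_upwards [hcad] with ω hω
    refine hω.1.add (hω.2.1.add (IsCadlagOn.const_mul (isCadlagOn_of_continuousOn ?_) _))
    refine ContinuousOn.mul (by fun_prop) ?_
    exact (hω.2.1.mul_continuous hexp).integral htT
  · -- the stochastic integral of the switched strategy
    have hnoise : ∀ᵐ ω ∂P, Y s ω - x - ∫ y in t..s, (m.r * Y y ω +
        ∑ i, switchAt τ u v y i * (m.μ y i - m.r)) = noise m v t x X s ω + E s ω := by
      filter_upwards [hcad] with ω hω
      have hXi := (hω.1.mono hs.2).intervalIntegrable hs.1
      have hQi := (hω.2.1.mono hs.2).intervalIntegrable hs.1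
      have hRi : IntervalIntegrable (fun y => R y ω) volume t s := by
        refine ContinuousOn.intervalIntegrable ?_
        rw [uIcc_of_le hs.1]
        refine ContinuousOn.mul (by fun_prop) ?_
        exact ((hω.2.1.mono hs.2).mul_continuous hexp).integral hs.1
      have hsub : uIcc t s ⊆ uIcc t m.T := by
        rw [uIcc_of_le hs.1, uIcc_of_le htT]
        exact Icc_subset_Icc_right hs.2
      have hvs := hvi.mono_set hsub
      have hws := hwi.mono_set hsub
      have hvar : ∫ y in t..s, (Q y ω + m.r * R y ω) = R s ω :=
        integral_variation_of_constants hω.2.1 m.r hs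
      have h1 : ∫ y in t..s, (m.r * Y y ω + ∑ i, switchAt τ u v y i * (m.μ y i - m.r))
          = (∫ y in t..s, (m.r * X y ω + excess m v y)) + m.r * R s ω + q s := by
        rw [← hvar, ← intervalIntegral.integral_const_mul, hq,
          ← intervalIntegral.integral_add ((hXi.const_mul _).add hvs)
            ((hQi.add (hRi.const_mul _)).const_mul _),
          ← intervalIntegral.integral_add (((hXi.const_mul _).add hvs).add
            ((hQi.add (hRi.const_mul _)).const_mul _)) (hws.sub hvs)]
        refine intervalIntegral.integral_congr fun y _ => ?_
        simp only [hY, excess]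
        ring
      rw [h1]
      simp only [hY, hQ, noise]
      ring
    intro N p hp hp0 hpN hmesh
    have hpos : ∀ n k, 0 ≤ p n k := fun n k =>
      ht.trans ((hp0 n).symm.trans_le (hp n (Nat.zero_le k)))
    have hmemp : ∀ n, ∀ k < N n, p n k ∈ Icc t m.T := fun n k hk =>
      ⟨(hp0 n).symm.trans_le (hp n (Nat.zero_le k)),
        ((hp n hk.le).trans_eq (hpN n)).trans hs.2⟩
    have l1 := hX.equation s hs N p hp hp0 hpN hmesh
    have l2 := tendstoInMeasure_const_mul (hX.equation (min s τ) (hmem s hs) N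
      (fun n k => min (p n k) τ) (fun n => (hp n).min monotone_const)
      (fun n => by simp only [hp0 n, min_eq_left htτ]) (fun n => by simp only [hpN n])
      (fun ε hε => (hmesh ε hε).mono fun n hn k hk => by
        refine lt_of_le_of_lt ?_ (hn k hk)
        have := hp n (Nat.le_succ k)
        rcases le_total (p n (k + 1)) τ with h | h
        · rw [min_eq_left h, min_eq_left (this.trans h)]
        · rw [min_eq_right h]
          rcases le_total (p n k) τ with h' | h'
          · rw [min_eq_left h']
            linarith
          · rw [min_eq_right h']
            linarith)) (-1)
    have l3 : TendstoInMeasure P (fun n => switchError L (fun s => c - exposure m v s) τ (N n)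
        (p n)) atTop (fun _ => 0) := by
      refine tendstoInMeasure_of_tendsto_ae (fun n => ?_) ?_
      · refine AEMeasurable.aestronglyMeasurable (Finset.aemeasurable_fun_sum _ fun k _ => ?_)
        split_ifs
        · exact ((measurable_dotProduct_left _).comp ((hL.measurable _ (hpos n _)).sub
            (hL.measurable _ (le_min (hpos n _) (ht.trans htτ))))).aemeasurable
        · exact aemeasurable_const
      · filter_upwards [hcad] with ω hω
        refine tendsto_switchError (C := ‖c‖ + C) (fun y hy i => ?_) hp hp0 hpN hmesh hω.2.2
        exact (abs_sub _ _).trans (add_le_add (norm_le_pi_norm c i)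
          (hC y ⟨hy.1, hy.2.trans hs.2⟩ i))
    have l4 : TendstoInMeasure P (fun _ : ℕ => fun ω => c ⬝ᵥ (L (min s τ) ω - L t ω)) atTop
        (fun ω => c ⬝ᵥ (L (min s τ) ω - L t ω)) := by
      rw [tendstoInMeasure_iff_norm]
      intro ε hε
      simp [not_le.2 hε]
    have l5 := tendstoInMeasure_add (tendstoInMeasure_add (tendstoInMeasure_add l1 l2) l4) l3
    refine l5.congr (fun n => Eventually.of_forall fun ω => ?_) ?_
    · have h := riemannSum_switch (L := L) (G := exposure m v)
        (G' := exposure m (switchAt τ u v)) (c := c) (τ := τ) (N := N n) (hp n)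
        (by rw [hp0 n]; exact htτ) (fun k hk hkτ => by
          rw [← hc _ ⟨(hmemp n k hk).1, hkτ⟩]
          simp only [exposure, switchAt, if_pos hkτ]) (fun k hk hkτ => by
          simp only [exposure, switchAt, if_neg (not_le.2 hkτ)]) ω
      rw [hpN n, hp0 n] at h
      exact h.symm
    · filter_upwards [hnoise] with ω hω
      rw [hω]
      simp only [hE, noise, excess]
      ring

end Switch

/-! ### The expected target and the risk as functions of location and scale -/

section Target

variable {Ω : Type*} [MeasurableSpace Ω] {P : Measure Ω}

/-- The standing assumptions on the target function `U` and the noise variable `Z`. -/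
structure IsTarget (P : Measure Ω) (U : ℝ → ℝ) (Z : Ω → ℝ) : Prop where
  contDiff : ContDiff ℝ 1 U
  mono : Monotone U
  concave : ConcaveOn ℝ univ U
  measurable : Measurable Z
  integrable : ∀ a b : ℝ, Integrable (fun ω => U (a + b * Z ω)) P
  integrable_mul_deriv : ∀ a b : ℝ, Integrable (fun ω => Z ω * deriv U (a + b * Z ω)) P

/-- `E[U(a + b Z)]`. -/
noncomputable def targetMean (P : Measure Ω) (U : ℝ → ℝ) (Z : Ω → ℝ) (a b : ℝ) : ℝ :=
  ∫ ω, U (a + b * Z ω) ∂P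

/-- `E[U'(a + b Z)]`, the derivative of the expected target with respect to the location. -/
noncomputable def targetLoc (P : Measure Ω) (U : ℝ → ℝ) (Z : Ω → ℝ) (a b : ℝ) : ℝ :=
  ∫ ω, deriv U (a + b * Z ω) ∂P

/-- `E[Z U'(a + b Z)]`, the derivative of the expected target with respect to the scale. -/
noncomputable def targetScale (P : Measure Ω) (U : ℝ → ℝ) (Z : Ω → ℝ) (a b : ℝ) : ℝ :=
  ∫ ω, Z ω * deriv U (a + b * Z ω) ∂P

variable {U : ℝ → ℝ} {Z : Ω → ℝ}

namespace IsTarget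

lemma continuous_deriv (h : IsTarget P U Z) : Continuous (deriv U) :=
  h.contDiff.continuous_deriv le_rfl

lemma differentiable (h : IsTarget P U Z) : Differentiable ℝ U :=
  h.contDiff.differentiable one_ne_zero

lemma deriv_nonneg (h : IsTarget P U Z) (y : ℝ) : 0 ≤ deriv U y := h.mono.deriv_nonneg

lemma antitone_deriv (h : IsTarget P U Z) : Antitone (deriv U) := by
  have := h.concave.antitoneOn_deriv (fun x _ => h.differentiable x)
  exact fun x y hxy => this (mem_univ x) (mem_univ y) hxy

/-- As `U'` is nonincreasing, locally in `(a, b)` the variable `U'(a + b Z)` is dominated by two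
variables of the same kind. -/
lemma deriv_le (h : IsTarget P U Z) {R a b : ℝ} (ha : |a| ≤ R) (hb : |b| ≤ R) (z : ℝ) :
    deriv U (a + b * z) ≤ deriv U (-R + -R * z) + deriv U (-R + R * z) := by
  have ha := abs_le.1 ha
  have hb := abs_le.1 hb
  rcases le_total 0 z with hz | hz
  · have h1 : deriv U (a + b * z) ≤ deriv U (-R + -R * z) := h.antitone_deriv (by nlinarith)
    linarith [h.deriv_nonneg (-R + R * z)]
  · have h1 : deriv U (a + b * z) ≤ deriv U (-R + R * z) := h.antitone_deriv (by nlinarith)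
    linarith [h.deriv_nonneg (-R + -R * z)]

lemma norm_mul_deriv_le (h : IsTarget P U Z) {R a b : ℝ} (ha : |a| ≤ R) (hb : |b| ≤ R) (z : ℝ) :
    ‖z * deriv U (a + b * z)‖
      ≤ ‖z * deriv U (-R + -R * z)‖ + ‖z * deriv U (-R + R * z)‖ := by
  have h1 := h.deriv_le ha hb z
  simp only [norm_mul, Real.norm_eq_abs, abs_of_nonneg (h.deriv_nonneg _)]
  nlinarith [abs_nonneg z]

lemma norm_deriv_le (h : IsTarget P U Z) {R a b : ℝ} (ha : |a| ≤ R) (hb : |b| ≤ R) (z : ℝ) :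
    ‖deriv U (a + b * z)‖
      ≤ deriv U (-R - R) + (‖z * deriv U (-R + -R * z)‖ + ‖z * deriv U (-R + R * z)‖) := by
  have h1 := h.deriv_le ha hb z
  have hR : 0 ≤ R := (abs_nonneg a).trans ha
  have n1 := h.deriv_nonneg (-R + -R * z)
  have n2 := h.deriv_nonneg (-R + R * z)
  have n3 := h.deriv_nonneg (-R - R)
  simp only [norm_mul, Real.norm_eq_abs, abs_of_nonneg (h.deriv_nonneg _)]
  rcases le_total |z| 1 with hz | hz
  · have h2 : deriv U (a + b * z) ≤ deriv U (-R - R) := by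
      refine h.antitone_deriv ?_
      have h3 : |b * z| ≤ R := by
        rw [abs_mul]
        nlinarith [abs_nonneg b, abs_nonneg z]
      linarith [(abs_le.1 ha).1, (abs_le.1 h3).1]
    nlinarith [abs_nonneg z]
  · nlinarith

lemma integrable_bound (h : IsTarget P U Z) (R : ℝ) : Integrable
    (fun ω => ‖Z ω * deriv U (-R + -R * Z ω)‖ + ‖Z ω * deriv U (-R + R * Z ω)‖) P :=
  (h.integrable_mul_deriv _ _).norm.add (h.integrable_mul_deriv _ _).norm

lemma measurable_deriv (h : IsTarget P U Z) (a b : ℝ) :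
    Measurable fun ω => deriv U (a + b * Z ω) :=
  h.continuous_deriv.measurable.comp ((h.measurable.const_mul b).const_add a)

lemma integrable_bound' [IsProbabilityMeasure P] (h : IsTarget P U Z) (R : ℝ) : Integrable
    (fun ω => deriv U (-R - R)
      + (‖Z ω * deriv U (-R + -R * Z ω)‖ + ‖Z ω * deriv U (-R + R * Z ω)‖)) P :=
  (integrable_const _).add (h.integrable_bound R)

lemma eventually_bound (x : ℝ × ℝ) :
    ∀ᶠ y : ℝ × ℝ in 𝓝 x, |y.1| ≤ |x.1| + |x.2| + 1 ∧ |y.2| ≤ |x.1| + |x.2| + 1 := by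
  have c1 : Continuous fun y : ℝ × ℝ => |y.1| := by fun_prop
  have c2 : Continuous fun y : ℝ × ℝ => |y.2| := by fun_prop
  have n1 := abs_nonneg x.1
  have n2 := abs_nonneg x.2
  filter_upwards [c1.continuousAt.eventually (gt_mem_nhds (show |x.1| < |x.1| + |x.2| + 1 by
    linarith)), c2.continuousAt.eventually (gt_mem_nhds (show |x.2| < |x.1| + |x.2| + 1 by
    linarith))] with y h1 h2
  exact ⟨h1.le, h2.le⟩

lemma continuous_targetScale (h : IsTarget P U Z) :
    Continuous fun y : ℝ × ℝ => targetScale P U Z y.1 y.2 := by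
  rw [continuous_iff_continuousAt]
  intro x
  refine continuousAt_of_dominated (bound := fun ω =>
    ‖Z ω * deriv U (-(|x.1| + |x.2| + 1) + -(|x.1| + |x.2| + 1) * Z ω)‖
      + ‖Z ω * deriv U (-(|x.1| + |x.2| + 1) + (|x.1| + |x.2| + 1) * Z ω)‖) ?_ ?_
    (h.integrable_bound _) ?_
  · exact Eventually.of_forall fun y =>
      (h.measurable.mul (h.measurable_deriv y.1 y.2)).aestronglyMeasurable
  · filter_upwards [eventually_bound x] with y hy
    exact Eventually.of_forall fun ω => h.norm_mul_deriv_le hy.1 hy.2 _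
  · refine Eventually.of_forall fun ω => Continuous.continuousAt ?_
    exact continuous_const.mul (h.continuous_deriv.comp (by fun_prop))

lemma continuous_targetLoc [IsProbabilityMeasure P] (h : IsTarget P U Z) :
    Continuous fun y : ℝ × ℝ => targetLoc P U Z y.1 y.2 := by
  rw [continuous_iff_continuousAt]
  intro x
  refine continuousAt_of_dominated (bound := fun ω =>
    deriv U (-(|x.1| + |x.2| + 1) - (|x.1| + |x.2| + 1))
      + (‖Z ω * deriv U (-(|x.1| + |x.2| + 1) + -(|x.1| + |x.2| + 1) * Z ω)‖
      + ‖Z ω * deriv U (-(|x.1| + |x.2| + 1) + (|x.1| + |x.2| + 1) * Z ω)‖)) ?_ ?_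
    (h.integrable_bound' _) ?_
  · exact Eventually.of_forall fun y => (h.measurable_deriv y.1 y.2).aestronglyMeasurable
  · filter_upwards [eventually_bound x] with y hy
    exact Eventually.of_forall fun ω => h.norm_deriv_le hy.1 hy.2 _
  · refine Eventually.of_forall fun ω => Continuous.continuousAt ?_
    exact h.continuous_deriv.comp (by fun_prop)

lemma hasDerivAt_loc [IsProbabilityMeasure P] (h : IsTarget P U Z) (a b : ℝ) :
    HasDerivAt (fun a => targetMean P U Z a b) (targetLoc P U Z a b) a := by
  have hs : ∀ᶠ y in 𝓝 a, |y| ≤ |a| + |b| + 1 := by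
    have := abs_nonneg b
    exact (continuous_abs.continuousAt.eventually (gt_mem_nhds (show |a| < |a| + |b| + 1 by
      linarith))).mono fun y hy => le_of_lt hy
  refine (hasDerivAt_integral_of_dominated_loc_of_deriv_le (F := fun a ω => U (a + b * Z ω))
    (F' := fun a ω => deriv U (a + b * Z ω)) hs
    (Eventually.of_forall fun y => (h.integrable y b).aestronglyMeasurable) (h.integrable a b)
    (h.measurable_deriv a b).aestronglyMeasurable
    (Eventually.of_forall fun ω y hy => h.norm_deriv_le hy (R := |a| + |b| + 1) ?_ _)
    (h.integrable_bound' _) (Eventually.of_forall fun ω y _ => ?_)).2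
  · linarith [abs_nonneg a]
  · exact (h.differentiable _).hasDerivAt.comp_add_const y _

lemma hasDerivAt_scale (h : IsTarget P U Z) (a b : ℝ) :
    HasDerivAt (fun b => targetMean P U Z a b) (targetScale P U Z a b) b := by
  have hs : ∀ᶠ y in 𝓝 b, |y| ≤ |a| + |b| + 1 := by
    have := abs_nonneg a
    exact (continuous_abs.continuousAt.eventually (gt_mem_nhds (show |b| < |a| + |b| + 1 by
      linarith))).mono fun y hy => le_of_lt hy
  refine (hasDerivAt_integral_of_dominated_loc_of_deriv_le (F := fun b ω => U (a + b * Z ω))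
    (F' := fun b ω => Z ω * deriv U (a + b * Z ω)) hs
    (Eventually.of_forall fun y => (h.integrable a y).aestronglyMeasurable) (h.integrable a b)
    (h.measurable.mul (h.measurable_deriv a b)).aestronglyMeasurable
    (Eventually.of_forall fun ω y hy => h.norm_mul_deriv_le (R := |a| + |b| + 1) ?_ hy _)
    (h.integrable_bound _) (Eventually.of_forall fun ω y _ => ?_)).2
  · linarith [abs_nonneg b]
  · have h1 : HasDerivAt (fun y => a + y * Z ω) (1 * Z ω) y :=
      ((hasDerivAt_id y).mul_const _).const_add a
    refine ((h.differentiable _).hasDerivAt.comp y h1).congr_deriv ?_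
    ring

/-- The expected target is continuously differentiable in location and scale. -/
theorem hasStrictFDerivAt [IsProbabilityMeasure P] (h : IsTarget P U Z) (y : ℝ × ℝ) :
    HasStrictFDerivAt (fun y : ℝ × ℝ => targetMean P U Z y.1 y.2)
      (((1 : ℝ →L[ℝ] ℝ).smulRight (targetLoc P U Z y.1 y.2)).coprod
        ((1 : ℝ →L[ℝ] ℝ).smulRight (targetScale P U Z y.1 y.2))) y := by
  refine hasStrictFDerivAt_uncurry_coprod (u := y) (f := targetMean P U Z)
    (f₁ := fun a b => (1 : ℝ →L[ℝ] ℝ).smulRight (targetLoc P U Z a b))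
    (f₂ := fun a b => (1 : ℝ →L[ℝ] ℝ).smulRight (targetScale P U Z a b))
    (Eventually.of_forall fun v => (h.hasDerivAt_loc v.1 v.2).hasFDerivAt)
    (Eventually.of_forall fun v => (h.hasDerivAt_scale v.1 v.2).hasFDerivAt) ?_ ?_
  · exact ((ContinuousLinearMap.smulRightL ℝ ℝ ℝ 1).continuous.comp
      h.continuous_targetLoc).continuousAt
  · exact ((ContinuousLinearMap.smulRightL ℝ ℝ ℝ 1).continuous.comp
      h.continuous_targetScale).continuousAt

/-- The chain rule for the expected target along a curve of locations and scales. -/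
lemma hasDerivWithinAt_comp [IsProbabilityMeasure P] (h : IsTarget P U Z)
    {A b : ℝ → ℝ} {A' b' s : ℝ} {S : Set ℝ}
    (hA : HasDerivWithinAt A A' S s) (hb : HasDerivWithinAt b b' S s) :
    HasDerivWithinAt (fun s => targetMean P U Z (A s) (b s))
      (targetLoc P U Z (A s) (b s) * A' + targetScale P U Z (A s) (b s) * b') S s := by
  have h1 := (h.hasStrictFDerivAt (A s, b s)).hasFDerivAt.comp_hasDerivWithinAt
    (f := fun s => (A s, b s)) s (hA.prodMk hb)
  refine h1.congr_deriv ?_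
  simp [mul_comm]

lemma targetLoc_nonneg (h : IsTarget P U Z) (a b : ℝ) : 0 ≤ targetLoc P U Z a b :=
  integral_nonneg fun _ => h.deriv_nonneg _

lemma targetScale_zero (hZ : ∫ ω, Z ω ∂P = 0) (a : ℝ) : targetScale P U Z a 0 = 0 := by
  simp only [targetScale, zero_mul, add_zero]
  rw [integral_mul_const, hZ, zero_mul]

/-- A risk-averse investor dislikes centred noise. -/
lemma targetScale_nonpos (h : IsTarget P U Z) (hZ : ∫ ω, Z ω ∂P = 0) (a : ℝ) {b : ℝ}
    (hb : 0 ≤ b) : targetScale P U Z a b ≤ 0 := by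
  rw [← targetScale_zero (U := U) hZ a]
  refine integral_mono (h.integrable_mul_deriv a b) (h.integrable_mul_deriv a 0) fun ω => ?_
  simp only [zero_mul, add_zero]
  rcases le_total 0 (Z ω) with hz | hz
  · exact mul_le_mul_of_nonneg_left (h.antitone_deriv (by nlinarith)) hz
  · exact mul_le_mul_of_nonpos_left (h.antitone_deriv (by nlinarith)) hz

end IsTarget

/-- A strictly stable process of index greater than `1` is centred. -/
lemma IsStableLevy.integral_coord_eq_zero {d : ℕ} {α : ℝ} {L : ℝ → Ω → Fin d → ℝ}
    (hL : IsStableLevy P α L) (j : Fin d) : ∫ ω, L 1 ω j ∂P = 0 := by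
  by_cases hi : Integrable (fun ω => L 1 ω j) P
  swap
  · exact integral_undef hi
  have h1 := (hL.identDistrib_smul (t := 2) (by norm_num)).comp (measurable_pi_apply j)
  have h2 := (hL.stationary 1 2 (by norm_num) (by norm_num)).comp (measurable_pi_apply j)
  rw [show (2 : ℝ) - 1 = 1 by norm_num] at h2
  have e1 := h1.integral_eq
  have e2 := h2.integral_eq
  have hi2 : Integrable (fun ω => L 2 ω j - L 1 ω j) P := h2.integrable_iff.2 hi
  simp only [Function.comp_apply, Pi.smul_apply, smul_eq_mul, integral_const_mul] at e1
  simp only [Function.comp_apply, Pi.sub_apply] at e2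
  have e3 : ∫ ω, L 2 ω j ∂P = ∫ ω, L 1 ω j ∂P + ∫ ω, L 1 ω j ∂P := by
    have e := integral_add hi2 hi
    simp only [sub_add_cancel] at e
    rw [e, e2]
  have hα := hL.one_lt
  have hlt : (2 : ℝ) ^ (1 / α) < 2 := by
    conv_rhs => rw [← Real.rpow_one 2]
    exact Real.rpow_lt_rpow_of_exponent_lt one_lt_two ((div_lt_one (by linarith)).2 hα)
  have e4 : (2 - (2 : ℝ) ^ (1 / α)) * ∫ ω, L 1 ω j ∂P = 0 := by linarith
  rcases mul_eq_zero.1 e4 with h | h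
  · linarith
  · exact h

/-- The risk of `a + b Z` is an affine function of location and scale; `χ` distinguishes
cash-invariant (`χ = 1`) from shift-invariant (`χ = 0`) risk measures. -/
lemma IsRiskMeasure.exists_affine {ρ : (Ω → ℝ) → EReal} (hρ : IsRiskMeasure P ρ)
    (hZ : AEMeasurable Z P) (hfin : ρ Z < ⊤) :
    ∃ χ : ℝ, (χ = 0 ∨ χ = 1) ∧ ∀ a b : ℝ, 0 ≤ b →
      ρ (fun ω => a + b * Z ω) = (((ρ Z).toReal * b - χ * a : ℝ) : EReal) := by
  have hr : ρ Z = ((ρ Z).toReal : EReal) :=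
    (EReal.coe_toReal hfin.ne (hρ.ne_bot Z hZ)).symm
  rcases hρ.cash_or_shift with h | h
  · refine ⟨1, Or.inr rfl, fun a b hb => ?_⟩
    have h1 := h (fun ω => b * Z ω) (hZ.const_mul b) a
    simp only [add_comm _ a] at h1
    rw [h1, hρ.pos_homogeneous Z hZ b hb, hr]
    norm_cast
    simp [mul_comm]
  · refine ⟨0, Or.inl rfl, fun a b hb => ?_⟩
    have h1 := h (fun ω => b * Z ω) (hZ.const_mul b) a
    simp only [add_comm _ a] at h1
    rw [h1, hρ.pos_homogeneous Z hZ b hb, hr]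
    norm_cast
    simp [mul_comm]

end Target

/-! ### The value of a strategy and of its deviations -/

section Coefficients

variable {d : ℕ}

/-- The retraction of `ℝ` onto `[0, T]`, used to extend the coefficients beyond `[0, T]`. -/
noncomputable def clamp (m : Market d) (s : ℝ) : ℝ := max 0 (min s m.T)

lemma clamp_mem (m : Market d) (s : ℝ) : clamp m s ∈ Icc 0 m.T :=
  ⟨le_max_left _ _, max_le m.T_pos.le (min_le_right _ _)⟩

lemma clamp_of_mem {m : Market d} {s : ℝ} (hs : s ∈ Icc 0 m.T) : clamp m s = s := by
  rw [clamp, min_eq_left hs.2, max_eq_right hs.1]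

lemma continuous_clamp (m : Market d) : Continuous (clamp m) := by
  unfold clamp
  fun_prop

/-- The density of the drift of the terminal gain under the strategy `u`. -/
noncomputable def driftDensity (m : Market d) (u : ℝ → Fin d → ℝ) (s : ℝ) : ℝ :=
  compound m (clamp m s) * excess m u (clamp m s)

/-- The density of the scale (to the power `α`) of the terminal gain under the strategy `u`. -/
noncomputable def scaleDensity (m : Market d) (α : ℝ) (ψ : (Fin d → ℝ) → ℝ)
    (u : ℝ → Fin d → ℝ) (s : ℝ) : ℝ :=
  compound m (clamp m s) ^ α * ψ (exposure m u (clamp m s))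

/-- The drift of the terminal gain from time `t` on. -/
noncomputable def driftFrom (m : Market d) (u : ℝ → Fin d → ℝ) (t : ℝ) : ℝ :=
  ∫ s in t..m.T, driftDensity m u s

/-- The scale, to the power `α`, of the terminal gain from time `t` on. -/
noncomputable def scaleFrom (m : Market d) (α : ℝ) (ψ : (Fin d → ℝ) → ℝ)
    (u : ℝ → Fin d → ℝ) (t : ℝ) : ℝ :=
  ∫ s in t..m.T, scaleDensity m α ψ u s

variable {m : Market d} {α : ℝ} {ψ : (Fin d → ℝ) → ℝ} {u : ℝ → Fin d → ℝ}

lemma continuousOn_excess (hu : ContinuousOn u (Icc 0 m.T)) :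
    ContinuousOn (excess m u) (Icc 0 m.T) := by
  unfold excess
  refine continuousOn_finsetSum _ fun i _ => ?_
  exact ((continuous_apply i).comp_continuousOn hu).mul
    (((continuous_apply i).comp_continuousOn m.continuousOn_μ).sub continuousOn_const)

lemma continuousOn_exposure (hu : ContinuousOn u (Icc 0 m.T)) :
    ContinuousOn (exposure m u) (Icc 0 m.T) := by
  have hσ := m.continuousOn_σ
  unfold exposure Matrix.vecMul dotProduct
  refine continuousOn_pi.2 fun j => continuousOn_finsetSum _ fun i _ => ?_
  refine ((continuous_apply i).comp_continuousOn hu).mul ?_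
  exact ((continuous_apply j).comp (continuous_apply i)).comp_continuousOn hσ

lemma continuous_driftDensity (hu : ContinuousOn u (Icc 0 m.T)) :
    Continuous (driftDensity m u) :=
  ((continuous_compound m).comp (continuous_clamp m)).mul
    ((continuousOn_excess hu).comp_continuous (continuous_clamp m) (clamp_mem m))

lemma continuous_scaleDensity (hα : 0 < α) (hψ : Continuous ψ)
    (hu : ContinuousOn u (Icc 0 m.T)) : Continuous (scaleDensity m α ψ u) :=
  (((continuous_compound m).comp (continuous_clamp m)).rpow_const fun _ => Or.inr hα.le).mul
    (hψ.comp ((continuousOn_exposure hu).comp_continuous (continuous_clamp m) (clamp_mem m)))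

lemma scaleDensity_nonneg (hψ : ∀ H, 0 ≤ ψ H) (s : ℝ) : 0 ≤ scaleDensity m α ψ u s :=
  mul_nonneg (Real.rpow_nonneg (compound_pos m _).le _) (hψ _)

lemma hasDerivAt_integral_left {g : ℝ → ℝ} (hg : Continuous g) (T t : ℝ) :
    HasDerivAt (fun t => ∫ s in t..T, g s) (-g t) t :=
  intervalIntegral.integral_hasDerivAt_left (hg.intervalIntegrable _ _)
    hg.aestronglyMeasurable.stronglyMeasurableAtFilter hg.continuousAt

lemma hasDerivAt_integral_right {g : ℝ → ℝ} (hg : Continuous g) (a t : ℝ) :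
    HasDerivAt (fun t => ∫ s in a..t, g s) (g t) t :=
  intervalIntegral.integral_hasDerivAt_right (hg.intervalIntegrable _ _)
    hg.aestronglyMeasurable.stronglyMeasurableAtFilter hg.continuousAt

lemma isRiemannOn_switch {g₁ g₂ : ℝ → ℝ} {t T τ : ℝ} (h1 : ContinuousOn g₁ (Icc t T))
    (h2 : ContinuousOn g₂ (Icc t T)) :
    IsRiemannOn (fun s => if s ≤ τ then g₁ s else g₂ s) t T := by
  obtain ⟨C, hC⟩ := isCompact_Icc.exists_bound_of_continuousOn h1
  obtain ⟨D, hD⟩ := isCompact_Icc.exists_bound_of_continuousOn h2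
  refine ⟨⟨max C D, fun s hs => ?_⟩, ?_⟩
  · dsimp only
    split_ifs
    · exact (hC s hs).trans (le_max_left _ _)
    · exact (hD s hs).trans (le_max_right _ _)
  · filter_upwards [ae_ne_right τ] with s hsτ hs
    rcases lt_or_gt_of_ne hsτ with h | h
    · refine (h1 s hs).congr_of_eventuallyEq ?_ (if_pos h.le)
      filter_upwards [mem_nhdsWithin_of_mem_nhds (Iio_mem_nhds h)] with y hy
      exact if_pos (le_of_lt hy)
    · refine (h2 s hs).congr_of_eventuallyEq ?_ (if_neg (not_le.2 h))
      filter_upwards [mem_nhdsWithin_of_mem_nhds (Ioi_mem_nhds h)] with y hy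
      exact if_neg (not_le.2 hy)

end Coefficients

/-- The data of the equilibrium problem in the form used below: the law of the noise enters through
the scale `ψ` and the variable `Z` only, and `χ` tells cash-invariance (`1`) from shift-invariance
(`0`). The conditions on the set `K` of positions hold for `[-M, M]^d` with symmetric noise and for
`[0, M]` with `d = 1`. -/
structure IsProblem {Ω : Type*} [MeasurableSpace Ω] (P : Measure Ω) {d : ℕ} (α : ℝ)
    (L : ℝ → Ω → Fin d → ℝ) (m : Market d) (pr : Preferences Ω) (K : Set (Fin d → ℝ))
    (C : Set (Fin d → ℝ)) (Z : Ω → ℝ) (ψ : (Fin d → ℝ) → ℝ) (χ : ℝ) (v : ℝ → Fin d → ℝ) :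
    Prop where
  levy : IsLevy P L
  one_lt : 1 < α
  scale : IsScale P α L C Z ψ
  target : IsTarget P pr.U Z
  mean : ∫ ω, Z ω ∂P = 0
  contDiff_F : ContDiff ℝ 1 pr.F
  mono_F : Monotone pr.F
  convex_F : ConvexOn ℝ univ pr.F
  lam_pos : ∀ t ∈ Icc 0 m.T, 0 < pr.lam t
  contDiffOn_lam : ContDiffOn ℝ 1 pr.lam (Icc 0 m.T)
  chi : χ = 0 ∨ χ = 1
  risk : ∀ (Y : Ω → ℝ) (a b : ℝ), 0 ≤ b → IdentDistrib Y (fun ω => a + b * Z ω) P P →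
    pr.ρ Y = (((pr.ρ Z).toReal * b - χ * a : ℝ) : EReal)
  zero_mem : (0 : Fin d → ℝ) ∈ K
  /-- The positions in `K` can be reached by a continuous retraction. -/
  retract : ∃ R : (Fin d → ℝ) → Fin d → ℝ, Continuous R ∧ (∀ y, R y ∈ K) ∧ ∀ y ∈ K, R y = y
  cone : ∀ t ∈ Icc 0 m.T, ∀ y ∈ K, Matrix.vecMul y (m.σ t) ∈ C
  /-- A position in the interior of `K` can be kept at constant exposure for a while. -/
  interior : ∀ t ∈ Icc 0 m.T, ∀ y ∈ K, ∀ ε ∈ Ioo (0 : ℝ) 1, ∀ᶠ s in 𝓝[Icc 0 m.T] t,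
    Matrix.vecMul (Matrix.vecMul ((1 - ε) • y) (m.σ t)) (m.σ s)⁻¹ ∈ K
  nondegenerate : ∀ t ∈ Icc 0 m.T, ∃ y ∈ K, 0 < ψ (Matrix.vecMul y (m.σ t))
  symm_or_pos : ((∀ y ∈ K, -y ∈ K) ∧ ∀ H, ψ (-H) = ψ H) ∨
    ((∀ t ∈ Icc 0 m.T, ∀ y ∈ K, ψ (Matrix.vecMul y (m.σ t)) = 0 → y = 0) ∧
      ∀ᶠ y in 𝓝[K] 0, (2 : ℝ) • y ∈ K)
  equilibrium : IsEquilibrium P L m pr K v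
  continuousOn : ContinuousOn v (Icc 0 m.T)
  exists_wealth : ∀ t ∈ Ico 0 m.T, ∃ X, IsWealth P L m v t 0 X

section Problem

variable {Ω : Type*} [MeasurableSpace Ω] {P : Measure Ω} {d : ℕ} {α : ℝ}
  {L : ℝ → Ω → Fin d → ℝ} {m : Market d} {pr : Preferences Ω} {K : Set (Fin d → ℝ)}
  {C : Set (Fin d → ℝ)} {Z : Ω → ℝ} {ψ : (Fin d → ℝ) → ℝ} {χ : ℝ} {v : ℝ → Fin d → ℝ}

/-- The risk of `a + b Z`. -/
noncomputable def riskOf (pr : Preferences Ω) (Z : Ω → ℝ) (χ a b : ℝ) : ℝ :=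
  (pr.ρ Z).toReal * b - χ * a

/-- The value at time `t` of a gain with location `a` and scale `b`. -/
noncomputable def valueOf (P : Measure Ω) (pr : Preferences Ω) (Z : Ω → ℝ) (χ t a b : ℝ) : ℝ :=
  targetMean P pr.U Z a b - pr.lam t * pr.F (riskOf pr Z χ a b)

namespace IsProblem

lemma alpha_pos (h : IsProblem P α L m pr K C Z ψ χ v) : 0 < α := by linarith [h.one_lt]

lemma hasDerivAt_F (h : IsProblem P α L m pr K C Z ψ χ v) (y : ℝ) :
    HasDerivAt pr.F (deriv pr.F y) y :=
  (h.contDiff_F.differentiable one_ne_zero y).hasDerivAt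

lemma continuous_deriv_F (h : IsProblem P α L m pr K C Z ψ χ v) : Continuous (deriv pr.F) :=
  h.contDiff_F.continuous_deriv le_rfl

lemma deriv_F_nonneg (h : IsProblem P α L m pr K C Z ψ χ v) (y : ℝ) : 0 ≤ deriv pr.F y :=
  h.mono_F.deriv_nonneg

lemma deriv_F_mono (h : IsProblem P α L m pr K C Z ψ χ v) : Monotone (deriv pr.F) := by
  have := h.convex_F.monotoneOn_deriv (fun x _ => h.contDiff_F.differentiable one_ne_zero x)
  exact fun x y hxy => this (mem_univ x) (mem_univ y) hxy

lemma hasDerivWithinAt_riskOf {Ω' : Type*} {pr : Preferences Ω'} {Z : Ω' → ℝ}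
    {A b : ℝ → ℝ} {A' b' s : ℝ} {S : Set ℝ}
    (hA : HasDerivWithinAt A A' S s) (hb : HasDerivWithinAt b b' S s) :
    HasDerivWithinAt (fun s => riskOf pr Z χ (A s) (b s))
      ((pr.ρ Z).toReal * b' - χ * A') S s :=
  (hb.const_mul _).sub (hA.const_mul _)

lemma hasDerivWithinAt_valueOf [IsProbabilityMeasure P]
    (h : IsProblem P α L m pr K C Z ψ χ v) (t : ℝ) {A b : ℝ → ℝ}
    {A' b' s : ℝ} {S : Set ℝ}
    (hA : HasDerivWithinAt A A' S s) (hb : HasDerivWithinAt b b' S s) :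
    HasDerivWithinAt (fun s => valueOf P pr Z χ t (A s) (b s))
      ((targetLoc P pr.U Z (A s) (b s)
          + χ * pr.lam t * deriv pr.F (riskOf pr Z χ (A s) (b s))) * A'
        - (pr.lam t * deriv pr.F (riskOf pr Z χ (A s) (b s)) * (pr.ρ Z).toReal
          - targetScale P pr.U Z (A s) (b s)) * b') S s := by
  have h1 := h.target.hasDerivWithinAt_comp hA hb
  have h2 := (((h.hasDerivAt_F (riskOf pr Z χ (A s) (b s))).comp_hasDerivWithinAt s
    (hasDerivWithinAt_riskOf (pr := pr) (Z := Z) (χ := χ) hA hb)).const_mul (pr.lam t))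
  refine (h1.sub h2).congr_deriv ?_
  ring

/-- The law of the gain determines the expected target and the risk. -/
lemma gain_formulas [IsProbabilityMeasure P] (h : IsProblem P α L m pr K C Z ψ χ v)
    {u : ℝ → Fin d → ℝ} {t x : ℝ} {X : ℝ → Ω → ℝ} (hX : IsWealth P L m u t x X)
    (ht : t ∈ Ico 0 m.T) (huC : ∀ s ∈ Icc t m.T, exposure m u s ∈ C)
    (hu : IsRiemannOn (fun s => ψ (exposure m u s)) t m.T)
    (hu' : IsRiemannOn (excess m u) t m.T) :
    pr.ρ (gain m t x (X m.T)) = ((riskOf pr Z χ (∫ s in t..m.T, compound m s * excess m u s)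
      ((∫ s in t..m.T, compound m s ^ α * ψ (exposure m u s)) ^ (1 / α)) : ℝ) : EReal) ∧
    Integrable (fun ω => pr.U (gain m t x (X m.T) ω)) P ∧
    expectedTarget P m pr t x (X m.T) = targetMean P pr.U Z
      (∫ s in t..m.T, compound m s * excess m u s)
      ((∫ s in t..m.T, compound m s ^ α * ψ (exposure m u s)) ^ (1 / α)) := by
  have hid := h.scale.identDistrib_gain h.levy h.alpha_pos hX ht.1 ht.2 huC hu hu'
  have hB : 0 ≤ ∫ s in t..m.T, compound m s ^ α * ψ (exposure m u s) :=
    intervalIntegral.integral_nonneg ht.2.le fun s _ =>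
      mul_nonneg (Real.rpow_nonneg (compound_pos m _).le _) (h.scale.nonneg _)
  have hU := hid.comp h.target.contDiff.continuous.measurable
  refine ⟨h.risk _ _ _ (Real.rpow_nonneg hB _) hid, ?_, ?_⟩
  · exact hU.integrable_iff.2 (h.target.integrable _ _)
  · exact hU.integral_eq

lemma value_eq [IsProbabilityMeasure P] (h : IsProblem P α L m pr K C Z ψ χ v)
    {u : ℝ → Fin d → ℝ} {t x : ℝ} {X : ℝ → Ω → ℝ} (hX : IsWealth P L m u t x X)
    (ht : t ∈ Ico 0 m.T) (huC : ∀ s ∈ Icc t m.T, exposure m u s ∈ C)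
    (hu : IsRiemannOn (fun s => ψ (exposure m u s)) t m.T)
    (hu' : IsRiemannOn (excess m u) t m.T) :
    value P m pr t x (X m.T) = valueOf P pr Z χ t (∫ s in t..m.T, compound m s * excess m u s)
      ((∫ s in t..m.T, compound m s ^ α * ψ (exposure m u s)) ^ (1 / α)) := by
  obtain ⟨h1, -, h3⟩ := h.gain_formulas hX ht huC hu hu'
  rw [value, h3, riskPenalty, h1, EReal.toReal_coe, valueOf]

lemma control_mem (h : IsProblem P α L m pr K C Z ψ χ v) {s : ℝ} (hs : s ∈ Icc 0 m.T) :
    v s ∈ K := h.equilibrium.1.2 s hs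

lemma integral_drift_eq {t : ℝ} (ht : t ∈ Icc 0 m.T) :
    ∫ s in t..m.T, compound m s * excess m v s = driftFrom m v t := by
  refine intervalIntegral.integral_congr fun s hs => ?_
  rw [uIcc_of_le ht.2] at hs
  simp only [driftDensity, clamp_of_mem (⟨ht.1.trans hs.1, hs.2⟩ : s ∈ Icc 0 m.T)]

lemma integral_scale_eq {t : ℝ} (ht : t ∈ Icc 0 m.T) :
    ∫ s in t..m.T, compound m s ^ α * ψ (exposure m v s) = scaleFrom m α ψ v t := by
  refine intervalIntegral.integral_congr fun s hs => ?_
  rw [uIcc_of_le ht.2] at hs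
  simp only [scaleDensity, clamp_of_mem (⟨ht.1.trans hs.1, hs.2⟩ : s ∈ Icc 0 m.T)]

lemma isRiemannOn_of_continuousOn {g : ℝ → ℝ} {t : ℝ} (ht : 0 ≤ t)
    (hg : ContinuousOn g (Icc 0 m.T)) : IsRiemannOn g t m.T := by
  have h1 := hg.mono (Icc_subset_Icc_left ht : Icc t m.T ⊆ Icc 0 m.T)
  simpa using isRiemannOn_switch (τ := t) h1 h1

end IsProblem

lemma isCagladOn_of_continuousOn {E : Type*} [TopologicalSpace E] {f : ℝ → E} {a b : ℝ}
    (hf : ContinuousOn f (Icc a b)) : IsCagladOn f a b := by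
  refine ⟨fun s hs => ?_, fun s hs => ⟨f s, ?_⟩⟩
  · refine (hf s ⟨hs.1.le, hs.2⟩).mono_of_mem_nhdsWithin ?_
    exact mem_of_superset (Icc_mem_nhdsLE hs.1) (Icc_subset_Icc_right hs.2)
  · refine ((hf s ⟨hs.1, hs.2.le⟩).mono_of_mem_nhdsWithin ?_).tendsto
    exact mem_of_superset (Ioo_mem_nhdsGT hs.2) fun x hx => ⟨hs.1.trans hx.1.le, hx.2.le⟩

namespace IsProblem

/-- The equilibrium condition for deviations of constant exposure, in terms of location and
scale. -/
theorem liminf_deviation [IsProbabilityMeasure P] (h : IsProblem P α L m pr K C Z ψ χ v)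
    {t : ℝ} (ht : t ∈ Ico 0 m.T) {u : ℝ → Fin d → ℝ} (hu : ContinuousOn u (Icc 0 m.T))
    (huK : ∀ s ∈ Icc 0 m.T, u s ∈ K) {δ : ℝ} (hδ : 0 < δ) {c : Fin d → ℝ}
    (hc : ∀ s ∈ Icc t m.T, s ≤ t + δ → exposure m u s = c) :
    0 ≤ liminf (fun k : ℝ => (((valueOf P pr Z χ t (driftFrom m v t)
        (scaleFrom m α ψ v t ^ (1 / α))
      - valueOf P pr Z χ t ((∫ s in t..(t + k), driftDensity m u s) + driftFrom m v (t + k))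
        (((∫ s in t..(t + k), scaleDensity m α ψ u s) + scaleFrom m α ψ v (t + k)) ^ (1 / α)))
          / k : ℝ) : EReal)) (𝓝[>] 0) := by
  have ht' : t ∈ Icc 0 m.T := ⟨ht.1, ht.2.le⟩
  have hα := h.alpha_pos
  have hsub : Icc t m.T ⊆ Icc 0 m.T := Icc_subset_Icc_left ht.1
  obtain ⟨X, hX⟩ := h.exists_wealth t ht
  have hv := h.continuousOn
  have hve := continuousOn_excess hv
  have hvx := continuousOn_exposure hv
  have hue := continuousOn_excess hu
  have hux := continuousOn_exposure hu
  have hψ := h.scale.continuous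
  have hexc : ∀ τ, excess m (switchAt τ u v)
      = fun s => if s ≤ τ then excess m u s else excess m v s := fun τ => by
    funext s
    simp only [excess, switchAt]
    split_ifs <;> rfl
  have hexp : ∀ τ s, exposure m (switchAt τ u v) s
      = if s ≤ τ then exposure m u s else exposure m v s := fun τ s => by
    simp only [exposure, switchAt]
    split_ifs <;> rfl
  have hψexp : ∀ τ, (fun s => ψ (exposure m (switchAt τ u v) s))
      = fun s => if s ≤ τ then ψ (exposure m u s) else ψ (exposure m v s) := fun τ => by
    funext s
    rw [hexp]
    split_ifs <;> rfl
  have hwR : ∀ τ, IsRiemannOn (excess m (switchAt τ u v)) t m.T := fun τ => by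
    rw [hexc]
    exact isRiemannOn_switch (hue.mono hsub) (hve.mono hsub)
  have hwR' : ∀ τ, IsRiemannOn (fun s => ψ (exposure m (switchAt τ u v) s)) t m.T := fun τ => by
    rw [hψexp]
    exact isRiemannOn_switch (hψ.comp_continuousOn (hux.mono hsub))
      (hψ.comp_continuousOn (hvx.mono hsub))
  obtain ⟨D, hD⟩ := isCompact_Icc.exists_bound_of_continuousOn hvx
  have hDi : ∀ s ∈ Icc t m.T, ∀ i, |exposure m v s i| ≤ D := fun s hs i =>
    (norm_le_pi_norm (exposure m v s) i).trans (hD s (hsub hs))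
  have hex : ∀ k : ℝ, ∃ Y, 0 < k → k < min δ (m.T - t) →
      IsWealth P L m (switchAt (t + k) u v) t 0 Y := by
    intro k
    by_cases hk : 0 < k ∧ k < min δ (m.T - t)
    · obtain ⟨hk0, hk1⟩ := hk
      have hk2 := hk1.trans_le (min_le_left _ _)
      have hk3 := hk1.trans_le (min_le_right _ _)
      obtain ⟨Y, hY⟩ := exists_isWealth_switch h.levy hX ht.1 (by linarith : t ≤ t + k)
        (by linarith) (u := u) (c := c)
        (fun s hs => hc s ⟨hs.1, by linarith [hs.2]⟩ (by linarith [hs.2]))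
        hDi (isRiemannOn_of_continuousOn ht.1 hve) (hwR _)
      exact ⟨Y, fun _ _ => hY⟩
    · exact ⟨X, fun h1 h2 => absurd ⟨h1, h2⟩ hk⟩
  choose Y hY using hex
  have hδ' : 0 < min δ (m.T - t) := lt_min hδ (sub_pos.2 ht.2)
  have hsmall : ∀ᶠ k in 𝓝[>] (0 : ℝ), 0 < k ∧ k < min δ (m.T - t) := Ioo_mem_nhdsGT hδ'
  have heq := h.equilibrium.2 t ht 0 u ⟨isCagladOn_of_continuousOn hu, huK⟩ X Y hX
    (hsmall.mono fun k hk => hY k hk.1 hk.2)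
  refine heq.trans_eq (liminf_congr ?_)
  filter_upwards [hsmall] with k hk
  have hk3 := hk.2.trans_le (min_le_right _ _)
  have hτ : t + k ∈ Icc 0 m.T := ⟨by linarith [ht.1, hk.1], by linarith⟩
  have e1 := h.value_eq hX ht (fun s hs => h.cone s (hsub hs) _ (h.control_mem (hsub hs)))
    (isRiemannOn_of_continuousOn ht.1 (hψ.comp_continuousOn hvx))
    (isRiemannOn_of_continuousOn ht.1 hve)
  have e2 := h.value_eq (hY k hk.1 hk.2) ht (fun s hs => by
    rw [hexp]
    split_ifs
    · exact h.cone s (hsub hs) _ (huK s (hsub hs))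
    · exact h.cone s (hsub hs) _ (h.control_mem (hsub hs))) (hwR' _) (hwR _)
  rw [integral_drift_eq ht', integral_scale_eq ht'] at e1
  -- split the integrals of the switched strategy at the switching time
  have hsplit : ∀ g₁ g₂ g : ℝ → ℝ, Continuous g₁ → Continuous g₂ →
      (∀ s ∈ Icc t m.T, s ≤ t + k → g s = g₁ s) → (∀ s ∈ Icc t m.T, t + k < s → g s = g₂ s) →
      ∫ s in t..m.T, g s = (∫ s in t..(t + k), g₁ s) + ∫ s in (t + k)..m.T, g₂ s := by
    intro g₁ g₂ g hg₁ hg₂ hga hgb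
    have i1 : ∫ s in t..(t + k), g s = ∫ s in t..(t + k), g₁ s := by
      refine intervalIntegral.integral_congr fun s hs => ?_
      rw [uIcc_of_le (by linarith [hk.1])] at hs
      exact hga s ⟨hs.1, by linarith [hs.2]⟩ hs.2
    have i2 : ∫ s in (t + k)..m.T, g s = ∫ s in (t + k)..m.T, g₂ s := by
      refine intervalIntegral.integral_congr_ae (Eventually.of_forall fun s hs => ?_)
      rw [uIoc_of_le hτ.2] at hs
      exact hgb s ⟨by linarith [hs.1, hk.1], hs.2⟩ hs.1
    rw [← i1, ← i2, intervalIntegral.integral_add_adjacent_intervals]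
    · refine (hg₁.intervalIntegrable t (t + k)).congr fun s hs => ?_
      rw [uIoc_of_le (by linarith [hk.1])] at hs
      exact (hga s ⟨hs.1.le, by linarith [hs.2]⟩ hs.2).symm
    · refine (hg₂.intervalIntegrable (t + k) m.T).congr fun s hs => ?_
      rw [uIoc_of_le hτ.2] at hs
      exact (hgb s ⟨by linarith [hs.1, hk.1], hs.2⟩ hs.1).symm
  have d1 := hsplit (driftDensity m u) (driftDensity m v)
    (fun s => compound m s * excess m (switchAt (t + k) u v) s)
    (continuous_driftDensity hu) (continuous_driftDensity hv)
    (fun s hs hs' => by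
      simp only [hexc, if_pos hs', driftDensity, clamp_of_mem (hsub hs)])
    (fun s hs hs' => by
      simp only [hexc, if_neg (not_le.2 hs'), driftDensity, clamp_of_mem (hsub hs)])
  have d2 := hsplit (scaleDensity m α ψ u) (scaleDensity m α ψ v)
    (fun s => compound m s ^ α * ψ (exposure m (switchAt (t + k) u v) s))
    (continuous_scaleDensity hα hψ hu) (continuous_scaleDensity hα hψ hv)
    (fun s hs hs' => by
      simp only [hexp, if_pos hs', scaleDensity, clamp_of_mem (hsub hs)])
    (fun s hs hs' => by
      simp only [hexp, if_neg (not_le.2 hs'), scaleDensity, clamp_of_mem (hsub hs)])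
  rw [d1, d2] at e2
  rw [e1, e2]
  rfl

end IsProblem

end Problem

/-! ### First-order conditions for the equilibrium -/

section Problem

variable {Ω : Type*} [MeasurableSpace Ω] {P : Measure Ω} {d : ℕ} {α : ℝ}
  {L : ℝ → Ω → Fin d → ℝ} {m : Market d} {pr : Preferences Ω} {K : Set (Fin d → ℝ)}
  {C : Set (Fin d → ℝ)} {Z : Ω → ℝ} {ψ : (Fin d → ℝ) → ℝ} {χ : ℝ} {v : ℝ → Fin d → ℝ}

lemma Market.isUnit_det (m : Market d) {s : ℝ} (hs : s ∈ Icc 0 m.T) : IsUnit (m.σ s).det :=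
  (Matrix.isUnit_iff_isUnit_det _).1 (m.σ_posDef s hs).isUnit

lemma Market.continuousOn_inv (m : Market d) : ContinuousOn (fun s => (m.σ s)⁻¹) (Icc 0 m.T) := by
  simp only [Matrix.inv_def, Ring.inverse_eq_inv']
  have hdet : ContinuousOn (fun s => (m.σ s).det) (Icc 0 m.T) :=
    (continuous_id.matrix_det).comp_continuousOn m.continuousOn_σ
  exact (hdet.inv₀ fun s hs => (m.isUnit_det hs).ne_zero).smul
    ((continuous_id.matrix_adjugate).comp_continuousOn m.continuousOn_σ)

lemma Market.continuousOn_vecMul_inv (m : Market d) (c : Fin d → ℝ) :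
    ContinuousOn (fun s => Matrix.vecMul c (m.σ s)⁻¹) (Icc 0 m.T) :=
  (Continuous.matrix_vecMul continuous_const continuous_id :
    Continuous fun A : Matrix (Fin d) (Fin d) ℝ => Matrix.vecMul c A).comp_continuousOn
      m.continuousOn_inv

lemma Market.vecMul_inv_vecMul (m : Market d) (c : Fin d → ℝ) {s : ℝ} (hs : s ∈ Icc 0 m.T) :
    Matrix.vecMul (Matrix.vecMul c (m.σ s)⁻¹) (m.σ s) = c := by
  rw [Matrix.vecMul_vecMul, Matrix.nonsing_inv_mul _ (m.isUnit_det hs), Matrix.vecMul_one]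

lemma Market.vecMul_vecMul_inv (m : Market d) (c : Fin d → ℝ) {s : ℝ} (hs : s ∈ Icc 0 m.T) :
    Matrix.vecMul (Matrix.vecMul c (m.σ s)) (m.σ s)⁻¹ = c := by
  rw [Matrix.vecMul_vecMul, Matrix.mul_nonsing_inv _ (m.isUnit_det hs), Matrix.vecMul_one]

/-- The marginal value of location at time `t`, for the strategy `v`. -/
noncomputable def marginalLoc (P : Measure Ω) (m : Market d) (pr : Preferences Ω) (α : ℝ)
    (Z : Ω → ℝ) (ψ : (Fin d → ℝ) → ℝ) (χ : ℝ) (v : ℝ → Fin d → ℝ) (t : ℝ) : ℝ :=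
  targetLoc P pr.U Z (driftFrom m v t) (scaleFrom m α ψ v t ^ (1 / α))
    + χ * pr.lam t * deriv pr.F
      (riskOf pr Z χ (driftFrom m v t) (scaleFrom m α ψ v t ^ (1 / α)))

/-- The marginal cost of scale at time `t`, for the strategy `v`. -/
noncomputable def marginalScale (P : Measure Ω) (m : Market d) (pr : Preferences Ω) (α : ℝ)
    (Z : Ω → ℝ) (ψ : (Fin d → ℝ) → ℝ) (χ : ℝ) (v : ℝ → Fin d → ℝ) (t : ℝ) : ℝ :=
  pr.lam t * deriv pr.F
      (riskOf pr Z χ (driftFrom m v t) (scaleFrom m α ψ v t ^ (1 / α))) * (pr.ρ Z).toReal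
    - targetScale P pr.U Z (driftFrom m v t) (scaleFrom m α ψ v t ^ (1 / α))

namespace IsProblem

lemma smul_mem (h : IsProblem P α L m pr K C Z ψ χ v) {y : Fin d → ℝ} (hy : y ∈ K) {ε : ℝ}
    (hε : ε ∈ Ioo (0 : ℝ) 1) : (1 - ε) • y ∈ K := by
  have h0 : (0 : ℝ) ∈ Icc 0 m.T := ⟨le_rfl, m.T_pos.le⟩
  have := (h.interior 0 h0 y hy ε hε).self_of_nhdsWithin h0
  rwa [m.vecMul_vecMul_inv _ h0] at this

lemma exists_deviation (h : IsProblem P α L m pr K C Z ψ χ v) {t : ℝ} (ht : t ∈ Ico 0 m.T)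
    {y : Fin d → ℝ} (hy : y ∈ K) {ε : ℝ} (hε : ε ∈ Ioo (0 : ℝ) 1) :
    ∃ u : ℝ → Fin d → ℝ, ContinuousOn u (Icc 0 m.T) ∧ (∀ s, u s ∈ K) ∧ u t = (1 - ε) • y ∧
      ∃ δ > 0, ∀ s ∈ Icc t m.T, s ≤ t + δ →
        exposure m u s = Matrix.vecMul ((1 - ε) • y) (m.σ t) := by
  have ht' : t ∈ Icc 0 m.T := ⟨ht.1, ht.2.le⟩
  obtain ⟨R, hRc, hRK, hR⟩ := h.retract
  set c := Matrix.vecMul ((1 - ε) • y) (m.σ t) with hc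
  refine ⟨fun s => R (Matrix.vecMul c (m.σ s)⁻¹), hRc.comp_continuousOn
    (m.continuousOn_vecMul_inv c), fun s => hRK _, ?_, ?_⟩
  · simp only [hc, m.vecMul_vecMul_inv _ ht']
    exact hR _ (h.smul_mem hy hε)
  · obtain ⟨δ, hδ, hball⟩ := Metric.mem_nhdsWithin_iff.1 (h.interior t ht' y hy ε hε)
    refine ⟨δ / 2, half_pos hδ, fun s hs hs' => ?_⟩
    have hs0 : s ∈ Icc 0 m.T := ⟨ht.1.trans hs.1, hs.2⟩
    have hmem : Matrix.vecMul c (m.σ s)⁻¹ ∈ K := by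
      refine hball ⟨?_, hs0⟩
      rw [Metric.mem_ball, Real.dist_eq, abs_of_nonneg (sub_nonneg.2 hs.1)]
      linarith
    simp only [exposure, hR _ hmem]
    exact m.vecMul_inv_vecMul c hs0

lemma scaleFrom_nonneg (h : IsProblem P α L m pr K C Z ψ χ v) {t : ℝ} (ht : t ≤ m.T) :
    0 ≤ scaleFrom m α ψ v t :=
  intervalIntegral.integral_nonneg ht fun s _ => scaleDensity_nonneg h.scale.nonneg s

lemma hasDerivAt_driftFrom (h : IsProblem P α L m pr K C Z ψ χ v) (t : ℝ) :
    HasDerivAt (driftFrom m v) (-driftDensity m v t) t :=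
  hasDerivAt_integral_left (continuous_driftDensity h.continuousOn) m.T t

lemma hasDerivAt_scaleFrom (h : IsProblem P α L m pr K C Z ψ χ v) (t : ℝ) :
    HasDerivAt (scaleFrom m α ψ v) (-scaleDensity m α ψ v t) t :=
  hasDerivAt_integral_left
    (continuous_scaleDensity h.alpha_pos h.scale.continuous h.continuousOn) m.T t

lemma hasDerivAt_deviation {g : ℝ → ℝ} (hg : Continuous g) {G : ℝ → ℝ} {G' t : ℝ}
    (hG : HasDerivAt G G' t) :
    HasDerivAt (fun k => (∫ s in t..(t + k), g s) + G (t + k)) (g t + G') 0 := by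
  have e : HasDerivAt (fun k => t + k) 1 0 := (hasDerivAt_id (0 : ℝ)).const_add t
  have h1 : HasDerivAt (fun y => (∫ s in t..y, g s) + G y) (g t + G') (t + 0) := by
    rw [add_zero]
    exact (hasDerivAt_integral_right hg t t).add hG
  exact (h1.comp (0 : ℝ) e).congr_deriv (mul_one _)

lemma tendsto_neg_slope {f : ℝ → ℝ} {D : ℝ} (hf : HasDerivWithinAt f D (Ioi 0) 0) :
    Tendsto (fun k => (f 0 - f k) / k) (𝓝[>] 0) (𝓝 (-D)) := by
  have h1 := (hasDerivWithinAt_iff_tendsto_slope' (by simp)).1 hf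
  refine h1.neg.congr fun k => ?_
  rw [slope_def_field]
  ring

lemma local_optimality_aux [IsProbabilityMeasure P] (h : IsProblem P α L m pr K C Z ψ χ v)
    {t : ℝ} (ht : t ∈ Ico 0 m.T) (hB : 0 < scaleFrom m α ψ v t) {y : Fin d → ℝ} (hy : y ∈ K)
    {ε : ℝ} (hε : ε ∈ Ioo (0 : ℝ) 1) :
    marginalLoc P m pr α Z ψ χ v t *
        (driftDensity m (fun _ => (1 - ε) • y) t - driftDensity m v t)
      ≤ marginalScale P m pr α Z ψ χ v t * (1 / α * scaleFrom m α ψ v t ^ (1 / α - 1) *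
        (scaleDensity m α ψ (fun _ => (1 - ε) • y) t - scaleDensity m α ψ v t)) := by
  obtain ⟨u, hu, huK, hut, δ, hδ, hc⟩ := h.exists_deviation ht hy hε
  have hct : clamp m t = t := clamp_of_mem ⟨ht.1, ht.2.le⟩
  have hA := hasDerivAt_deviation (continuous_driftDensity hu) (h.hasDerivAt_driftFrom t)
  have hS := hasDerivAt_deviation
    (continuous_scaleDensity h.alpha_pos h.scale.continuous hu) (h.hasDerivAt_scaleFrom t)
  have hb := hS.rpow_const (p := 1 / α) (Or.inl (by simpa using hB.ne'))
  have hf := h.hasDerivWithinAt_valueOf t (hA.hasDerivWithinAt (s := Ioi 0))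
    (hb.hasDerivWithinAt (s := Ioi 0))
  have hlim := tendsto_neg_slope hf
  have hlim' := (continuous_coe_real_ereal.tendsto _).comp hlim
  have hl := h.liminf_deviation ht hu (fun s _ => huK s) hδ hc
  simp only [add_zero, intervalIntegral.integral_same, zero_add] at hlim'
  have h0 := hl.trans_eq hlim'.liminf_eq
  have h1 := EReal.coe_nonneg.1 h0
  have e1 : driftDensity m u t = driftDensity m (fun _ => (1 - ε) • y) t := by
    simp only [driftDensity, hct, excess, hut]
  have e2 : scaleDensity m α ψ u t = scaleDensity m α ψ (fun _ => (1 - ε) • y) t := by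
    simp only [scaleDensity, hct, exposure, hut]
  rw [e1, e2] at h1
  simp only [marginalLoc, marginalScale]
  linarith

/-- The first-order condition at a time at which the equilibrium strategy still carries noise:
the equilibrium position maximizes the marginal gain in location less the marginal cost of
scale. -/
theorem local_optimality [IsProbabilityMeasure P] (h : IsProblem P α L m pr K C Z ψ χ v)
    {t : ℝ} (ht : t ∈ Ico 0 m.T) (hB : 0 < scaleFrom m α ψ v t) {y : Fin d → ℝ} (hy : y ∈ K) :
    marginalLoc P m pr α Z ψ χ v t *
        (driftDensity m (fun _ => y) t - driftDensity m v t)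
      ≤ marginalScale P m pr α Z ψ χ v t * (1 / α * scaleFrom m α ψ v t ^ (1 / α - 1) *
        (scaleDensity m α ψ (fun _ => y) t - scaleDensity m α ψ v t)) := by
  have hc1 : Continuous fun ε : ℝ => driftDensity m (fun _ => (1 - ε) • y) t := by
    unfold driftDensity excess
    simp only [Pi.smul_apply, smul_eq_mul]
    fun_prop
  have hc2 : Continuous fun ε : ℝ => scaleDensity m α ψ (fun _ => (1 - ε) • y) t := by
    unfold scaleDensity exposure
    have h1 : Continuous fun ε : ℝ => Matrix.vecMul ((1 - ε) • y) (m.σ (clamp m t)) :=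
      Continuous.matrix_vecMul (by fun_prop) continuous_const
    exact continuous_const.mul (h.scale.continuous.comp h1)
  have l1 := (continuous_const.mul (hc1.sub continuous_const) : Continuous fun ε : ℝ =>
    marginalLoc P m pr α Z ψ χ v t * (driftDensity m (fun _ => (1 - ε) • y) t
      - driftDensity m v t)).tendsto' 0 (marginalLoc P m pr α Z ψ χ v t *
        (driftDensity m (fun _ => y) t - driftDensity m v t)) (by simp)
  have l2 := (continuous_const.mul (continuous_const.mul (hc2.sub continuous_const)) :
    Continuous fun ε : ℝ => marginalScale P m pr α Z ψ χ v t *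
      (1 / α * scaleFrom m α ψ v t ^ (1 / α - 1) *
        (scaleDensity m α ψ (fun _ => (1 - ε) • y) t - scaleDensity m α ψ v t))).tendsto' 0
    (marginalScale P m pr α Z ψ χ v t * (1 / α * scaleFrom m α ψ v t ^ (1 / α - 1) *
        (scaleDensity m α ψ (fun _ => y) t - scaleDensity m α ψ v t))) (by simp)
  refine le_of_tendsto_of_tendsto (l1.mono_left nhdsWithin_le_nhds)
    (l2.mono_left nhdsWithin_le_nhds) (b := 𝓝[>] 0) ?_
  filter_upwards [Ioo_mem_nhdsGT (zero_lt_one (α := ℝ))] with ε hε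
  exact h.local_optimality_aux ht hB hy hε

end IsProblem

end Problem

/-! ### Vanishing of the marginal penalty once the noise has stopped -/

section Problem

variable {Ω : Type*} [MeasurableSpace Ω] {P : Measure Ω} {d : ℕ} {α : ℝ}
  {L : ℝ → Ω → Fin d → ℝ} {m : Market d} {pr : Preferences Ω} {K : Set (Fin d → ℝ)}
  {C : Set (Fin d → ℝ)} {Z : Ω → ℝ} {ψ : (Fin d → ℝ) → ℝ} {χ : ℝ} {v : ℝ → Fin d → ℝ}

namespace IsProblem

lemma antitone_scaleFrom (h : IsProblem P α L m pr K C Z ψ χ v) :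
    Antitone (scaleFrom m α ψ v) :=
  antitone_of_hasDerivAt_nonpos (fun t => h.hasDerivAt_scaleFrom t) fun _ =>
    neg_nonpos.2 (scaleDensity_nonneg h.scale.nonneg _)

lemma scaleFrom_eq_zero (h : IsProblem P α L m pr K C Z ψ χ v) {t s : ℝ}
    (hB : scaleFrom m α ψ v t = 0) (hts : t ≤ s) (hs : s ≤ m.T) : scaleFrom m α ψ v s = 0 :=
  le_antisymm ((h.antitone_scaleFrom hts).trans_eq hB) (h.scaleFrom_nonneg hs)

/-- If the equilibrium strategy carries no noise after time `t` and noise reduces the risk, then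
the marginal penalty vanishes at time `t`: the scale of a deviation of length `k` is of order
`k^{1/α}`, which is large compared to `k`. -/
theorem deriv_F_eq_zero [IsProbabilityMeasure P] (h : IsProblem P α L m pr K C Z ψ χ v)
    {t : ℝ} (ht : t ∈ Ico 0 m.T) (hB : scaleFrom m α ψ v t = 0) (hρ : (pr.ρ Z).toReal < 0) :
    deriv pr.F (riskOf pr Z χ (driftFrom m v t) 0) = 0 := by
  by_contra hne
  have hF : 0 < deriv pr.F (riskOf pr Z χ (driftFrom m v t) 0) :=
    lt_of_le_of_ne (h.deriv_F_nonneg _) (Ne.symm hne)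
  have ht' : t ∈ Icc 0 m.T := ⟨ht.1, ht.2.le⟩
  have hα := h.alpha_pos
  have hα1 := h.one_lt
  obtain ⟨y, hy, hyψ⟩ := h.nondegenerate t ht'
  obtain ⟨u, hu, huK, hut, δ, hδ, hc⟩ := h.exists_deviation ht hy (ε := 1 / 2) (by norm_num)
  set g := scaleDensity m α ψ u with hg
  have hgc : Continuous g := continuous_scaleDensity hα h.scale.continuous hu
  have hgpos : 0 < g t := by
    simp only [hg, scaleDensity, clamp_of_mem ht', exposure, hut, Matrix.smul_vecMul]
    rw [h.scale.map_smul _ (by norm_num)]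
    have := compound_pos m t
    positivity
  set A : ℝ → ℝ := fun k => (∫ s in t..(t + k), driftDensity m u s) + driftFrom m v (t + k)
    with hAdef
  set S : ℝ → ℝ := fun k => ∫ s in t..(t + k), g s with hSdef
  have hS0 : S 0 = 0 := by simp [hSdef]
  have hA0 : A 0 = driftFrom m v t := by simp [hAdef]
  have hA : HasDerivAt A (driftDensity m u t + -driftDensity m v t) 0 :=
    hasDerivAt_deviation (continuous_driftDensity hu) (h.hasDerivAt_driftFrom t)
  have hS : HasDerivAt S (g t) 0 := by
    have := hasDerivAt_deviation hgc (hasDerivAt_const t (0 : ℝ))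
    simpa using this
  have hSnn : ∀ k, 0 < k → 0 ≤ S k := fun k hk =>
    intervalIntegral.integral_nonneg (by linarith) fun s _ => scaleDensity_nonneg h.scale.nonneg s
  -- reparametrize by `k ↦ k ^ α`, so that the scale becomes differentiable at `0`
  have h0α : (0 : ℝ) ^ α = 0 := Real.zero_rpow hα.ne'
  have hpow : HasDerivAt (fun k : ℝ => k ^ α) 0 0 := by
    have := Real.hasDerivAt_rpow_const (x := 0) (p := α) (Or.inr hα1.le)
    rwa [Real.zero_rpow (by linarith), mul_zero] at this
  have hA2 : HasDerivWithinAt (fun k : ℝ => A (k ^ α)) 0 (Ioi 0) 0 := by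
    have hA' := hA
    rw [← h0α] at hA'
    have := hA'.comp (0 : ℝ) hpow
    rw [mul_zero] at this
    exact this.hasDerivWithinAt
  have hSslope : Tendsto (fun k => S k / k) (𝓝[>] 0) (𝓝 (g t)) := by
    have := (hasDerivWithinAt_iff_tendsto_slope' (by simp)).1
      (hS.hasDerivWithinAt (s := Ioi 0))
    refine this.congr fun k => ?_
    rw [slope_def_field, hS0, sub_zero, sub_zero]
  have hpow0 : Tendsto (fun k : ℝ => k ^ α) (𝓝[>] 0) (𝓝[>] 0) := by
    refine tendsto_nhdsWithin_iff.2 ⟨?_, ?_⟩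
    · have := hpow.continuousAt.tendsto
      simp only [h0α] at this
      exact this.mono_left nhdsWithin_le_nhds
    · filter_upwards [self_mem_nhdsWithin] with k hk
      exact Real.rpow_pos_of_pos hk _
  have hb2 : HasDerivWithinAt (fun k : ℝ => S (k ^ α) ^ (1 / α)) (g t ^ (1 / α)) (Ioi 0) 0 := by
    refine (hasDerivWithinAt_iff_tendsto_slope' (by simp)).2 ?_
    have := (hSslope.comp hpow0).rpow_const (p := 1 / α) (Or.inl hgpos.ne')
    refine this.congr' ?_
    filter_upwards [self_mem_nhdsWithin] with k hk
    have hk : 0 < k := hk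
    rw [slope_def_field, h0α, hS0, Real.zero_rpow (by positivity), sub_zero, sub_zero,
      Function.comp_apply, Real.div_rpow (hSnn _ (Real.rpow_pos_of_pos hk _))
        (Real.rpow_nonneg hk.le _), ← Real.rpow_mul hk.le, mul_one_div_cancel hα.ne',
      Real.rpow_one]
  have hf := h.hasDerivWithinAt_valueOf t hA2 hb2
  have hlim := tendsto_neg_slope hf
  have hroot : Tendsto (fun k : ℝ => k ^ (1 / α)) (𝓝[>] 0) (𝓝[>] 0) := by
    refine tendsto_nhdsWithin_iff.2 ⟨?_, ?_⟩
    · have := (Real.continuous_rpow_const (q := 1 / α) (by positivity)).tendsto 0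
      rw [Real.zero_rpow (by positivity)] at this
      exact this.mono_left nhdsWithin_le_nhds
    · filter_upwards [self_mem_nhdsWithin] with k hk
      exact Real.rpow_pos_of_pos hk _
  have hlim2 := hlim.comp hroot
  simp only [h0α, hA0, hS0, Real.zero_rpow (show (1 / α : ℝ) ≠ 0 by positivity), mul_zero,
    zero_sub, neg_neg, IsTarget.targetScale_zero h.mean, sub_zero] at hlim2
  have hexpl : Tendsto (fun k : ℝ => k ^ (-(1 - 1 / α))) (𝓝[>] 0) atTop := by
    refine tendsto_rpow_neg_nhdsGT_zero ?_
    have : 1 / α < 1 := (div_lt_one hα).2 hα1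
    linarith
  have hneg : pr.lam t * deriv pr.F (riskOf pr Z χ (driftFrom m v t) 0) * (pr.ρ Z).toReal
      * g t ^ (1 / α) < 0 :=
    mul_neg_of_neg_of_pos (mul_neg_of_pos_of_neg (mul_pos (h.lam_pos t ht') hF) hρ)
      (Real.rpow_pos_of_pos hgpos _)
  have hbot := hlim2.neg_mul_atTop hneg hexpl
  have hl := h.liminf_deviation ht hu (fun s _ => huK s) hδ hc
  refine absurd hl (not_le.2 (lt_of_le_of_lt (liminf_le_of_frequently_le'
    (x := ((-1 : ℝ) : EReal)) (Eventually.frequently ?_)) (by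
      exact_mod_cast (by norm_num : (-1 : ℝ) < 0))))
  filter_upwards [hbot.eventually_le_atBot (-1), self_mem_nhdsWithin,
    Ioo_mem_nhdsGT (sub_pos.2 ht.2)] with k hk1 hk hk2
  have hk : 0 < k := hk
  rw [EReal.coe_le_coe_iff]
  refine le_of_eq_of_le ?_ hk1
  have e1 : (k ^ (1 / α)) ^ α = k := by
    rw [← Real.rpow_mul hk.le, one_div_mul_cancel hα.ne', Real.rpow_one]
  have e2 : scaleFrom m α ψ v (t + k) = 0 :=
    h.scaleFrom_eq_zero hB (by linarith) (by linarith [hk2.2])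
  have e3 : k ^ (-(1 - 1 / α)) = k ^ (1 / α) / k := by
    rw [neg_sub, Real.rpow_sub hk, Real.rpow_one]
  have e4 := (Real.rpow_pos_of_pos hk (1 / α)).ne'
  simp only [Function.comp_apply, e1, hB, e2, Real.zero_rpow (show (1 / α : ℝ) ≠ 0 by positivity),
    add_zero]
  rw [e3]
  field_simp
  rfl

end IsProblem

end Problem

/-! ### Regularity in time of the value functions -/

section Problem

variable {Ω : Type*} [MeasurableSpace Ω] {P : Measure Ω} {d : ℕ} {α : ℝ}
  {L : ℝ → Ω → Fin d → ℝ} {m : Market d} {pr : Preferences Ω} {K : Set (Fin d → ℝ)}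
  {C : Set (Fin d → ℝ)} {Z : Ω → ℝ} {ψ : (Fin d → ℝ) → ℝ} {χ : ℝ} {v : ℝ → Fin d → ℝ}

/-- The derivative of the scale `scaleFrom ^ (1 / α)`. Where the noise has stopped, the junk value
`0 ^ (1 / α - 1) = 0` makes it vanish, as it should. -/
noncomputable def scaleRate (m : Market d) (α : ℝ) (ψ : (Fin d → ℝ) → ℝ) (v : ℝ → Fin d → ℝ)
    (t : ℝ) : ℝ :=
  1 / α * scaleFrom m α ψ v t ^ (1 / α - 1) * -scaleDensity m α ψ v t

/-- The risk of the gain from time `t` on. -/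
noncomputable def riskFrom (m : Market d) (pr : Preferences Ω) (α : ℝ) (Z : Ω → ℝ)
    (ψ : (Fin d → ℝ) → ℝ) (χ : ℝ) (v : ℝ → Fin d → ℝ) (t : ℝ) : ℝ :=
  riskOf pr Z χ (driftFrom m v t) (scaleFrom m α ψ v t ^ (1 / α))

namespace IsProblem

lemma continuous_driftFrom (h : IsProblem P α L m pr K C Z ψ χ v) : Continuous (driftFrom m v) :=
  continuous_iff_continuousAt.2 fun t => (h.hasDerivAt_driftFrom t).continuousAt

lemma continuous_scaleFrom (h : IsProblem P α L m pr K C Z ψ χ v) :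
    Continuous (scaleFrom m α ψ v) :=
  continuous_iff_continuousAt.2 fun t => (h.hasDerivAt_scaleFrom t).continuousAt

lemma continuous_scaleFrom_rpow (h : IsProblem P α L m pr K C Z ψ χ v) :
    Continuous fun t => scaleFrom m α ψ v t ^ (1 / α) :=
  h.continuous_scaleFrom.rpow_const fun _ => Or.inr (one_div_pos.2 h.alpha_pos).le

lemma continuous_riskFrom (h : IsProblem P α L m pr K C Z ψ χ v) :
    Continuous (riskFrom m pr α Z ψ χ v) :=
  (continuous_const.mul h.continuous_scaleFrom_rpow).sub
    (continuous_const.mul h.continuous_driftFrom)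

lemma continuous_targetLoc [IsProbabilityMeasure P] (h : IsProblem P α L m pr K C Z ψ χ v) :
    Continuous fun t =>
      targetLoc P pr.U Z (driftFrom m v t) (scaleFrom m α ψ v t ^ (1 / α)) :=
  h.target.continuous_targetLoc.comp
    (h.continuous_driftFrom.prodMk h.continuous_scaleFrom_rpow)

lemma continuous_targetScale (h : IsProblem P α L m pr K C Z ψ χ v) :
    Continuous fun t =>
      targetScale P pr.U Z (driftFrom m v t) (scaleFrom m α ψ v t ^ (1 / α)) :=
  h.target.continuous_targetScale.comp
    (h.continuous_driftFrom.prodMk h.continuous_scaleFrom_rpow)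

lemma one_div_sub_one_ne_zero (h : IsProblem P α L m pr K C Z ψ χ v) : 1 / α - 1 ≠ 0 := by
  have := (div_lt_one h.alpha_pos).2 h.one_lt
  linarith

lemma scaleRate_eq_zero (h : IsProblem P α L m pr K C Z ψ χ v) {t : ℝ}
    (hB : scaleFrom m α ψ v t = 0) : scaleRate m α ψ v t = 0 := by
  rw [scaleRate, hB, Real.zero_rpow h.one_div_sub_one_ne_zero, mul_zero, zero_mul]

lemma scaleRate_nonpos (h : IsProblem P α L m pr K C Z ψ χ v) {t : ℝ} (ht : t ≤ m.T) :
    scaleRate m α ψ v t ≤ 0 :=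
  mul_nonpos_of_nonneg_of_nonpos
    (mul_nonneg (one_div_pos.2 h.alpha_pos).le (Real.rpow_nonneg (h.scaleFrom_nonneg ht) _))
    (neg_nonpos.2 (scaleDensity_nonneg h.scale.nonneg _))

lemma hasDerivAt_scale (h : IsProblem P α L m pr K C Z ψ χ v) {t : ℝ}
    (hB : 0 < scaleFrom m α ψ v t) :
    HasDerivAt (fun t => scaleFrom m α ψ v t ^ (1 / α)) (scaleRate m α ψ v t) t := by
  refine ((h.hasDerivAt_scaleFrom t).rpow_const (p := 1 / α) (Or.inl hB.ne')).congr_deriv ?_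
  rw [scaleRate]
  ring

lemma continuousAt_scaleRate (h : IsProblem P α L m pr K C Z ψ χ v) {t : ℝ}
    (hB : 0 < scaleFrom m α ψ v t) : ContinuousAt (scaleRate m α ψ v) t :=
  ((h.continuous_scaleFrom.continuousAt.rpow_const (Or.inl hB.ne')).const_mul _).mul
    (continuous_scaleDensity h.alpha_pos h.scale.continuous h.continuousOn).neg.continuousAt

/-- A function of time that depends on the location and the scale of the gain is continuously
differentiable provided that the contribution of the scale to its derivative tends to `0` when the
noise stops. -/
lemma exists_continuousOn_deriv (h : IsProblem P α L m pr K C Z ψ χ v) {Φ D E : ℝ → ℝ}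
    (hΦ : Continuous Φ) (hD : Continuous D) (hE : Continuous E)
    (hderiv : ∀ (S : Set ℝ) (t : ℝ),
      HasDerivWithinAt (fun t => scaleFrom m α ψ v t ^ (1 / α)) (scaleRate m α ψ v t) S t →
      HasDerivWithinAt Φ (D t + E t * scaleRate m α ψ v t) S t)
    (hlim : ∀ t ∈ Ioo 0 m.T, scaleFrom m α ψ v t = 0 → (∀ s < t, 0 < scaleFrom m α ψ v s) →
      Tendsto (fun s => E s * scaleRate m α ψ v s) (𝓝[<] t) (𝓝 0)) :
    (∀ t ∈ Ico 0 m.T,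
      HasDerivWithinAt Φ (D t + E t * scaleRate m α ψ v t) (Ico 0 m.T) t) ∧
    ContinuousOn (fun t => D t + E t * scaleRate m α ψ v t) (Ico 0 m.T) := by
  have hroot : (1 : ℝ) / α ≠ 0 := (one_div_pos.2 h.alpha_pos).ne'
  rw [ContinuousOn, ← forall₂_and]
  intro t ht
  rcases (h.scaleFrom_nonneg ht.2.le).lt_or_eq with hB | hB
  · exact ⟨hderiv _ t (h.hasDerivAt_scale hB).hasDerivWithinAt,
      (hD.continuousAt.add (hE.continuousAt.mul
        (h.continuousAt_scaleRate hB))).continuousWithinAt⟩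
  have hB := hB.symm
  have hrate := h.scaleRate_eq_zero hB
  -- after time `t` there is no noise
  have hright : HasDerivWithinAt Φ (D t + E t * scaleRate m α ψ v t) (Ici t) t := by
    refine hderiv _ t ?_
    rw [hrate]
    refine (hasDerivWithinAt_const t (Ici t) (0 : ℝ)).congr_of_eventuallyEq ?_
      (by rw [hB, Real.zero_rpow hroot])
    filter_upwards [Icc_mem_nhdsGE ht.2] with s hs
    rw [h.scaleFrom_eq_zero hB hs.1 hs.2, Real.zero_rpow hroot]
  have hlright : Tendsto (fun s => E s * scaleRate m α ψ v s) (𝓝[≥] t) (𝓝 0) := by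
    refine tendsto_const_nhds.congr' ?_
    filter_upwards [Icc_mem_nhdsGE ht.2] with s hs
    rw [h.scaleRate_eq_zero (h.scaleFrom_eq_zero hB hs.1 hs.2), mul_zero]
  simp only [ContinuousWithinAt, hrate, mul_zero, add_zero] at hright ⊢
  rcases ht.1.eq_or_lt with h0 | h0
  · subst h0
    refine ⟨hright.mono Ico_subset_Ici_self, ?_⟩
    simpa using (hD.continuousAt.continuousWithinAt).tendsto.add
      (hlright.mono_left (nhdsWithin_mono _ Ico_subset_Ici_self))
  suffices hleft : HasDerivWithinAt Φ (D t) (Iic t) t ∧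
      Tendsto (fun s => E s * scaleRate m α ψ v s) (𝓝[<] t) (𝓝 0) by
    constructor
    · have := hleft.1.union hright
      rw [Iic_union_Ici] at this
      exact this.mono (subset_univ _)
    · have := (nhdsLT_sup_nhdsGE t) ▸ hleft.2.sup hlright
      simpa using (hD.continuousAt.continuousWithinAt).tendsto.add
        (this.mono_left nhdsWithin_le_nhds)
  by_cases hex : ∃ s < t, scaleFrom m α ψ v s = 0
  · obtain ⟨s, hs, hs0⟩ := hex
    have hz : ∀ᶠ x in 𝓝 t, scaleFrom m α ψ v x = 0 := by
      filter_upwards [Ioo_mem_nhds hs ht.2] with x hx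
      exact h.scaleFrom_eq_zero hs0 hx.1.le hx.2.le
    refine ⟨?_, ?_⟩
    · have := hderiv (Iic t) t ?_
      · rwa [hrate, mul_zero, add_zero] at this
      · rw [hrate]
        refine HasDerivAt.hasDerivWithinAt ((hasDerivAt_const t (0 : ℝ)).congr_of_eventuallyEq ?_)
        filter_upwards [hz] with x hx
        rw [hx, Real.zero_rpow hroot]
    · refine tendsto_const_nhds.congr' ?_
      filter_upwards [nhdsWithin_le_nhds hz] with x hx
      rw [h.scaleRate_eq_zero hx, mul_zero]
  · push Not at hex
    have hpos : ∀ s < t, 0 < scaleFrom m α ψ v s := fun s hs =>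
      lt_of_le_of_ne (h.scaleFrom_nonneg (hs.le.trans ht.2.le)) (hex s hs).symm
    have hl := hlim t ⟨h0, ht.2⟩ hB hpos
    have hd : ∀ s < t, HasDerivAt Φ (D s + E s * scaleRate m α ψ v s) s := fun s hs =>
      hasDerivWithinAt_univ.1 (hderiv univ s (h.hasDerivAt_scale (hpos s hs)).hasDerivWithinAt)
    refine ⟨hasDerivWithinAt_Iic_of_tendsto_deriv (s := Iio t)
      (fun s hs => (hd s hs).differentiableAt.differentiableWithinAt)
      hΦ.continuousAt.continuousWithinAt self_mem_nhdsWithin ?_, hl⟩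
    have h1 : Tendsto (fun s => D s + E s * scaleRate m α ψ v s) (𝓝[<] t) (𝓝 (D t)) := by
      simpa using (hD.continuousAt.continuousWithinAt).tendsto.add hl
    refine h1.congr' ?_
    filter_upwards [self_mem_nhdsWithin] with s hs
    exact (hd s hs).deriv.symm

lemma scale_exposure_eq_zero (h : IsProblem P α L m pr K C Z ψ χ v) {t : ℝ} (ht : t ∈ Ico 0 m.T)
    (hB : scaleFrom m α ψ v t = 0) : ψ (exposure m v t) = 0 := by
  have h1 := (h.hasDerivAt_scaleFrom t).hasDerivWithinAt (s := Ici t)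
  have h2 : HasDerivWithinAt (scaleFrom m α ψ v) 0 (Ici t) t := by
    refine (hasDerivWithinAt_const t (Ici t) (0 : ℝ)).congr_of_eventuallyEq ?_ hB
    filter_upwards [Icc_mem_nhdsGE ht.2] with s hs
    exact h.scaleFrom_eq_zero hB hs.1 hs.2
  have h3 := (uniqueDiffWithinAt_Ici t).eq_deriv _ h1 h2
  rw [neg_eq_zero, scaleDensity, clamp_of_mem ⟨ht.1, ht.2.le⟩] at h3
  exact (mul_eq_zero.1 h3).resolve_left (Real.rpow_pos_of_pos (compound_pos m t) _).ne'

lemma driftDensity_smul (c t : ℝ) :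
    driftDensity m (fun _ => c • v t) t = c * (compound m (clamp m t) *
      ∑ i, v t i * (m.μ (clamp m t) i - m.r)) := by
  simp only [driftDensity, excess, Pi.smul_apply, smul_eq_mul, Finset.mul_sum]
  refine Finset.sum_congr rfl fun i _ => ?_
  ring

/-- Shortly before the noise stops, the equilibrium drift has a nonnegative marginal value:
compare the equilibrium position with its negative, or with `0` and its double. -/
lemma eventually_drift_nonneg [IsProbabilityMeasure P] (h : IsProblem P α L m pr K C Z ψ χ v)
    {t : ℝ} (ht : t ∈ Ioo 0 m.T) (hB : scaleFrom m α ψ v t = 0)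
    (hpos : ∀ s < t, 0 < scaleFrom m α ψ v s) :
    ∀ᶠ s in 𝓝[<] t, 0 ≤ marginalLoc P m pr α Z ψ χ v s * driftDensity m v s := by
  have hα := h.alpha_pos
  have hsub : ∀ s ∈ Ioo 0 t, s ∈ Ico 0 m.T := fun s hs => ⟨hs.1.le, hs.2.trans ht.2⟩
  have hdrift : ∀ s ∈ Ioo 0 t, ∀ c : ℝ,
      driftDensity m (fun _ => c • v s) s = c * driftDensity m v s := fun s hs c => by
    rw [driftDensity_smul, driftDensity, excess, clamp_of_mem ⟨(hsub s hs).1, (hsub s hs).2.le⟩]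
  have hscale : ∀ s ∈ Ioo 0 t, ∀ c : ℝ, scaleDensity m α ψ (fun _ => c • v s) s
      = compound m s ^ α * ψ (c • exposure m v s) := fun s hs c => by
    rw [scaleDensity, clamp_of_mem ⟨(hsub s hs).1, (hsub s hs).2.le⟩, exposure,
      Matrix.smul_vecMul]
    rfl
  have hscale1 : ∀ s ∈ Ioo 0 t, scaleDensity m α ψ v s
      = compound m s ^ α * ψ (exposure m v s) := fun s hs => by
    rw [scaleDensity, clamp_of_mem ⟨(hsub s hs).1, (hsub s hs).2.le⟩]
  rcases h.symm_or_pos with ⟨hsymm, heven⟩ | ⟨hzero, hdouble⟩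
  · filter_upwards [Ioo_mem_nhdsLT ht.1] with s hs
    have hK := hsymm _ (h.control_mem ⟨(hsub s hs).1, (hsub s hs).2.le⟩)
    have h1 := h.local_optimality (hsub s hs) (hpos s hs.2) hK
    have e1 := hdrift s hs (-1)
    have e2 := hscale s hs (-1)
    simp only [neg_smul, one_smul] at e1 e2
    rw [e1, e2, hscale1 s hs, heven, sub_self, mul_zero, mul_zero] at h1
    linarith
  · have hv0 : v t = 0 := hzero t ⟨ht.1.le, ht.2.le⟩ _ (h.control_mem ⟨ht.1.le, ht.2.le⟩)
      (h.scale_exposure_eq_zero ⟨ht.1.le, ht.2⟩ hB)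
    have hvt : Tendsto v (𝓝[<] t) (𝓝[K] 0) := by
      refine tendsto_nhdsWithin_iff.2 ⟨?_, ?_⟩
      · have := (h.continuousOn.continuousAt (Icc_mem_nhds ht.1 ht.2)).tendsto
        rw [hv0] at this
        exact this.mono_left nhdsWithin_le_nhds
      · filter_upwards [Ioo_mem_nhdsLT ht.1] with s hs
        exact h.control_mem ⟨(hsub s hs).1, (hsub s hs).2.le⟩
    filter_upwards [Ioo_mem_nhdsLT ht.1, hvt.eventually hdouble] with s hs h2K
    have h1 := h.local_optimality (hsub s hs) (hpos s hs.2) h2K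
    have h0 := h.local_optimality (hsub s hs) (hpos s hs.2) h.zero_mem
    have e1 := hdrift s hs 0
    have e2 := hscale s hs 0
    rw [zero_smul] at e1 e2
    have hψ0 : ψ 0 = 0 := by
      have := h.scale.map_smul 0 le_rfl 0
      rwa [zero_smul, Real.zero_rpow hα.ne', zero_mul] at this
    rw [e1, e2, zero_smul, hscale1 s hs, hψ0] at h0
    rw [hdrift s hs, hscale s hs, hscale1 s hs, h.scale.map_smul _ zero_le_two] at h1
    have h2 : (2 : ℝ) < 2 ^ α := by
      simpa using Real.rpow_lt_rpow_of_exponent_lt one_lt_two h.one_lt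
    set k := marginalLoc P m pr α Z ψ χ v s * driftDensity m v s with hk
    set w := marginalScale P m pr α Z ψ χ v s * (1 / α * scaleFrom m α ψ v s ^ (1 / α - 1) *
      (compound m s ^ α * ψ (exposure m v s))) with hw
    have a0 : w ≤ k := by rw [hk, hw]; linarith
    have a1 : k ≤ (2 ^ α - 1) * w := by rw [hk, hw]; linarith
    have a2 : 0 ≤ w := by
      by_contra hneg
      nlinarith
    exact a2.trans a0

/-- When the noise stops, the risk contributes nonnegatively to the marginal cost of scale.
This is immediate if noise increases the risk. Otherwise the marginal penalty vanishes at the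
time `t` at which the noise stops, and hence, as the equilibrium drift is nonnegative as long as the
marginal penalty is positive, also shortly before. -/
lemma eventually_risk_nonneg [IsProbabilityMeasure P] (h : IsProblem P α L m pr K C Z ψ χ v)
    {t : ℝ} (ht : t ∈ Ioo 0 m.T) (hB : scaleFrom m α ψ v t = 0)
    (hpos : ∀ s < t, 0 < scaleFrom m α ψ v s) :
    ∀ᶠ s in 𝓝[<] t, 0 ≤ deriv pr.F (riskFrom m pr α Z ψ χ v s) * (pr.ρ Z).toReal := by
  have hroot : (0 : ℝ) < 1 / α := one_div_pos.2 h.alpha_pos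
  rcases le_or_gt 0 (pr.ρ Z).toReal with hρ | hρ
  · exact Eventually.of_forall fun s => mul_nonneg (h.deriv_F_nonneg _) hρ
  have hF0 : deriv pr.F (riskFrom m pr α Z ψ χ v t) = 0 := by
    rw [riskFrom, hB, Real.zero_rpow hroot.ne']
    exact h.deriv_F_eq_zero ⟨ht.1.le, ht.2⟩ hB hρ
  have hcF : Continuous fun s => deriv pr.F (riskFrom m pr α Z ψ χ v s) :=
    h.continuous_deriv_F.comp h.continuous_riskFrom
  obtain ⟨a, ha, hnn⟩ := (mem_nhdsLT_iff_exists_Ioo_subset' ht.1).1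
    (inter_mem (h.eventually_drift_nonneg ht hB hpos) (Ioo_mem_nhdsLT ht.1))
  filter_upwards [Ioo_mem_nhdsLT ha] with t₁ ht₁
  refine le_of_eq (mul_eq_zero_of_left ?_ _).symm
  refine le_antisymm ?_ (h.deriv_F_nonneg _)
  obtain ⟨t₂, ⟨ht₂, hF2⟩, hleast⟩ := (isCompact_Icc.inter_right
    (isClosed_singleton.preimage hcF) : IsCompact
      (Icc t₁ t ∩ (fun s => deriv pr.F (riskFrom m pr α Z ψ χ v s)) ⁻¹' {0})).exists_isLeast
    ⟨t, ⟨ht₁.2.le, le_rfl⟩, hF0⟩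
  have hF2 : deriv pr.F (riskFrom m pr α Z ψ χ v t₂) = 0 := hF2
  rw [← hF2]
  refine h.deriv_F_mono ?_
  have hb : scaleFrom m α ψ v t₂ ^ (1 / α) ≤ scaleFrom m α ψ v t₁ ^ (1 / α) :=
    Real.rpow_le_rpow (h.scaleFrom_nonneg (ht₂.2.trans ht.2.le)) (h.antitone_scaleFrom ht₂.1)
      hroot.le
  have hA : χ * driftFrom m v t₂ ≤ χ * driftFrom m v t₁ := by
    rcases h.chi with hχ | hχ
    · rw [hχ, zero_mul, zero_mul]
    rw [hχ, one_mul, one_mul]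
    refine antitoneOn_of_deriv_nonpos (convex_Icc t₁ t₂) h.continuous_driftFrom.continuousOn
      (fun s _ => (h.hasDerivAt_driftFrom s).differentiableAt.differentiableWithinAt)
      (fun s hs => ?_) (left_mem_Icc.2 ht₂.1) (right_mem_Icc.2 ht₂.1) ht₂.1
    rw [interior_Icc] at hs
    rw [(h.hasDerivAt_driftFrom s).deriv, neg_nonpos]
    obtain ⟨hs1, hs2⟩ := hnn ⟨ht₁.1.trans hs.1, hs.2.trans_le ht₂.2⟩
    have hs1 : 0 ≤ marginalLoc P m pr α Z ψ χ v s * driftDensity m v s := hs1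
    have hFs : 0 < deriv pr.F (riskFrom m pr α Z ψ χ v s) := by
      refine lt_of_le_of_ne (h.deriv_F_nonneg _) fun he => ?_
      exact absurd (hleast ⟨⟨hs.1.le, hs.2.le.trans ht₂.2⟩, he.symm⟩) (not_le.2 hs.2)
    refine nonneg_of_mul_nonneg_right hs1 ?_
    rw [riskFrom, hχ] at hFs
    rw [marginalLoc, hχ, one_mul]
    exact add_pos_of_nonneg_of_pos (h.target.targetLoc_nonneg _ _)
      (mul_pos (h.lam_pos s ⟨hs2.1.le, hs2.2.le.trans ht.2.le⟩) hFs)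
  rw [riskFrom, riskFrom, riskOf, riskOf]
  have := mul_le_mul_of_nonpos_left hb hρ.le
  linarith

/-- The contribution of the scale to the equilibrium value is asymptotically nonnegative when the
noise stops: compare the equilibrium position at time `s` with one whose exposure is that at
time `t`, up to a factor `1 - ε`. -/
lemma eventually_neg_le_marginalScale [IsProbabilityMeasure P]
    (h : IsProblem P α L m pr K C Z ψ χ v)
    {t : ℝ} (ht : t ∈ Ioo 0 m.T) (hB : scaleFrom m α ψ v t = 0)
    (hpos : ∀ s < t, 0 < scaleFrom m α ψ v s) {η : ℝ} (hη : 0 < η) :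
    ∀ᶠ s in 𝓝[<] t, -η < marginalScale P m pr α Z ψ χ v s * scaleRate m α ψ v s := by
  have ht' : t ∈ Icc 0 m.T := ⟨ht.1.le, ht.2.le⟩
  have hα := h.alpha_pos
  set q := marginalLoc P m pr α Z ψ χ v t * driftDensity m v t with hq
  obtain ⟨ε, hε, hεq⟩ : ∃ ε ∈ Ioo (0 : ℝ) 1, -η < -(ε * q) := by
    have : Tendsto (fun ε : ℝ => -(ε * q)) (𝓝[>] 0) (𝓝 0) :=
      ((continuous_id.mul continuous_const).neg.tendsto' 0 0 (by simp)).mono_left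
        nhdsWithin_le_nhds
    obtain ⟨ε, h1, h2⟩ := ((this.eventually (lt_mem_nhds (neg_lt_zero.2 hη))).and
      (Ioo_mem_nhdsGT (zero_lt_one (α := ℝ)))).exists
    exact ⟨ε, h2, h1⟩
  set y : ℝ → Fin d → ℝ :=
    fun s => Matrix.vecMul (Matrix.vecMul ((1 - ε) • v t) (m.σ t)) (m.σ s)⁻¹ with hy
  have hnhds : Icc 0 m.T ∈ 𝓝 t := Icc_mem_nhds ht.1 ht.2
  have hyK : ∀ᶠ s in 𝓝[<] t, y s ∈ K := by
    have := h.interior t ht' _ (h.control_mem ht') ε hε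
    rw [nhdsWithin_eq_nhds.2 hnhds] at this
    exact nhdsWithin_le_nhds this
  have hyt : y t = (1 - ε) • v t := m.vecMul_vecMul_inv _ ht'
  have hyc : ContinuousOn y (Icc 0 m.T) := m.continuousOn_vecMul_inv _
  have hexp : ∀ s ∈ Icc 0 m.T, scaleDensity m α ψ y s = 0 := fun s hs => by
    have e : ψ (exposure m v t) = 0 := h.scale_exposure_eq_zero ⟨ht.1.le, ht.2⟩ hB
    rw [scaleDensity, clamp_of_mem hs, exposure, hy]
    simp only [m.vecMul_inv_vecMul _ hs, Matrix.smul_vecMul]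
    rw [h.scale.map_smul _ (sub_pos.2 hε.2).le]
    rw [exposure] at e
    rw [e, mul_zero, mul_zero]
  have hlamc : ContinuousAt pr.lam t := h.contDiffOn_lam.continuousOn.continuousAt hnhds
  have hlim : Tendsto (fun s => marginalLoc P m pr α Z ψ χ v s *
      (driftDensity m y s - driftDensity m v s)) (𝓝 t) (𝓝 (-(ε * q))) := by
    have hc : ContinuousAt (fun s => marginalLoc P m pr α Z ψ χ v s *
        (driftDensity m y s - driftDensity m v s)) t :=
      (h.continuous_targetLoc.continuousAt.add ((continuousAt_const.mul hlamc).mul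
        (h.continuous_deriv_F.comp h.continuous_riskFrom).continuousAt)).mul
        ((continuous_driftDensity hyc).sub (continuous_driftDensity h.continuousOn)).continuousAt
    have e1 : driftDensity m y t = (1 - ε) * driftDensity m v t := by
      have := driftDensity_smul (m := m) (v := v) (1 - ε) t
      rw [driftDensity, excess, clamp_of_mem ht'] at this ⊢
      rw [hyt, this, driftDensity, excess, clamp_of_mem ht']
    have e2 : marginalLoc P m pr α Z ψ χ v t * (driftDensity m y t - driftDensity m v t)
        = -(ε * q) := by
      rw [e1, hq]
      ring
    rw [← e2]
    exact hc.tendsto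
  filter_upwards [nhdsWithin_le_nhds (hlim.eventually (lt_mem_nhds hεq)), hyK,
    Ioo_mem_nhdsLT ht.1] with s hs hsK hs0
  have hs' : s ∈ Icc 0 m.T := ⟨hs0.1.le, hs0.2.le.trans ht.2.le⟩
  have h1 := h.local_optimality ⟨hs'.1, hs0.2.trans ht.2⟩ (hpos s hs0.2) hsK
  have e1 : driftDensity m (fun _ => y s) s = driftDensity m y s := by
    simp only [driftDensity, excess, clamp_of_mem hs']
  have e2 : scaleDensity m α ψ (fun _ => y s) s = scaleDensity m α ψ y s := by
    simp only [scaleDensity, exposure, clamp_of_mem hs']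
  rw [e1, e2, hexp s hs', zero_sub] at h1
  rw [scaleRate]
  exact hs.trans_le h1

/-- When the noise stops, neither the risk nor the target leaves a contribution of the scale to
the time derivative. -/
lemma tendsto_scale_contribution [IsProbabilityMeasure P]
    (h : IsProblem P α L m pr K C Z ψ χ v)
    {t : ℝ} (ht : t ∈ Ioo 0 m.T) (hB : scaleFrom m α ψ v t = 0)
    (hpos : ∀ s < t, 0 < scaleFrom m α ψ v s) :
    Tendsto (fun s => deriv pr.F (riskFrom m pr α Z ψ χ v s) * (pr.ρ Z).toReal
      * scaleRate m α ψ v s) (𝓝[<] t) (𝓝 0) ∧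
    Tendsto (fun s => targetScale P pr.U Z (driftFrom m v s) (scaleFrom m α ψ v s ^ (1 / α))
      * scaleRate m α ψ v s) (𝓝[<] t) (𝓝 0) := by
  have hθ : Tendsto (fun s => min 0 (marginalScale P m pr α Z ψ χ v s * scaleRate m α ψ v s))
      (𝓝[<] t) (𝓝 0) := by
    refine tendsto_order.2 ⟨fun c hc => ?_, fun c hc => Eventually.of_forall fun s =>
      (min_le_left _ _).trans_lt hc⟩
    filter_upwards [h.eventually_neg_le_marginalScale ht hB hpos (neg_pos.2 hc)] with s hs
    exact lt_min hc (by simpa using hs)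
  have hlamc : ContinuousAt pr.lam t :=
    h.contDiffOn_lam.continuousOn.continuousAt (Icc_mem_nhds ht.1 ht.2)
  have hlam0 := h.lam_pos t ⟨ht.1.le, ht.2.le⟩
  -- the marginal cost of scale is the sum of two nonnegative terms
  have hev := (h.eventually_risk_nonneg ht hB hpos).and (Ioo_mem_nhdsLT ht.1)
  constructor
  · have h1 : Tendsto (fun s => pr.lam s * (deriv pr.F (riskFrom m pr α Z ψ χ v s)
        * (pr.ρ Z).toReal * scaleRate m α ψ v s)) (𝓝[<] t) (𝓝 0) := by
      refine tendsto_of_tendsto_of_tendsto_of_le_of_le' hθ tendsto_const_nhds ?_ ?_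
      · filter_upwards [hev] with s hs
        have hsT : s ≤ m.T := hs.2.2.le.trans ht.2.le
        have hr := h.scaleRate_nonpos hsT
        have hb := Real.rpow_nonneg (h.scaleFrom_nonneg hsT) (1 / α)
        have hq := h.target.targetScale_nonpos h.mean (driftFrom m v s) hb
        refine (min_le_right _ _).trans ?_
        rw [marginalScale]
        have := mul_nonneg_of_nonpos_of_nonpos hq hr
        rw [riskFrom]
        linarith
      · filter_upwards [hev] with s hs
        have hsT : s ≤ m.T := hs.2.2.le.trans ht.2.le
        exact mul_nonpos_of_nonneg_of_nonpos (h.lam_pos s ⟨hs.2.1.le, hsT⟩).le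
          (mul_nonpos_of_nonneg_of_nonpos hs.1 (h.scaleRate_nonpos hsT))
    have h2 := (hlamc.inv₀ hlam0.ne').continuousWithinAt.tendsto.mul h1 (x := 𝓝[<] t)
    rw [mul_zero] at h2
    refine h2.congr' ?_
    filter_upwards [hev] with s hs
    rw [Pi.inv_apply, inv_mul_cancel_left₀
      (h.lam_pos s ⟨hs.2.1.le, hs.2.2.le.trans ht.2.le⟩).ne']
  · have h1 : Tendsto (fun s => -(targetScale P pr.U Z (driftFrom m v s)
        (scaleFrom m α ψ v s ^ (1 / α)) * scaleRate m α ψ v s)) (𝓝[<] t) (𝓝 0) := by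
      refine tendsto_of_tendsto_of_tendsto_of_le_of_le' hθ tendsto_const_nhds ?_ ?_
      · filter_upwards [hev] with s hs
        have hsT : s ≤ m.T := hs.2.2.le.trans ht.2.le
        refine (min_le_right _ _).trans ?_
        rw [marginalScale]
        have := mul_nonpos_of_nonneg_of_nonpos (h.lam_pos s ⟨hs.2.1.le, hsT⟩).le
          (mul_nonpos_of_nonneg_of_nonpos hs.1 (h.scaleRate_nonpos hsT))
        rw [riskFrom] at this
        linarith
      · filter_upwards [hev] with s hs
        have hsT : s ≤ m.T := hs.2.2.le.trans ht.2.le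
        have hb := Real.rpow_nonneg (h.scaleFrom_nonneg hsT) (1 / α)
        exact neg_nonpos.2 (mul_nonneg_of_nonpos_of_nonpos
          (h.target.targetScale_nonpos h.mean (driftFrom m v s) hb) (h.scaleRate_nonpos hsT))
    simpa using h1.neg

end IsProblem

lemma isC12On_of_time {T : ℝ} {f : ℝ → ℝ → ℝ} {φ φ' : ℝ → ℝ}
    (hf : ∀ t ∈ Ico 0 T, ∀ x, f t x = φ t)
    (hd : ∀ t ∈ Ico 0 T, HasDerivWithinAt φ (φ' t) (Ico 0 T) t)
    (hc : ContinuousOn φ' (Ico 0 T)) : IsC12On T f := by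
  have hfst : MapsTo (Prod.fst : ℝ × ℝ → ℝ) (Ico 0 T ×ˢ univ) (Ico 0 T) := fun y hy => hy.1
  have hφ : ContinuousOn φ (Ico 0 T) := fun t ht => (hd t ht).continuousWithinAt
  refine ⟨fun t _ => φ' t, fun _ _ => 0, fun _ _ => 0, fun t ht x => ?_, fun t ht x => ?_,
    fun t _ x => hasDerivAt_const x 0, ?_, hc.comp continuousOn_fst hfst, continuousOn_const,
    continuousOn_const⟩
  · exact (hd t ht).congr (fun s hs => hf s hs x) (hf t ht x)
  · have : f t = fun _ => φ t := funext (hf t ht)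
    rw [this]
    exact hasDerivAt_const x _
  · exact (hφ.comp continuousOn_fst hfst).congr fun y hy => hf y.1 hy.1 y.2

namespace IsProblem

/-- The expected target as a function of time. -/
theorem exists_deriv_target [IsProbabilityMeasure P] (h : IsProblem P α L m pr K C Z ψ χ v) :
    ∃ φ' : ℝ → ℝ, (∀ t ∈ Ico 0 m.T, HasDerivWithinAt (fun t => targetMean P pr.U Z
      (driftFrom m v t) (scaleFrom m α ψ v t ^ (1 / α))) (φ' t) (Ico 0 m.T) t) ∧
      ContinuousOn φ' (Ico 0 m.T) := by
  refine ⟨_, h.exists_continuousOn_deriv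
    (D := fun t => targetLoc P pr.U Z (driftFrom m v t) (scaleFrom m α ψ v t ^ (1 / α))
      * -driftDensity m v t)
    (E := fun t => targetScale P pr.U Z (driftFrom m v t) (scaleFrom m α ψ v t ^ (1 / α)))
    ?_ (h.continuous_targetLoc.mul (continuous_driftDensity h.continuousOn).neg)
    h.continuous_targetScale ?_ fun t ht hB hpos => (h.tendsto_scale_contribution ht hB hpos).2⟩
  · have : Continuous fun y : ℝ × ℝ => targetMean P pr.U Z y.1 y.2 :=
      continuous_iff_continuousAt.2 fun y => (h.target.hasStrictFDerivAt y).continuousAt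
    exact this.comp (h.continuous_driftFrom.prodMk h.continuous_scaleFrom_rpow)
  · intro S t hb
    exact h.target.hasDerivWithinAt_comp (h.hasDerivAt_driftFrom t).hasDerivWithinAt hb

/-- The penalty as a function of time. -/
theorem exists_deriv_penalty [IsProbabilityMeasure P] (h : IsProblem P α L m pr K C Z ψ χ v) :
    ∃ φ' : ℝ → ℝ, (∀ t ∈ Ico 0 m.T, HasDerivWithinAt
      (fun t => pr.lam t * pr.F (riskFrom m pr α Z ψ χ v t)) (φ' t) (Ico 0 m.T) t) ∧
      ContinuousOn φ' (Ico 0 m.T) := by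
  have hcF : Continuous fun s => deriv pr.F (riskFrom m pr α Z ψ χ v s) :=
    h.continuous_deriv_F.comp h.continuous_riskFrom
  have hFc : Continuous fun s => pr.F (riskFrom m pr α Z ψ χ v s) :=
    h.contDiff_F.continuous.comp h.continuous_riskFrom
  obtain ⟨h1, h2⟩ := h.exists_continuousOn_deriv
    (Φ := fun t => pr.F (riskFrom m pr α Z ψ χ v t))
    (D := fun t => deriv pr.F (riskFrom m pr α Z ψ χ v t) * (χ * driftDensity m v t))
    (E := fun t => deriv pr.F (riskFrom m pr α Z ψ χ v t) * (pr.ρ Z).toReal)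
    hFc (hcF.mul (continuous_const.mul (continuous_driftDensity h.continuousOn)))
    (hcF.mul continuous_const)
    (fun S t hb => by
      refine ((h.hasDerivAt_F _).comp_hasDerivWithinAt t (hasDerivWithinAt_riskOf (pr := pr)
        (Z := Z) (χ := χ) (h.hasDerivAt_driftFrom t).hasDerivWithinAt hb)).congr_deriv ?_
      rw [riskFrom]
      ring)
    fun t ht hB hpos => (h.tendsto_scale_contribution ht hB hpos).1
  have hud : UniqueDiffOn ℝ (Icc 0 m.T) := uniqueDiffOn_Icc m.T_pos
  refine ⟨_, fun t ht => HasDerivWithinAt.mul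
    ((h.contDiffOn_lam.differentiableOn one_ne_zero t
      ⟨ht.1, ht.2.le⟩).hasDerivWithinAt.mono Ico_subset_Icc_self) (h1 t ht), ?_⟩
  have hl : ContinuousOn (derivWithin pr.lam (Icc 0 m.T)) (Ico 0 m.T) :=
    (h.contDiffOn_lam.continuousOn_derivWithin hud le_rfl).mono Ico_subset_Icc_self
  exact (hl.mul hFc.continuousOn).add
    ((h.contDiffOn_lam.continuousOn.mono Ico_subset_Icc_self).mul h2)

/-- The conclusion for the equilibrium problem in terms of the scale. -/
theorem regular [IsProbabilityMeasure P] (h : IsProblem P α L m pr K C Z ψ χ v)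
    {X : ℝ → ℝ → ℝ → Ω → ℝ} (hX : ∀ t ∈ Ico 0 m.T, ∀ x, IsWealth P L m v t x (X t x)) :
    (∀ t ∈ Ico 0 m.T, ∀ x,
      pr.ρ (gain m t x (X t x m.T)) ≠ ⊥ ∧ pr.ρ (gain m t x (X t x m.T)) ≠ ⊤ ∧
      Integrable (fun ω => pr.U (gain m t x (X t x m.T) ω)) P) ∧
    IsC12On m.T (fun t x => riskPenalty m pr t x (X t x m.T)) ∧
    IsC12On m.T (fun t x => expectedTarget P m pr t x (X t x m.T)) := by
  have key : ∀ t ∈ Ico 0 m.T, ∀ x,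
      pr.ρ (gain m t x (X t x m.T)) = ((riskFrom m pr α Z ψ χ v t : ℝ) : EReal) ∧
      Integrable (fun ω => pr.U (gain m t x (X t x m.T) ω)) P ∧
      expectedTarget P m pr t x (X t x m.T) = targetMean P pr.U Z (driftFrom m v t)
        (scaleFrom m α ψ v t ^ (1 / α)) := fun t ht x => by
    have ht' : t ∈ Icc 0 m.T := ⟨ht.1, ht.2.le⟩
    have hsub : Icc t m.T ⊆ Icc 0 m.T := Icc_subset_Icc_left ht.1
    have := h.gain_formulas (hX t ht x) ht
      (fun s hs => h.cone s (hsub hs) _ (h.control_mem (hsub hs)))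
      (isRiemannOn_of_continuousOn ht.1
        (h.scale.continuous.comp_continuousOn (continuousOn_exposure h.continuousOn)))
      (isRiemannOn_of_continuousOn ht.1 (continuousOn_excess h.continuousOn))
    rwa [integral_drift_eq ht', integral_scale_eq ht'] at this
  obtain ⟨φ, hφ, hφc⟩ := h.exists_deriv_target
  obtain ⟨φ₂, hφ₂, hφ₂c⟩ := h.exists_deriv_penalty
  refine ⟨fun t ht x => ?_, isC12On_of_time (fun t ht x => ?_) hφ₂ hφ₂c,
    isC12On_of_time (fun t ht x => (key t ht x).2.2) hφ hφc⟩
  · obtain ⟨h1, h2, -⟩ := key t ht x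
    rw [h1]
    exact ⟨EReal.coe_ne_bot _, EReal.coe_ne_top _, h2⟩
  · rw [riskPenalty, (key t ht x).1, EReal.toReal_coe]

end IsProblem

end Problem

/-! ### The two sets of admissible positions -/

section Positions

variable {Ω : Type*} [MeasurableSpace Ω] {P : Measure Ω} {d : ℕ} {α M : ℝ}
  {L : ℝ → Ω → Fin d → ℝ} {m : Market d}

/-- Integrability at the horizon transfers to time `1` by stability. -/
lemma IsStableLevy.isTarget (hL : IsStableLevy P α L) {U : ℝ → ℝ} (hU : ContDiff ℝ 1 U)
    (hU_mono : Monotone U) (hU_conc : ConcaveOn ℝ univ U) {T : ℝ} (hT : 0 < T) (j : Fin d)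
    (hint : ∀ a b : ℝ, Integrable (fun ω => U (a + b * L T ω j)) P)
    (hint' : ∀ a b : ℝ, Integrable (fun ω => L T ω j * deriv U (a + b * L T ω j)) P) :
    IsTarget P U (fun ω => L 1 ω j) := by
  have hc : 0 < T ^ (1 / α) := Real.rpow_pos_of_pos hT _
  have hid : IdentDistrib (fun ω => L T ω j) (fun ω => T ^ (1 / α) * L 1 ω j) P P :=
    (hL.identDistrib_smul hT.le).comp (measurable_pi_apply j)
  have hU' : Continuous (deriv U) := hU.continuous_deriv le_rfl
  refine ⟨hU, hU_mono, hU_conc, hL.measurable_coord j, fun a b => ?_, fun a b => ?_⟩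
  · have h1 := (hid.comp (u := fun z => U (a + b / T ^ (1 / α) * z))
      (hU.continuous.measurable.comp (by fun_prop))).integrable_iff.1 (hint a _)
    refine h1.congr (Eventually.of_forall fun ω => ?_)
    simp only [Function.comp_apply]
    rw [← mul_assoc, div_mul_cancel₀ _ hc.ne']
  · have h1 := (hid.comp (u := fun z => z * deriv U (a + b / T ^ (1 / α) * z))
      (measurable_id.mul (hU'.measurable.comp (by fun_prop)))).integrable_iff.1 (hint' a _)
    refine (h1.const_mul (T ^ (1 / α))⁻¹).congr (Eventually.of_forall fun ω => ?_)
    simp only [Function.comp_apply]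
    rw [← mul_assoc (b / T ^ (1 / α)), div_mul_cancel₀ _ hc.ne', mul_assoc,
      inv_mul_cancel_left₀ hc.ne']

lemma exists_retract_box {l M : ℝ} (hlM : l ≤ M) :
    ∃ R : (Fin d → ℝ) → Fin d → ℝ, Continuous R ∧ (∀ y i, l ≤ R y i ∧ R y i ≤ M) ∧
      ∀ y, (∀ i, l ≤ y i ∧ y i ≤ M) → R y = y := by
  refine ⟨fun y i => max l (min (y i) M), by fun_prop,
    fun y i => ⟨le_max_left _ _, max_le hlM (min_le_right _ _)⟩, fun y hy => funext fun i => ?_⟩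
  dsimp only
  rw [min_eq_left (hy i).2, max_eq_right (hy i).1]

/-- A position in the interior of the box stays there when the exposure is kept constant. -/
lemma Market.eventually_lt (m : Market d) {t : ℝ} (ht : t ∈ Icc 0 m.T) {y : Fin d → ℝ}
    (hM : 0 < M) (hy : ∀ i, y i ≤ M) {ε : ℝ} (hε : ε ∈ Ioo (0 : ℝ) 1) :
    ∀ᶠ s in 𝓝[Icc 0 m.T] t, ∀ i,
      Matrix.vecMul (Matrix.vecMul ((1 - ε) • y) (m.σ t)) (m.σ s)⁻¹ i < M := by
  refine eventually_all.2 fun i => ?_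
  have hc := ((continuous_apply i).comp_continuousOn
    (m.continuousOn_vecMul_inv (Matrix.vecMul ((1 - ε) • y) (m.σ t)))) t ht
  refine hc.eventually (gt_mem_nhds ?_)
  simp only [Function.comp_apply, m.vecMul_vecMul_inv _ ht, Pi.smul_apply, smul_eq_mul]
  nlinarith [hy i, hε.1, hε.2, mul_le_mul_of_nonneg_left (hy i) (sub_pos.2 hε.2).le]

lemma Market.eventually_abs_le (m : Market d) {t : ℝ} (ht : t ∈ Icc 0 m.T) {y : Fin d → ℝ}
    (hM : 0 < M) (hy : ∀ i, |y i| ≤ M) {ε : ℝ} (hε : ε ∈ Ioo (0 : ℝ) 1) :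
    ∀ᶠ s in 𝓝[Icc 0 m.T] t, ∀ i,
      |Matrix.vecMul (Matrix.vecMul ((1 - ε) • y) (m.σ t)) (m.σ s)⁻¹ i| ≤ M := by
  filter_upwards [m.eventually_lt ht hM (fun i => (abs_le.1 (hy i)).2) hε,
    m.eventually_lt ht hM (y := -y) (fun i => neg_le.1 (abs_le.1 (hy i)).1) hε] with s h1 h2 i
  have h2 := h2 i
  simp only [smul_neg, Matrix.neg_vecMul, Pi.neg_apply] at h2
  exact abs_le.2 ⟨by linarith, (h1 i).le⟩

lemma Market.eventually_nonneg_le {m : Market 1} {t : ℝ} (ht : t ∈ Icc 0 m.T) {y : Fin 1 → ℝ}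
    (hM : 0 < M) (hy : ∀ i, 0 ≤ y i ∧ y i ≤ M) {ε : ℝ} (hε : ε ∈ Ioo (0 : ℝ) 1) :
    ∀ᶠ s in 𝓝[Icc 0 m.T] t, ∀ i,
      0 ≤ Matrix.vecMul (Matrix.vecMul ((1 - ε) • y) (m.σ t)) (m.σ s)⁻¹ i ∧
      Matrix.vecMul (Matrix.vecMul ((1 - ε) • y) (m.σ t)) (m.σ s)⁻¹ i ≤ M := by
  filter_upwards [m.eventually_lt ht hM (fun i => (hy i).2) hε, self_mem_nhdsWithin] with s h1 hs i
  refine ⟨?_, (h1 i).le⟩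
  have h2 := congrFun (m.vecMul_inv_vecMul (Matrix.vecMul ((1 - ε) • y) (m.σ t)) hs) 0
  rw [Subsingleton.elim i 0]
  set w := Matrix.vecMul (Matrix.vecMul ((1 - ε) • y) (m.σ t)) (m.σ s)⁻¹
  simp only [Matrix.vecMul, dotProduct, Fin.sum_univ_one, Fin.isValue, Pi.smul_apply,
    smul_eq_mul] at h2
  refine nonneg_of_mul_nonneg_left (h2.ge.trans' ?_) (m.σ_pos s hs 0 0)
  exact mul_nonneg (mul_nonneg (sub_pos.2 hε.2).le (hy 0).1) (m.σ_pos t ht 0 0).le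

lemma exists_smul_abs_le (hM : 0 < M) (z : Fin d → ℝ) : ∃ c : ℝ, 0 < c ∧ ∀ i, |(c • z) i| ≤ M := by
  have hn := norm_nonneg z
  refine ⟨M / (1 + ‖z‖), by positivity, fun i => ?_⟩
  rw [Pi.smul_apply, smul_eq_mul, abs_mul, abs_of_nonneg (by positivity), div_mul_eq_mul_div,
    div_le_iff₀ (by positivity)]
  have := norm_le_pi_norm z i
  rw [Real.norm_eq_abs] at this
  nlinarith

end Positions

end StableMarket

theorem proposition5p3 {Ω : Type*} [MeasurableSpace Ω] (P : Measure Ω) [IsProbabilityMeasure P]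
    {d : ℕ} (α M : ℝ) (hM : 0 < M)
    (L : ℝ → Ω → Fin d → ℝ) (hL : StableMarket.IsStableLevy P α L)
    (m : StableMarket.Market d) (pr : StableMarket.Preferences Ω)
    -- the admissible positions: either the noise is symmetric, or there is a single risky asset
    -- and short selling is prohibited
    (K : Set (Fin d → ℝ))
    (hK : (StableMarket.IsSymmetric P L ∧ K = {y | ∀ i, |y i| ≤ M}) ∨
      (d = 1 ∧ K = {y | ∀ i, 0 ≤ y i ∧ y i ≤ M}))
    -- the target function, the penalty function, the risk aversion and the risk measure
    (hU : ContDiff ℝ 1 pr.U) (hU_mono : Monotone pr.U) (hU_conc : ConcaveOn ℝ univ pr.U)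
    (hF : ContDiff ℝ 1 pr.F) (hF_mono : Monotone pr.F) (hF_conv : ConvexOn ℝ univ pr.F)
    (hlam_pos : ∀ t ∈ Icc 0 m.T, 0 < pr.lam t) (hlam : ContDiffOn ℝ 1 pr.lam (Icc 0 m.T))
    (hρ : StableMarket.IsRiskMeasure P pr.ρ)
    (hρ_fin : ∀ j, pr.ρ (fun ω => L 1 ω j) < ⊤)
    -- the integrability conditions
    (hint : ∀ j, ∀ t ∈ Ioc 0 m.T, ∀ a b : ℝ, Integrable (fun ω => pr.U (a + b * L t ω j)) P)
    (hint' : ∀ j, ∀ t ∈ Ioc 0 m.T, ∀ a b : ℝ,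
      Integrable (fun ω => L t ω j * deriv pr.U (a + b * L t ω j)) P)
    -- the continuous optimal control and its wealth processes from all states
    (v : ℝ → Fin d → ℝ) (hv : StableMarket.IsEquilibrium P L m pr K v)
    (hv_cont : ContinuousOn v (Icc 0 m.T))
    (X : ℝ → ℝ → ℝ → Ω → ℝ)
    (hX : ∀ t ∈ Ico 0 m.T, ∀ x, StableMarket.IsWealth P L m v t x (X t x)) :
    (∀ t ∈ Ico 0 m.T, ∀ x,
      pr.ρ (StableMarket.gain m t x (X t x m.T)) ≠ ⊥ ∧
      pr.ρ (StableMarket.gain m t x (X t x m.T)) ≠ ⊤ ∧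
      Integrable (fun ω => pr.U (StableMarket.gain m t x (X t x m.T) ω)) P) ∧
    StableMarket.IsC12On m.T (fun t x => StableMarket.riskPenalty m pr t x (X t x m.T)) ∧
    StableMarket.IsC12On m.T (fun t x => StableMarket.expectedTarget P m pr t x (X t x m.T)) := by
  have hα := hL.alpha_pos
  have hT := m.T_pos
  have hT0 : m.T ∈ Ioc 0 m.T := ⟨hT, le_rfl⟩
  obtain ⟨j, hj⟩ := hL.exists_coord
  set Z : Ω → ℝ := fun ω => L 1 ω j with hZdef
  have hZ : Measurable Z := hL.measurable_coord j
  obtain ⟨χ, hχ, hrisk⟩ := hρ.exists_affine hZ.aemeasurable (hρ_fin j)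
  have htarget : StableMarket.IsTarget P pr.U Z :=
    hL.isTarget hU hU_mono hU_conc hT j (hint j m.T hT0) (hint' j m.T hT0)
  have hrisk' : ∀ (Y : Ω → ℝ) (a b : ℝ), 0 ≤ b → IdentDistrib Y (fun ω => a + b * Z ω) P P →
      pr.ρ Y = (((pr.ρ Z).toReal * b - χ * a : ℝ) : EReal) := fun Y a b hb hid =>
    (hρ.law_invariant _ _ hid).trans (hrisk a b hb)
  rcases hK with ⟨hsymm, rfl⟩ | ⟨rfl, rfl⟩
  · obtain ⟨hscale, hlog⟩ := hL.isScale_of_symmetric hsymm j hj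
    have hbox : ∀ y : Fin d → ℝ, (∀ i, |y i| ≤ M) ↔ ∀ i, -M ≤ y i ∧ y i ≤ M := fun y =>
      forall_congr' fun i => abs_le
    refine StableMarket.IsProblem.regular (χ := χ) (C := univ) (ψ := _) (K := {y | ∀ i, |y i| ≤ M})
      (L := L) (v := v) ⟨hL.toIsLevy, hL.one_lt, hscale, htarget, hL.integral_coord_eq_zero j, hF,
        hF_mono, hF_conv, hlam_pos, hlam, hχ, hrisk', fun i => ?_, ?_, fun _ _ _ _ => mem_univ _,
        fun t ht y hy ε hε => m.eventually_abs_le ht hM hy hε, fun t ht => ?_,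
        Or.inl ⟨fun y hy i => ?_, fun H => ?_⟩, hv, hv_cont, fun t ht => ⟨_, hX t ht 0⟩⟩ hX
    · simpa using hM.le
    · obtain ⟨R, hR, hRK, hRe⟩ := StableMarket.exists_retract_box (d := d) (neg_le_self hM.le)
      exact ⟨R, hR, fun y => (hbox _).2 (hRK y), fun y hy => hRe y ((hbox _).1 hy)⟩
    · obtain ⟨c, hc, hcM⟩ := StableMarket.exists_smul_abs_le hM
        (Matrix.vecMul (Pi.single j 1) (m.σ t)⁻¹)
      refine ⟨_, hcM, ?_⟩
      rw [Matrix.smul_vecMul, m.vecMul_inv_vecMul _ ht, hscale.map_smul c hc.le,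
        div_self hlog.ne, mul_one]
      exact Real.rpow_pos_of_pos hc _
    · rw [Pi.neg_apply, abs_neg]
      exact hy i
    · rw [StableMarket.cosTransform_neg]
  · have hvec : ∀ t (y : Fin 1 → ℝ), Matrix.vecMul y (m.σ t) j = y j * m.σ t j j := fun t y => by
      rw [Subsingleton.elim j 0]
      simp [Matrix.vecMul, dotProduct]
    refine StableMarket.IsProblem.regular (χ := χ) (C := {H | ∀ i, 0 ≤ H i})
      (ψ := fun H => |H j| ^ α) (K := {y | ∀ i, 0 ≤ y i ∧ y i ≤ M}) (L := L) (v := v)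
      ⟨hL.toIsLevy, hL.one_lt, hL.isScale_of_one rfl j, htarget, hL.integral_coord_eq_zero j, hF,
        hF_mono, hF_conv, hlam_pos, hlam, hχ, hrisk', fun i => ⟨le_rfl, hM.le⟩,
        StableMarket.exists_retract_box hM.le, fun t ht y hy i => ?_,
        fun t ht y hy ε hε => StableMarket.Market.eventually_nonneg_le ht hM hy hε,
        fun t ht => ⟨fun _ => M, fun i => ⟨hM.le, le_rfl⟩, ?_⟩,
        Or.inr ⟨fun t ht y hy h0 => ?_, ?_⟩, hv, hv_cont, fun t ht => ⟨_, hX t ht 0⟩⟩ hX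
    · rw [Subsingleton.elim i j, hvec]
      exact mul_nonneg (hy j).1 (m.σ_pos t ht j j).le
    · rw [hvec]
      exact Real.rpow_pos_of_pos (abs_pos.2 (mul_pos hM (m.σ_pos t ht j j)).ne') _
    · rw [hvec, Real.rpow_eq_zero (abs_nonneg _) hα.ne', abs_eq_zero] at h0
      funext i
      rw [Subsingleton.elim i j]
      exact (mul_eq_zero.1 h0).resolve_right (m.σ_pos t ht j j).ne'
    · have hsmall : ∀ᶠ y : Fin 1 → ℝ in 𝓝 0, y j < M / 2 :=
        (continuous_apply j).continuousAt.eventually (gt_mem_nhds (by simpa using hM))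
      filter_upwards [self_mem_nhdsWithin, nhdsWithin_le_nhds hsmall] with y hy hy2 i
      rw [Subsingleton.elim i j, Pi.smul_apply, smul_eq_mul]
      exact ⟨mul_nonneg zero_le_two (hy j).1, by linarith⟩
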